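/- Let $d\ge 2$, let $D\subset\mathbb R^d$ be a bounded Lipschitz domain, $\lambda,\beta>0$, $r>d/2-1$ and $s>d/2$. Let $\dot W$ be Gaussian white noise on $D$, that is, an $H^{-s}(D)$-valued zero mean Gaussian random variable on a probability space $(\Omega,\Sigma,P)$ with $\mathbb E\langle\dot W,\varphi\rangle\langle\dot W,\psi\rangle=\int_D\varphi\psi\,dx$ for all $\varphi,\psi\in C_c^\infty(D)$. Let $B$ be one of the boundary operators $Bu=u|_{\partial D}$ (Dirichlet), $Bu=\partial_nu$ (Neumann), $Bu=\partial_nu+\beta u|_{\partial D}$ (Robin), defined for $u\in H^1(D)$ with $\Delta u\in L^2(D)$ and with values in $H^{-1/2}(\partial D)$; here $\partial_n u$ is the conormal derivative, $\langle\partial_nu,w|_{\partial D}\rangle=\int_D\nabla u\cdot\nabla w+(\Delta u)\,w\,dx$. Fix an orthonormal basis $(f_k)$ of $H^{-1/2}(\partial D)$ and let $H_{sc}(\partial D)$ be the completion of $H^{-1/2}(\partial D)$ in the norm $\|u\|_{sc}^2=\sum_{k\ge1}k^{-2}(u,f_k)^2_{H^{-1/2}(\partial D)}$. For a zero mean Gaussian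 measure $\mu$ on a separable Hilbert space $\mathbb B$, let $\mathbb B^*_\mu$ be the closure of $\mathbb B^*$ in $L^2(\mu)$. The Cameron--Martin space $H_\mu$ consists of the elements $h=\int\widehat h(b)\,b\,\mu(db)$, $\widehat h\in\mathbb B^*_\mu$, with inner product $(h,g)_{H_\mu}=\int\widehat h\,\widehat g\,d\mu$. The measurable linear extension of an operator $S$ on $H_\mu$ is the $\mu$-measurable linear operator $\widehat S b=\sum_k\widehat e_k(b)\,Se_k$ ($\mu$-a.e. $b$), where $(e_k)$ is an orthonormal basis of $H_\mu$. A zero mean Gaussian $H^{-r}(D)$-valued random variable $X$ with law $\mu_X$ is called a solution of the stochastic boundary value problem if 1. $H_{\mu_X}$ is continuously embedded in $H^1(D)$ and $\Delta h\in L^2(D)$ for all $h\in H_{\mu_X}$; 2. almost surely $-\Delta X+\lambda X=\dot W$ in the sense of generalized functions on $D$; 3. almost surely $\widehat BX=0$ in $H_{sc}(\partial D)$, that is, $\widehat{Tr}X=0$, respectively $\widehat{\partial_n}X=0$, respectively $\widehat{\partial_n}X+\beta\,\widehat{Tr}X=0$, where $\widehat{Tr}X=\sum_k\widehat e_k(X)\,e_k|_{\partial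 D}$ and $\widehat{\partial_n}X=\sum_k\widehat e_k(X)\,\partial_ne_k$ for an orthonormal basis $(e_k)$ of $H_{\mu_X}$. Then: - For every $f\in L^2(D)$ the problem $-\Delta u+\lambda u=f$ in $D$, $Bu=0$ on $\partial D$, has exactly one solution $u=:Tf\in H^1(D)$, and $T:L^2(D)\to H^1(D)$ is linear and continuous. - The Cameron--Martin space of $\dot W$ is $L^2(D)$, and $T$ has a measurable linear extension $\widehat T:H^{-s}(D)\to H^{-r}(D)$ with respect to the law of $\dot W$ (the series converges almost everywhere to $\widehat T$ for every orthonormal basis of $L^2(D)$). - $\widehat T\dot W$ is a solution of the stochastic boundary value problem, and every solution $X$ satisfies $X=\widehat T\dot W$ almost surely. -/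

import Mathlib

open MeasureTheory ProbabilityTheory Filter Topology TopologicalSpace
open scoped ENNReal NNReal Distributions LineDeriv FourierTransform InnerProductSpace
open scoped SchwartzMap

noncomputable section

namespace WhiteNoiseBVP

/-! ### Domains -/

/-- The Euclidean space `ℝ^d`. -/
abbrev Rd (d : ℕ) : Type := EuclideanSpace ℝ (Fin d)

variable {d : ℕ}

/-- A (nonempty) bounded Lipschitz domain: near each boundary point, after a rotation that turns
the unit vector `e` into the last coordinate direction, the set is the region strictly below the
graph of a Lipschitz function `γ` of the remaining coordinates `x - ⟪x, e⟫ e`.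
Connectedness is not imposed. -/
structure IsBoundedLipschitzDomain (D : Opens (Rd d)) : Prop where
  nonempty : (D : Set (Rd d)).Nonempty
  bounded : Bornology.IsBounded (D : Set (Rd d))
  locally_graph : ∀ x₀ ∈ frontier (D : Set (Rd d)),
    ∃ (e : Rd d) (γ : Rd d → ℝ) (K : ℝ≥0) (ε : ℝ), ‖e‖ = 1 ∧ LipschitzWith K γ ∧ 0 < ε ∧
      ∀ x ∈ Metric.ball x₀ ε, x ∈ D ↔ ⟪x, e⟫_ℝ < γ (x - ⟪x, e⟫_ℝ • e)

/-- The surface measure on `∂D`: the normalised `(d-1)`-dimensional Hausdorff measure. -/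
def surfaceMeasure (D : Opens (Rd d)) : Measure (Rd d) :=
  (Measure.euclideanHausdorffMeasure (d - 1)).restrict (frontier (D : Set (Rd d)))

/-- The space `L²(D)`. -/
abbrev L2 (D : Opens (Rd d)) : Type :=
  Lp ℝ 2 ((volume : Measure (Rd d)).restrict (D : Set (Rd d)))

/-- The space `L²(D; ℝ^d)` of square integrable vector fields. -/
abbrev L2Vec (D : Opens (Rd d)) : Type :=
  Lp (Rd d) 2 ((volume : Measure (Rd d)).restrict (D : Set (Rd d)))

/-- The space `L²(∂D)`. -/
abbrev L2Boundary (D : Opens (Rd d)) : Type := Lp ℝ 2 (surfaceMeasure D)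

/-- The Laplacian of a test function, as a test function. -/
def testLaplacian {D : Opens (Rd d)} (φ : 𝓓(D, ℝ)) : 𝓓(D, ℝ) :=
  ∑ i : Fin d, ∂_{EuclideanSpace.single i (1 : ℝ)} (∂_{EuclideanSpace.single i (1 : ℝ)} φ)

/-! ### The Sobolev space `H¹(D)` -/

theorem testFunction_memLp {D : Opens (Rd d)} (φ : 𝓓(D, ℝ)) (μ : Measure (Rd d))
    [IsFiniteMeasureOnCompacts μ] : MemLp φ 2 μ :=
  φ.continuous.memLp_of_hasCompactSupport φ.hasCompactSupport

theorem integrable_mul_test {D : Opens (Rd d)} (u : L2 D) (φ : 𝓓(D, ℝ)) :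
    Integrable (fun x => u x * φ x) (volume.restrict (D : Set (Rd d))) :=
  (Lp.memLp u).integrable_mul (testFunction_memLp φ _)

theorem integrable_inner_mul_test {D : Opens (Rd d)} (g : L2Vec D) (v : Rd d) (φ : 𝓓(D, ℝ)) :
    Integrable (fun x => ⟪g x, v⟫_ℝ * φ x) (volume.restrict (D : Set (Rd d))) :=
  ((Lp.memLp g).inner_const v).integrable_mul (testFunction_memLp φ _)

/-- The pairs `(u, g)` with `u ∈ L²(D)` and `g ∈ L²(D; ℝ^d)` the weak gradient of `u`. -/
def H1Sub (D : Opens (Rd d)) : Submodule ℝ (WithLp 2 (L2 D × L2Vec D)) where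
  carrier := {p | ∀ (φ : 𝓓(D, ℝ)) (v : Rd d),
    ∫ x in (D : Set (Rd d)), p.fst x * (∂_{v} φ) x
      = -∫ x in (D : Set (Rd d)), ⟪p.snd x, v⟫_ℝ * φ x}
  zero_mem' := by
    intro φ v
    have h1 : (fun x => (0 : WithLp 2 (L2 D × L2Vec D)).fst x * (∂_{v} φ) x)
        =ᵐ[volume.restrict (D : Set (Rd d))] fun _ => 0 := by
      filter_upwards [Lp.coeFn_zero ℝ 2 (volume.restrict (D : Set (Rd d)))] with x hx
      rw [WithLp.zero_fst, hx, Pi.zero_apply, zero_mul]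
    have h2 : (fun x => ⟪(0 : WithLp 2 (L2 D × L2Vec D)).snd x, v⟫_ℝ * φ x)
        =ᵐ[volume.restrict (D : Set (Rd d))] fun _ => 0 := by
      filter_upwards [Lp.coeFn_zero (Rd d) 2 (volume.restrict (D : Set (Rd d)))] with x hx
      rw [WithLp.zero_snd, hx, Pi.zero_apply, inner_zero_left, zero_mul]
    rw [integral_congr_ae h1, integral_congr_ae h2, integral_zero, neg_zero]
  add_mem' := by
    intro p q hp hq φ v
    have h1 : (fun x => (p + q).fst x * (∂_{v} φ) x) =ᵐ[volume.restrict (D : Set (Rd d))]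
        fun x => p.fst x * (∂_{v} φ) x + q.fst x * (∂_{v} φ) x := by
      filter_upwards [Lp.coeFn_add p.fst q.fst] with x hx
      rw [WithLp.add_fst, hx, Pi.add_apply, add_mul]
    have h2 : (fun x => ⟪(p + q).snd x, v⟫_ℝ * φ x) =ᵐ[volume.restrict (D : Set (Rd d))]
        fun x => ⟪p.snd x, v⟫_ℝ * φ x + ⟪q.snd x, v⟫_ℝ * φ x := by
      filter_upwards [Lp.coeFn_add p.snd q.snd] with x hx
      rw [WithLp.add_snd, hx, Pi.add_apply, inner_add_left, add_mul]
    rw [integral_congr_ae h1, integral_congr_ae h2,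
      integral_add (integrable_mul_test _ _) (integrable_mul_test _ _),
      integral_add (integrable_inner_mul_test _ _ _) (integrable_inner_mul_test _ _ _),
      hp φ v, hq φ v, neg_add]
  smul_mem' := by
    intro c p hp φ v
    have h1 : (fun x => (c • p).fst x * (∂_{v} φ) x) =ᵐ[volume.restrict (D : Set (Rd d))]
        fun x => c * (p.fst x * (∂_{v} φ) x) := by
      filter_upwards [Lp.coeFn_smul c p.fst] with x hx
      rw [WithLp.smul_fst, hx, Pi.smul_apply, smul_eq_mul, mul_assoc]
    have h2 : (fun x => ⟪(c • p).snd x, v⟫_ℝ * φ x) =ᵐ[volume.restrict (D : Set (Rd d))]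
        fun x => c * (⟪p.snd x, v⟫_ℝ * φ x) := by
      filter_upwards [Lp.coeFn_smul c p.snd] with x hx
      rw [WithLp.smul_snd, hx, Pi.smul_apply, real_inner_smul_left, mul_assoc]
    rw [integral_congr_ae h1, integral_congr_ae h2, integral_const_mul, integral_const_mul,
      hp φ v, mul_neg]

/-- The Sobolev space `H¹(D)`: pairs `(u, ∇u)` with `u ∈ L²(D)` and weak gradient
`∇u ∈ L²(D; ℝ^d)`, with the norm `(‖u‖² + ‖∇u‖²)^(1/2)`. -/
def H1 (D : Opens (Rd d)) : Type := H1Sub D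

instance (D : Opens (Rd d)) : NormedAddCommGroup (H1 D) :=
  inferInstanceAs (NormedAddCommGroup (H1Sub D))

instance (D : Opens (Rd d)) : InnerProductSpace ℝ (H1 D) :=
  inferInstanceAs (InnerProductSpace ℝ (H1Sub D))

/-- The inclusion `H¹(D) → L²(D)`. -/
def H1.toL2 (D : Opens (Rd d)) : H1 D →L[ℝ] L2 D :=
  (WithLp.fstL 2 ℝ (L2 D) (L2Vec D)).comp (H1Sub D).subtypeL

/-- The weak gradient `H¹(D) → L²(D; ℝ^d)`. -/
def H1.grad (D : Opens (Rd d)) : H1 D →L[ℝ] L2Vec D :=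
  (WithLp.sndL 2 ℝ (L2 D) (L2Vec D)).comp (H1Sub D).subtypeL

/-- `g = Δ u` in the sense of generalized functions on `D`. -/
def HasLaplacian {D : Opens (Rd d)} (u g : L2 D) : Prop :=
  ∀ φ : 𝓓(D, ℝ), ∫ x in (D : Set (Rd d)), g x * φ x
    = ∫ x in (D : Set (Rd d)), u x * testLaplacian φ x

open Classical in
/-- `Δ u` for `u ∈ L²(D)` with `Δ u ∈ L²(D)` (and `0` if `Δ u ∉ L²(D)`). -/
def laplacian {D : Opens (Rd d)} (u : L2 D) : L2 D :=
  if h : ∃ g, HasLaplacian u g then h.choose else 0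

/-! ### Boundary operators -/

/-- `τ` is a bounded operator `H¹(D) → L²(∂D)` which maps the restriction to `D` of a smooth
function `ψ` on `ℝ^d` to the restriction of `ψ` to `∂D`. -/
def IsTraceOperator (D : Opens (Rd d)) (τ : H1 D →L[ℝ] L2Boundary D) : Prop :=
  ∀ ψ : Rd d → ℝ, ContDiff ℝ (⊤ : ℕ∞) ψ → HasCompactSupport ψ → ∀ u : H1 D,
    (H1.toL2 D u =ᵐ[volume.restrict (D : Set (Rd d))] ψ) → τ u =ᵐ[surfaceMeasure D] ψ

open Classical in
/-- The trace operator `Tr`: the continuous linear extension of `u ↦ u|_∂D` from smooth functions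
to `H¹(D)` (it exists and is unique on bounded Lipschitz domains; `0` if there is none). -/
def trace (D : Opens (Rd d)) : H1 D →L[ℝ] L2Boundary D :=
  if h : ∃ τ, IsTraceOperator D τ then h.choose else 0

/-- The space `H^{1/2}(∂D)`, i.e. the range of the trace with the quotient norm
`‖g‖ = inf {‖u‖_{H¹(D)} : Tr u = g}`. A boundary function `g` is stored as the unique element of
least norm in `Tr⁻¹ {g}`, that is, the one orthogonal to the kernel of the trace. -/
abbrev HHalf (D : Opens (Rd d)) : Submodule ℝ (H1 D) := (trace D).kerᗮ

/-- The space `H^{-1/2}(∂D)`, the dual of `H^{1/2}(∂D)`. -/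
abbrev HNegHalf (D : Opens (Rd d)) : Type := StrongDual ℝ (HHalf D)

/-- The inclusion `L²(∂D) → H^{-1/2}(∂D)`, `g ↦ (Tr w ↦ ∫_∂D g · Tr w dσ)`. -/
def boundaryIncl (D : Opens (Rd d)) (g : L2Boundary D) : HNegHalf D :=
  (innerSL ℝ g).comp ((trace D).comp (HHalf D).subtypeL)

/-- The conormal derivative `∂ₙ u ∈ H^{-1/2}(∂D)` of `u ∈ H¹(D)` with `Δ u ∈ L²(D)`:
`⟨∂ₙ u, Tr w⟩ = ∫_D ∇u · ∇w + (Δ u) w dx`. -/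
def conormal (D : Opens (Rd d)) (u : H1 D) : HNegHalf D :=
  ((innerSL ℝ (H1.grad D u)).comp (H1.grad D)
    + (innerSL ℝ (laplacian (H1.toL2 D u))).comp (H1.toL2 D)).comp (HHalf D).subtypeL

/-- The type of the boundary condition. -/
inductive BoundaryCondition : Type
  | dirichlet
  | neumann
  | robin

/-- The boundary operator `B`: `Tr u`, `∂ₙ u` or `∂ₙ u + β Tr u`, as an element of
`H^{-1/2}(∂D)`. -/
def boundaryOp (D : Opens (Rd d)) (β : ℝ) : BoundaryCondition → H1 D → HNegHalf D
  | .dirichlet, u => boundaryIncl D (trace D u)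
  | .neumann, u => conormal D u
  | .robin, u => conormal D u + β • boundaryIncl D (trace D u)

/-- `u ∈ H¹(D)` solves `-Δ u + λ u = f` in `D` (in the sense of generalized functions) and
`B u = 0` on `∂D`. -/
def SolvesBVP (D : Opens (Rd d)) (lam β : ℝ) (bc : BoundaryCondition) (f : L2 D) (u : H1 D) :
    Prop :=
  HasLaplacian (H1.toL2 D u) (lam • H1.toL2 D u - f) ∧ boundaryOp D β bc u = 0

/-! ### The scale space `H_sc(∂D)`

By the Riesz theorem, the orthonormal bases `(f_k)` of the Hilbert space `H^{-1/2}(∂D)` are the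
images of the orthonormal bases `(g_k)` of `H^{1/2}(∂D)`, and
`(u, f_k)_{H^{-1/2}(∂D)} = ⟨u, g_k⟩`. -/

theorem memlp_scale {D : Opens (Rd d)} (g : HilbertBasis ℕ ℝ (HHalf D)) (u : HNegHalf D) :
    Memℓp (fun k : ℕ => ((k : ℝ) + 1)⁻¹ * u (g k)) 2 := by
  have hs : Summable fun k : ℕ => (1 : ℝ) / ((k : ℝ) + 1) ^ 2 := by
    have := (summable_nat_add_iff 1).2 (Real.summable_one_div_nat_pow.2 (one_lt_two))
    simpa using this
  refine memℓp_gen ?_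
  refine Summable.of_nonneg_of_le (fun k => by positivity) (fun k => ?_) (hs.mul_left (‖u‖ ^ 2))
  have h1 : ‖u (g k)‖ ≤ ‖u‖ := by
    simpa [g.orthonormal.1 k] using u.le_opNorm (g k)
  have h2 : ‖u (g k)‖ ^ 2 ≤ ‖u‖ ^ 2 := by gcongr
  have h3 : ‖((k : ℝ) + 1)⁻¹ * u (g k)‖ ^ (2 : ℝ≥0∞).toReal
      = ‖u (g k)‖ ^ 2 * (1 / ((k : ℝ) + 1) ^ 2) := by
    simp [norm_mul, mul_pow, mul_comm]
  rw [h3]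
  gcongr

/-- `u ↦ (k⁻¹ (u, f_k))_{k ≥ 1}`, a linear map of `H^{-1/2}(∂D)` into `ℓ²` with
`‖scaleMap u‖² = ∑ k⁻² (u, f_k)² = ‖u‖_sc²`. -/
def scaleMap {D : Opens (Rd d)} (g : HilbertBasis ℕ ℝ (HHalf D)) :
    HNegHalf D →ₗ[ℝ] lp (fun _ : ℕ => ℝ) 2 where
  toFun u := ⟨fun k => ((k : ℝ) + 1)⁻¹ * u (g k), memlp_scale g u⟩
  map_add' u v := by
    apply lp.ext
    funext k
    change ((k : ℝ) + 1)⁻¹ * (u (g k) + v (g k))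
      = ((k : ℝ) + 1)⁻¹ * u (g k) + ((k : ℝ) + 1)⁻¹ * v (g k)
    ring
  map_smul' c u := by
    apply lp.ext
    funext k
    change ((k : ℝ) + 1)⁻¹ * (c * u (g k)) = c * (((k : ℝ) + 1)⁻¹ * u (g k))
    ring

/-- `H_sc(∂D)`: the closure of (the isometric image of) `H^{-1/2}(∂D)` with the norm
`‖·‖_sc`. -/
abbrev Hsc {D : Opens (Rd d)} (g : HilbertBasis ℕ ℝ (HHalf D)) :
    Submodule ℝ (lp (fun _ : ℕ => ℝ) 2) :=
  (LinearMap.range (scaleMap g)).topologicalClosure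

/-- The inclusion `H^{-1/2}(∂D) → H_sc(∂D)`. -/
def scaleIncl {D : Opens (Rd d)} (g : HilbertBasis ℕ ℝ (HHalf D)) (u : HNegHalf D) : Hsc g :=
  ⟨scaleMap g u, Submodule.le_topologicalClosure _ (LinearMap.mem_range_self _ u)⟩

/-! ### The Sobolev spaces `H^{-r}(D)` -/

/-- The complexification of a test function, as a Schwartz function. -/
def testSchwartz {D : Opens (Rd d)} (φ : 𝓓(D, ℝ)) : 𝓢(Rd d, ℂ) :=
  HasCompactSupport.toSchwartzMap (f := fun x => ((φ x : ℝ) : ℂ))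
    (φ.hasCompactSupport.comp_left (g := fun t : ℝ => (t : ℂ)) Complex.ofReal_zero)
    (Complex.ofRealCLM.contDiff.comp φ.contDiff)

/-- `(1 + |ξ|²)^{r/2} φ̂(ξ)`, where `φ̂` is the Fourier transform of `φ`. -/
def weightedFourier {D : Opens (Rd d)} (r : ℝ) (φ : 𝓓(D, ℝ)) (ξ : Rd d) : ℂ :=
  (((1 + ‖ξ‖ ^ 2) ^ (r / 2) : ℝ) : ℂ) * 𝓕 (fun x => ((φ x : ℝ) : ℂ)) ξ

theorem memLp_weightedFourier {D : Opens (Rd d)} (r : ℝ) (φ : 𝓓(D, ℝ)) :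
    MemLp (weightedFourier r φ) 2 (volume : Measure (Rd d)) := by
  have hg : Function.HasTemperateGrowth
      (fun ξ : Rd d => (((1 + ‖ξ‖ ^ 2) ^ (r / 2) : ℝ) : ℂ)) := by
    fun_prop
  have h := (SchwartzMap.smulLeftCLM ℂ (fun ξ : Rd d => (((1 + ‖ξ‖ ^ 2) ^ (r / 2) : ℝ) : ℂ))
    (𝓕 (testSchwartz φ))).memLp 2 (volume : Measure (Rd d))
  rw [SchwartzMap.smulLeftCLM_apply hg] at h
  exact h

/-- The test functions `C_c^∞(D)`, to be equipped with the norm of `H^r(ℝ^d)`. -/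
def TestH (_r : ℝ≥0) (D : Opens (Rd d)) : Type := 𝓓(D, ℝ)

instance (r : ℝ≥0) (D : Opens (Rd d)) : AddCommGroup (TestH r D) :=
  inferInstanceAs (AddCommGroup 𝓓(D, ℝ))

instance (r : ℝ≥0) (D : Opens (Rd d)) : Module ℝ (TestH r D) :=
  inferInstanceAs (Module ℝ 𝓓(D, ℝ))

/-- A test function as an element of `TestH r D`. -/
def TestH.of (r : ℝ≥0) {D : Opens (Rd d)} : 𝓓(D, ℝ) ≃ₗ[ℝ] TestH r D :=
  LinearEquiv.refl ℝ 𝓓(D, ℝ)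

theorem weightedFourier_eq {D : Opens (Rd d)} (r : ℝ) (φ : 𝓓(D, ℝ)) (ξ : Rd d) :
    weightedFourier r φ ξ
      = (((1 + ‖ξ‖ ^ 2) ^ (r / 2) : ℝ) : ℂ) * (𝓕 (testSchwartz φ)) ξ := rfl

theorem weightedFourier_add {D : Opens (Rd d)} (r : ℝ) (φ ψ : 𝓓(D, ℝ)) :
    weightedFourier r (φ + ψ) = weightedFourier r φ + weightedFourier r ψ := by
  have h : testSchwartz (φ + ψ) = testSchwartz φ + testSchwartz ψ := by
    ext x
    exact Complex.ofReal_add _ _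
  funext ξ
  rw [Pi.add_apply, weightedFourier_eq, weightedFourier_eq, weightedFourier_eq, h,
    FourierTransform.fourier_add]
  exact mul_add _ _ _

theorem weightedFourier_smul {D : Opens (Rd d)} (r : ℝ) (c : ℝ) (φ : 𝓓(D, ℝ)) :
    weightedFourier r (c • φ) = c • weightedFourier r φ := by
  have h : testSchwartz (c • φ) = (c : ℂ) • testSchwartz φ := by
    ext x
    exact Complex.ofReal_mul _ _
  funext ξ
  rw [Pi.smul_apply, weightedFourier_eq, weightedFourier_eq, h, FourierTransform.fourier_smul,
    Complex.real_smul]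
  exact mul_left_comm _ _ _

/-- The linear embedding `φ ↦ (1 + |ξ|²)^{r/2} φ̂` into `L²(ℝ^d; ℂ)`. -/
def TestH.toLp (r : ℝ≥0) (D : Opens (Rd d)) :
    TestH r D →ₗ[ℝ] Lp ℂ 2 (volume : Measure (Rd d)) where
  toFun φ := (memLp_weightedFourier r ((TestH.of r).symm φ)).toLp
  map_add' φ ψ := by
    rw [← MemLp.toLp_add]
    exact MemLp.toLp_congr _ _ (by rw [map_add, weightedFourier_add])
  map_smul' c φ := by
    rw [RingHom.id_apply, ← MemLp.toLp_const_smul]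
    exact MemLp.toLp_congr _ _ (by rw [map_smul, weightedFourier_smul])

theorem weightedFourier_eq_zero {D : Opens (Rd d)} (r : ℝ) (φ : 𝓓(D, ℝ))
    (h : (memLp_weightedFourier r φ).toLp = 0) : φ = 0 := by
  have hae : weightedFourier r φ =ᵐ[volume] fun _ => (0 : ℂ) := by
    have h1 := (memLp_weightedFourier r φ).coeFn_toLp
    rw [h] at h1
    exact h1.symm.trans (Lp.coeFn_zero _ _ _)
  have hc : Continuous (weightedFourier r φ) := by
    have : Continuous fun ξ : Rd d => (((1 + ‖ξ‖ ^ 2) ^ (r / 2) : ℝ) : ℂ) :=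
      Complex.continuous_ofReal.comp
        (Continuous.rpow_const (by fun_prop) fun ξ => Or.inl (by positivity))
    exact this.mul (𝓕 (testSchwartz φ)).continuous
  have h0 := (hc.ae_eq_iff_eq volume continuous_const).1 hae
  have hF : 𝓕 (testSchwartz φ) = 0 := by
    ext ξ
    have h1 := congrFun h0 ξ
    rw [weightedFourier_eq] at h1
    have hp : ((1 + ‖ξ‖ ^ 2) ^ (r / 2) : ℝ) ≠ 0 := by positivity
    exact (mul_eq_zero.1 h1).resolve_left (by exact_mod_cast hp)
  have hS : testSchwartz φ = 0 := by
    have h1 : 𝓕⁻ (𝓕 (testSchwartz φ)) = testSchwartz φ :=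
      FourierTransform.fourierInv_fourier_eq (testSchwartz φ)
    rw [← h1, hF]
    exact FourierTransform.fourierInv_zero
  refine TestFunction.ext fun x => ?_
  exact Complex.ofReal_eq_zero.1 (DFunLike.congr_fun hS x)

theorem TestH.toLp_injective (r : ℝ≥0) (D : Opens (Rd d)) :
    Function.Injective (TestH.toLp r D) := by
  rw [injective_iff_map_eq_zero]
  intro φ h
  exact (LinearEquiv.map_eq_zero_iff _).1 (weightedFourier_eq_zero (r : ℝ) _ h)

/-- The norm of `H^r(ℝ^d)` on test functions: `‖φ‖² = ∫ (1 + |ξ|²)^r |φ̂(ξ)|² dξ`. -/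
instance (r : ℝ≥0) (D : Opens (Rd d)) : NormedAddCommGroup (TestH r D) :=
  NormedAddCommGroup.induced _ _ (TestH.toLp r D) (TestH.toLp_injective r D)

instance (r : ℝ≥0) (D : Opens (Rd d)) : NormedSpace ℝ (TestH r D) :=
  NormedSpace.induced ℝ _ _ (TestH.toLp r D)

/-- The Sobolev space `H^{-r}(D)`, `r ≥ 0`: the generalized functions on `D` which are bounded on
`C_c^∞(D)` in the norm of `H^r(ℝ^d)`, with the dual norm. (It is the dual of the closure of
`C_c^∞(D)` in `H^r(ℝ^d)`, and equals the space of restrictions to `D` of the elements of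
`H^{-r}(ℝ^d)`.) It carries its Borel σ-algebra. -/
abbrev HNeg (r : ℝ≥0) (D : Opens (Rd d)) : Type := StrongDual ℝ (TestH r D)

theorem norm_testFunction_le (r : ℝ≥0) {D : Opens (Rd d)} (φ : 𝓓(D, ℝ)) :
    ‖(testFunction_memLp φ (volume.restrict (D : Set (Rd d)))).toLp‖ ≤ ‖TestH.of r φ‖ := by
  have h1 : ‖(testFunction_memLp φ (volume.restrict (D : Set (Rd d)))).toLp‖
      ≤ ‖(testSchwartz φ).toLp 2 volume‖ := by
    rw [Lp.norm_toLp, SchwartzMap.norm_toLp]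
    refine ENNReal.toReal_mono ((testSchwartz φ).memLp 2 volume).2.ne ?_
    calc eLpNorm φ 2 (volume.restrict (D : Set (Rd d)))
        ≤ eLpNorm φ 2 volume := eLpNorm_mono_measure _ Measure.restrict_le_self
      _ = eLpNorm (testSchwartz φ) 2 volume :=
          eLpNorm_congr_norm_ae (ae_of_all _ fun x => (Complex.norm_real _).symm)
  have h2 : ‖(testSchwartz φ).toLp 2 volume‖ = ‖(𝓕 (testSchwartz φ)).toLp 2 volume‖ :=
    (SchwartzMap.norm_fourier_toL2_eq _).symm
  have h3 : ‖(𝓕 (testSchwartz φ)).toLp 2 volume‖ ≤ ‖TestH.of r φ‖ := by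
    change _ ≤ ‖(memLp_weightedFourier (r : ℝ) φ).toLp‖
    rw [Lp.norm_toLp, SchwartzMap.norm_toLp]
    refine ENNReal.toReal_mono (memLp_weightedFourier (r : ℝ) φ).2.ne (eLpNorm_mono fun ξ => ?_)
    rw [weightedFourier_eq, norm_mul, Complex.norm_real]
    have : (1 : ℝ) ≤ (1 + ‖ξ‖ ^ 2) ^ ((r : ℝ) / 2) :=
      Real.one_le_rpow (by nlinarith [sq_nonneg ‖ξ‖]) (by positivity)
    rw [Real.norm_of_nonneg (by positivity)]
    exact le_mul_of_one_le_left (norm_nonneg _) this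
  exact h1.trans (h2.le.trans h3)

theorem integral_test_eq_inner {D : Opens (Rd d)} (u : L2 D) (φ : 𝓓(D, ℝ)) :
    ∫ x in (D : Set (Rd d)), u x * φ x
      = ⟪u, (testFunction_memLp φ (volume.restrict (D : Set (Rd d)))).toLp⟫_ℝ := by
  rw [L2.inner_def]
  refine integral_congr_ae ?_
  filter_upwards [(testFunction_memLp φ (volume.restrict (D : Set (Rd d)))).coeFn_toLp] with x hx
  rw [hx]
  exact mul_comm _ _

/-- A function `u ∈ L²(D)` as the generalized function `φ ↦ ∫_D u φ dx`; this is the inclusion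
`L²(D) → H^{-r}(D)`. -/
def toHNeg (r : ℝ≥0) (D : Opens (Rd d)) : L2 D →L[ℝ] HNeg r D :=
  LinearMap.mkContinuous₂
    (LinearMap.mk₂ ℝ
      (fun (u : L2 D) (φ : TestH r D) => ∫ x in (D : Set (Rd d)), u x * (TestH.of r).symm φ x)
      (fun u v φ => by
        rw [integral_test_eq_inner, integral_test_eq_inner, integral_test_eq_inner,
          inner_add_left])
      (fun c u φ => by
        rw [integral_test_eq_inner, integral_test_eq_inner, real_inner_smul_left, smul_eq_mul])
      (fun u φ ψ => by
        rw [← integral_add (integrable_mul_test _ _) (integrable_mul_test _ _)]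
        exact integral_congr_ae (ae_of_all _ fun x => mul_add _ _ _))
      (fun c u φ => by
        rw [smul_eq_mul, ← integral_const_mul]
        exact integral_congr_ae (ae_of_all _ fun x => mul_left_comm _ _ _)))
    1
    (fun u φ => by
      have h := norm_testFunction_le r ((TestH.of r).symm φ)
      rw [LinearEquiv.apply_symm_apply] at h
      rw [one_mul]
      refine le_trans ?_ (mul_le_mul_of_nonneg_left h (norm_nonneg u))
      refine le_trans (le_of_eq ?_) (norm_inner_le_norm (𝕜 := ℝ) u _)
      exact congrArg norm (integral_test_eq_inner u ((TestH.of r).symm φ)))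

/-! ### Gaussian random variables and Cameron–Martin spaces -/

section Gaussian

variable {B B₂ : Type*} [NormedAddCommGroup B] [NormedSpace ℝ B] [MeasurableSpace B]
  [NormedAddCommGroup B₂] [NormedSpace ℝ B₂]

/-- `X` is a Gaussian zero mean random variable with values in `B`. -/
structure IsCenteredGaussian {Ω : Type*} [MeasurableSpace Ω] (X : Ω → B) (P : Measure Ω) :
    Prop where
  gaussian : HasGaussianLaw X P
  mean_zero : ∀ L : StrongDual ℝ B, ∫ ω, L (X ω) ∂P = 0

/-- The Cameron–Martin space `H_μ` of a zero mean Gaussian measure `μ` on `B`. Its elements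
`h = C ĥ` are stored as `ĥ`, an element of the closure `B*_μ` of the dual `B*` in `L²(μ)`; the
inner product of `h` and `g` is `∫ ĥ ĝ dμ`. -/
abbrev CameronMartin [OpensMeasurableSpace B] (μ : Measure B) : Submodule ℝ (Lp ℝ 2 μ) :=
  (LinearMap.range (StrongDual.toLp (𝕜 := ℝ) μ 2).toLinearMap).topologicalClosure

/-- The element `h = C ĥ = ∫ ĥ(b) b μ(db)` of `B`, where `C` is the covariance operator. -/
def CameronMartin.incl [OpensMeasurableSpace B] {μ : Measure B} (h : CameronMartin μ) : B :=
  ∫ b, (h : Lp ℝ 2 μ) b • b ∂μ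

/-- The partial sum `∑_{k < n} ê_k(b) S(e_k)`. -/
def extensionSum [OpensMeasurableSpace B] {μ : Measure B}
    (e : HilbertBasis ℕ ℝ (CameronMartin μ)) (S : CameronMartin μ → B₂) (b : B) (n : ℕ) : B₂ :=
  ∑ k ∈ Finset.range n, (e k : Lp ℝ 2 μ) b • S (e k)

/-- `A : B → B₂` is a `μ`-measurable linear operator: it has a proper linear version. -/
def IsMeasurableLinearOperator [MeasurableSpace B₂] (μ : Measure B) (A : B → B₂) : Prop :=
  ∃ S : B →ₗ[ℝ] B₂, AEMeasurable S μ ∧ S =ᵐ[μ] A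

/-- `A : B → B₂` is the measurable linear extension of the operator `S` on the Cameron–Martin
space of `μ`: a `μ`-measurable linear operator with `A b = ∑_k ê_k(b) S(e_k)` for `μ`-almost
every `b`, where `(e_k)` is an orthonormal basis of the Cameron–Martin space. -/
def IsMeasurableLinearExtension [OpensMeasurableSpace B] [MeasurableSpace B₂] {μ : Measure B}
    (e : HilbertBasis ℕ ℝ (CameronMartin μ)) (S : CameronMartin μ →L[ℝ] B₂) (A : B → B₂) : Prop :=
  IsMeasurableLinearOperator μ A ∧ ∀ᵐ b ∂μ, Tendsto (extensionSum e S b) atTop (𝓝 (A b))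

end Gaussian

section Stochastic

variable {Ω : Type*} [MeasurableSpace Ω]

/-- `W` is Gaussian white noise on `D`, as an `H^{-s}(D)`-valued random variable: zero mean,
Gaussian, with the identity as covariance operator. -/
structure IsWhiteNoise {s : ℝ≥0} {D : Opens (Rd d)} (W : Ω → HNeg s D) (P : Measure Ω) :
    Prop where
  gaussian : IsCenteredGaussian W P
  covariance : ∀ φ ψ : 𝓓(D, ℝ), ∫ ω, W ω (TestH.of s φ) * W ω (TestH.of s ψ) ∂P
    = ∫ x in (D : Set (Rd d)), φ x * ψ x

/-- `Z = ∑_k ê_k(X) S(e_k)` almost surely. -/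
def IsMeasurableValue {B B₂ : Type*} [NormedAddCommGroup B] [NormedSpace ℝ B] [MeasurableSpace B]
    [OpensMeasurableSpace B] [NormedAddCommGroup B₂] [NormedSpace ℝ B₂]
    (X : Ω → B) (P : Measure Ω) (e : HilbertBasis ℕ ℝ (CameronMartin (P.map X)))
    (S : CameronMartin (P.map X) → B₂) (Z : Ω → B₂) : Prop :=
  ∀ᵐ ω ∂P, Tendsto (extensionSum e S (X ω)) atTop (𝓝 (Z ω))

/-- The `μ_X`-measurable boundary condition in `H_sc(∂D)`. Here `(e_k)` is an orthonormal basis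
of the Cameron–Martin space of `X`, `J` is the inclusion of the Cameron–Martin space into
`H¹(D)`, `Z` is the measurable trace of `X` (`Tr^ X = ∑ ê_k(X) Tr e_k`) and `N` is the measurable
normal derivative of `X` (`∂ₙ^ X = ∑ ê_k(X) ∂ₙ e_k`). -/
def MeasurableBoundaryCondition {r : ℝ≥0} {D : Opens (Rd d)} (g : HilbertBasis ℕ ℝ (HHalf D))
    (β : ℝ) (X : Ω → HNeg r D) (P : Measure Ω) (J : CameronMartin (P.map X) →L[ℝ] H1 D)
    (e : HilbertBasis ℕ ℝ (CameronMartin (P.map X))) : BoundaryCondition → Prop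
  | .dirichlet => ∃ Z : Ω → Hsc g,
      IsMeasurableValue X P e (fun h => scaleIncl g (boundaryIncl D (trace D (J h)))) Z ∧
      ∀ᵐ ω ∂P, Z ω = 0
  | .neumann => ∃ N : Ω → Hsc g,
      IsMeasurableValue X P e (fun h => scaleIncl g (conormal D (J h))) N ∧
      ∀ᵐ ω ∂P, N ω = 0
  | .robin => ∃ N Z : Ω → Hsc g,
      IsMeasurableValue X P e (fun h => scaleIncl g (conormal D (J h))) N ∧
      IsMeasurableValue X P e (fun h => scaleIncl g (boundaryIncl D (trace D (J h)))) Z ∧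
      ∀ᵐ ω ∂P, N ω + β • Z ω = 0

/-- `X` is a Gaussian zero mean `H^{-r}(D)`-valued random field that solves the boundary value
problem `-Δ X + λ X = W` with the homogeneous `μ_X`-measurable boundary condition `bc`. -/
structure IsSolution {r s : ℝ≥0} {D : Opens (Rd d)} (g : HilbertBasis ℕ ℝ (HHalf D))
    (lam β : ℝ) (bc : BoundaryCondition) (W : Ω → HNeg s D) (P : Measure Ω)
    (X : Ω → HNeg r D) : Prop where
  gaussian : IsCenteredGaussian X P
  equation : ∀ᵐ ω ∂P, ∀ φ : 𝓓(D, ℝ),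
    X ω (TestH.of r (-testLaplacian φ + lam • φ)) = W ω (TestH.of s φ)
  boundary : ∃ J : CameronMartin (P.map X) →L[ℝ] H1 D,
    (∀ h, toHNeg r D (H1.toL2 D (J h)) = CameronMartin.incl h) ∧
    (∀ h, ∃ f : L2 D, HasLaplacian (H1.toL2 D (J h)) f) ∧
    ∃ e : HilbertBasis ℕ ℝ (CameronMartin (P.map X)),
      MeasurableBoundaryCondition g β X P J e bc

end Stochastic

end WhiteNoiseBVP

end

open WhiteNoiseBVP

noncomputable section

namespace WhiteNoiseBVP

section

variable {d : ℕ} {D U : Opens (Rd d)}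

/-! ### Test functions and the Sobolev space `H¹(D)` -/

/-! Deterministic problem. Green's formula turns each boundary value problem into a variational
equation for the coercive form `bvpForm`, λ∫uw + ∫∇u·∇w + c∫Tr u Tr w, posed on ker Tr for Dirichlet
and on all of H¹(D) for Neumann (c = 0) and Robin (c = β); Lax–Milgram gives T. The differential
equation is tested only with C_c^∞(D) and a natural boundary condition only with (ker Tr)^⊥, so
everything hinges on ker Tr being the closure of C_c^∞(D) (`IsTraceOperator.ker_eq`). The divergence
theorem is not needed for this: an inequality suffices, which bounds the boundary term of an
integration by parts by the L² norm of the trace (`IsTraceOperator.abs_boundaryForm_le`). For smooth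
functions it follows by translating a Lipschitz subgraph and estimating the strip between the two
positions, and smooth functions are dense. A function without boundary terms has a zero extension
with weak derivatives, hence mollification with kernels shifted into D approximates it by test
functions.

Measurable extension. White noise has identity covariance, so closing the functionals given by test
functions in L² of its law identifies its Cameron–Martin space with L²(D). The coordinates ê_k of an
orthonormal basis are independent standard Gaussians, and Kolmogorov's maximal inequality makes ∑
ê_k S e_k converge almost surely once ∑ ‖S e_k‖² is finite. It remains to see that H¹(D) → H^{-r}(D)
is Hilbert–Schmidt (`summable_sq_norm_toHNeg`). As a functional on H¹(D), the Fourier coefficient at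
ξ of the zero extension has norm O((1+|ξ|²)^{-1/2}): integrate by parts once and control the
boundary term by the trace. Bessel's inequality at each fixed ξ bounds the sum over the basis by a
multiple of (1+|ξ|²)^{-1}, and its integral against (1+|ξ|²)^{-r} is finite because 2r + 2 > d.

Stochastic problem. For every continuous functional L, the variable L(T̂W) is the Cameron–Martin
element that represents h ↦ L(S h) (`CameronMartin.apply_ae_eq_dualComp`). Hence T̂W is Gaussian,
solves the equation, and has Cameron–Martin space T(L²(D)), on which B vanishes. Conversely, for a
solution X the map φ ↦ X(-Δφ + λφ) extends to an isometry M of L²(D) into the Cameron–Martin space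
of X. With A = M* the equation says -ΔJh + λJh = Ah. A Gaussian series with sum 0 has only zero
coefficients, so B J e_k = 0 along the basis, and deterministic uniqueness gives J = T A.
Injectivity of the Cameron–Martin embedding then makes M onto: every functional of X is a functional
of W, and it is the one prescribed by T̂. -/

/-- Smooth compactly supported functions on the whole space. -/
abbrev TestRd (d : ℕ) : Type := 𝓓((⊤ : Opens (Rd d)), ℝ)

theorem lineDeriv_test_apply (φ : 𝓓(U, ℝ)) (v x : Rd d) : (∂_{v} φ) x = fderiv ℝ φ x v := by
  rw [TestFunction.lineDerivOp_eq_lineDerivCLM ℝ]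
  simp only [TestFunction.lineDerivCLM_apply, top_add, le_refl, if_true]
  exact ((φ.contDiff.differentiable (by simp)) x).lineDeriv_eq_fderiv

theorem test_differentiable (φ : 𝓓(U, ℝ)) : Differentiable ℝ φ :=
  φ.contDiff.differentiable (by simp)

theorem continuous_fderiv_test (φ : 𝓓(U, ℝ)) : Continuous (fderiv ℝ φ) :=
  φ.contDiff.continuous_fderiv (by simp)

/-- A smooth compactly supported function as an element of `TestRd d`. -/
def TestRd.mk (f : Rd d → ℝ) (hf : ContDiff ℝ (⊤ : ℕ∞) f) (hc : HasCompactSupport f) : TestRd d :=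
  ⟨f, hf, hc, fun _ _ => trivial⟩

@[simp]
theorem TestRd.mk_apply (f : Rd d → ℝ) (hf : ContDiff ℝ (⊤ : ℕ∞) f) (hc : HasCompactSupport f)
    (x : Rd d) : TestRd.mk f hf hc x = f x := rfl

/-- The product of a test function with a smooth function. -/
def mulTest (χ : TestRd d) (φ : 𝓓(U, ℝ)) : 𝓓(U, ℝ) where
  toFun x := χ x * φ x
  contDiff' := χ.contDiff.mul φ.contDiff
  hasCompactSupport' := φ.hasCompactSupport.mul_left
  tsupport_subset' := (tsupport_mul_subset_right (f := χ) (g := φ)).trans φ.tsupport_subset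

@[simp]
theorem mulTest_apply (χ : TestRd d) (φ : 𝓓(U, ℝ)) (x : Rd d) : mulTest χ φ x = χ x * φ x := rfl

theorem fderiv_mulTest (χ : TestRd d) (φ : 𝓓(U, ℝ)) (x v : Rd d) :
    fderiv ℝ (mulTest χ φ) x v = fderiv ℝ χ x v * φ x + χ x * fderiv ℝ φ x v := by
  have h := (((test_differentiable χ) x).hasFDerivAt.mul
    ((test_differentiable φ) x).hasFDerivAt).fderiv
  change fderiv ℝ (⇑χ * ⇑φ) x v = _
  rw [h]
  simp only [add_apply, smul_apply, smul_eq_mul]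
  ring

/-- A test function as an element of `L²(D)`. -/
def testL2 (D : Opens (Rd d)) (φ : 𝓓(U, ℝ)) : L2 D :=
  (testFunction_memLp φ (volume.restrict (D : Set (Rd d)))).toLp

theorem coeFn_testL2 (φ : 𝓓(U, ℝ)) :
    testL2 D φ =ᵐ[volume.restrict (D : Set (Rd d))] φ := MemLp.coeFn_toLp _

theorem testL2_add (φ ψ : 𝓓(U, ℝ)) : testL2 D (φ + ψ) = testL2 D φ + testL2 D ψ := rfl

theorem testL2_smul (c : ℝ) (φ : 𝓓(U, ℝ)) : testL2 D (c • φ) = c • testL2 D φ := rfl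

theorem memLp_smul_const_test (φ : 𝓓(U, ℝ)) (v : Rd d) (μ : Measure (Rd d))
    [IsFiniteMeasureOnCompacts μ] : MemLp (fun x => φ x • v) 2 μ :=
  (φ.continuous.smul continuous_const).memLp_of_hasCompactSupport
    φ.hasCompactSupport.smul_right

/-- The vector field `φ v` as an element of `L²(D; ℝ^d)`. -/
def testVec (D : Opens (Rd d)) (φ : 𝓓(U, ℝ)) (v : Rd d) : L2Vec D :=
  (memLp_smul_const_test φ v (volume.restrict (D : Set (Rd d)))).toLp

theorem inner_testL2 (u : L2 D) (φ : 𝓓(U, ℝ)) :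
    ⟪u, testL2 D φ⟫_ℝ = ∫ x in (D : Set (Rd d)), u x * φ x := by
  rw [L2.inner_def]
  refine integral_congr_ae ?_
  filter_upwards [coeFn_testL2 (D := D) φ] with x hx
  rw [hx]
  exact mul_comm _ _

theorem inner_testVec (g : L2Vec D) (φ : 𝓓(U, ℝ)) (v : Rd d) :
    ⟪g, testVec D φ v⟫_ℝ = ∫ x in (D : Set (Rd d)), ⟪g x, v⟫_ℝ * φ x := by
  rw [L2.inner_def]
  refine integral_congr_ae ?_
  filter_upwards [(memLp_smul_const_test φ v (volume.restrict (D : Set (Rd d)))).coeFn_toLp]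
    with x hx
  rw [testVec, hx, inner_smul_right, mul_comm]

theorem mem_H1Sub_iff (p : WithLp 2 (L2 D × L2Vec D)) :
    p ∈ H1Sub D ↔ ∀ (φ : 𝓓(D, ℝ)) (v : Rd d),
      ⟪p.fst, testL2 D (∂_{v} φ)⟫_ℝ + ⟪p.snd, testVec D φ v⟫_ℝ = 0 := by
  refine forall₂_congr fun φ v => ?_
  rw [inner_testL2, inner_testVec, eq_neg_iff_add_eq_zero]

/-- An intersection of zero sets of continuous functionals, one for each test function and
direction. It makes H¹(D) a Hilbert space. -/
theorem isClosed_H1Sub (D : Opens (Rd d)) :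
    IsClosed (H1Sub D : Set (WithLp 2 (L2 D × L2Vec D))) := by
  have : (H1Sub D : Set (WithLp 2 (L2 D × L2Vec D))) = ⋂ (φ : 𝓓(D, ℝ)) (v : Rd d),
      {p | ⟪p.fst, testL2 D (∂_{v} φ)⟫_ℝ + ⟪p.snd, testVec D φ v⟫_ℝ = 0} := by
    ext p
    simp only [SetLike.mem_coe, mem_H1Sub_iff, Set.mem_iInter, Set.mem_ofPred_eq]
  rw [this]
  refine isClosed_iInter fun φ => isClosed_iInter fun v => isClosed_eq ?_ continuous_const
  exact ((WithLp.fstL 2 ℝ (L2 D) (L2Vec D)).continuous.inner continuous_const).add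
    ((WithLp.sndL 2 ℝ (L2 D) (L2Vec D)).continuous.inner continuous_const)

instance (D : Opens (Rd d)) : CompleteSpace (H1 D) :=
  (isClosed_H1Sub D).completeSpace_coe

theorem H1.inner_eq (u w : H1 D) :
    ⟪u, w⟫_ℝ = ⟪H1.toL2 D u, H1.toL2 D w⟫_ℝ + ⟪H1.grad D u, H1.grad D w⟫_ℝ := rfl

theorem H1.norm_sq_eq (u : H1 D) : ‖u‖ ^ 2 = ‖H1.toL2 D u‖ ^ 2 + ‖H1.grad D u‖ ^ 2 := by
  rw [← real_inner_self_eq_norm_sq, H1.inner_eq, real_inner_self_eq_norm_sq,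
    real_inner_self_eq_norm_sq]

theorem H1.norm_toL2_le (u : H1 D) : ‖H1.toL2 D u‖ ≤ ‖u‖ := by
  refine abs_le_of_sq_le_sq' ?_ (norm_nonneg _) |>.2
  rw [H1.norm_sq_eq]
  exact le_add_of_nonneg_right (sq_nonneg _)

theorem H1.norm_grad_le (u : H1 D) : ‖H1.grad D u‖ ≤ ‖u‖ := by
  refine abs_le_of_sq_le_sq' ?_ (norm_nonneg _) |>.2
  rw [H1.norm_sq_eq]
  exact le_add_of_nonneg_left (sq_nonneg _)

/-- The functional `u ↦ ∫_D u ∂_v φ + (∂_v u) φ dx`; it vanishes for test functions on `D`, and in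
general it represents the boundary term in the formula of integration by parts. -/
def boundaryForm (D : Opens (Rd d)) (φ : 𝓓(U, ℝ)) (v : Rd d) : H1 D →L[ℝ] ℝ :=
  (innerSL ℝ (testL2 D (∂_{v} φ))).comp (H1.toL2 D) + (innerSL ℝ (testVec D φ v)).comp (H1.grad D)

theorem boundaryForm_apply' (φ : 𝓓(U, ℝ)) (v : Rd d) (u : H1 D) :
    boundaryForm D φ v u
      = ⟪H1.toL2 D u, testL2 D (∂_{v} φ)⟫_ℝ + ⟪H1.grad D u, testVec D φ v⟫_ℝ := by
  rw [real_inner_comm, real_inner_comm (testVec D φ v)]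
  rfl

theorem boundaryForm_apply (φ : 𝓓(U, ℝ)) (v : Rd d) (u : H1 D) :
    boundaryForm D φ v u = (∫ x in (D : Set (Rd d)), H1.toL2 D u x * fderiv ℝ φ x v)
      + ∫ x in (D : Set (Rd d)), ⟪H1.grad D u x, v⟫_ℝ * φ x := by
  rw [boundaryForm_apply', inner_testL2, inner_testVec]
  simp only [lineDeriv_test_apply]

theorem boundaryForm_eq_zero (φ : 𝓓(D, ℝ)) (v : Rd d) (u : H1 D) : boundaryForm D φ v u = 0 := by
  rw [boundaryForm_apply']
  exact (mem_H1Sub_iff _).1 u.2 φ v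

theorem boundaryForm_congr {U' : Opens (Rd d)} {φ : 𝓓(U, ℝ)} {ψ : 𝓓(U', ℝ)} (h : ∀ x, φ x = ψ x)
    (v : Rd d) (u : H1 D) : boundaryForm D φ v u = boundaryForm D ψ v u := by
  have : (φ : Rd d → ℝ) = ψ := funext h
  rw [boundaryForm_apply, boundaryForm_apply, this]

theorem boundaryForm_eq_zero_of_tsupport_subset (φ : 𝓓(U, ℝ)) (h : tsupport φ ⊆ D) (v : Rd d)
    (u : H1 D) : boundaryForm D φ v u = 0 := by
  rw [← boundaryForm_eq_zero (⟨φ, φ.contDiff, φ.hasCompactSupport, h⟩ : 𝓓(D, ℝ)) v u]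
  exact boundaryForm_congr (fun _ => rfl) v u

theorem inner_gradient (f : Rd d → ℝ) (x v : Rd d) : ⟪gradient f x, v⟫_ℝ = fderiv ℝ f x v := by
  rw [gradient, InnerProductSpace.toDual_symm_apply]

theorem continuous_gradient_test (φ : 𝓓(U, ℝ)) : Continuous (gradient φ) :=
  (InnerProductSpace.toDual ℝ (Rd d)).symm.continuous.comp (continuous_fderiv_test φ)

theorem hasCompactSupport_gradient_test (φ : 𝓓(U, ℝ)) : HasCompactSupport (gradient φ) :=
  (φ.hasCompactSupport.fderiv (𝕜 := ℝ)).comp_left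
    (g := (InnerProductSpace.toDual ℝ (Rd d)).symm) (map_zero _)

theorem memLp_gradient_test (φ : 𝓓(U, ℝ)) (μ : Measure (Rd d)) [IsFiniteMeasureOnCompacts μ] :
    MemLp (gradient φ) 2 μ :=
  (continuous_gradient_test φ).memLp_of_hasCompactSupport (hasCompactSupport_gradient_test φ)

theorem integrable_test_mul_test {U' : Opens (Rd d)} (φ : 𝓓(U, ℝ)) (ψ : 𝓓(U', ℝ))
    (μ : Measure (Rd d)) [IsFiniteMeasureOnCompacts μ] : Integrable (fun x => φ x * ψ x) μ :=
  (testFunction_memLp φ μ).integrable_mul (testFunction_memLp ψ μ)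

theorem integral_fderiv_test (φ : 𝓓(U, ℝ)) (v : Rd d) : ∫ x, fderiv ℝ φ x v = 0 := by
  have h1 := (∂_{v} φ).continuous.integrable_of_hasCompactSupport (μ := volume)
    (∂_{v} φ).hasCompactSupport
  have h2 := φ.continuous.integrable_of_hasCompactSupport (μ := volume) φ.hasCompactSupport
  have h := integral_mul_fderiv_eq_neg_fderiv_mul_of_integrable (μ := (volume : Measure (Rd d)))
    (f := fun _ => (1 : ℝ)) (g := φ) (v := v) (by simp)
    (by simpa [← lineDeriv_test_apply] using h1) (by simpa using h2)
    (fun x _ => differentiableAt_const _) (fun x _ => test_differentiable φ x)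
  simpa using h

theorem test_eq_zero_of_notMem (φ : 𝓓(U, ℝ)) {x : Rd d} (hx : x ∉ U) : φ x = 0 :=
  image_eq_zero_of_notMem_tsupport fun h => hx (φ.tsupport_subset h)

theorem setIntegral_mul_test (f : Rd d → ℝ) (φ : 𝓓(D, ℝ)) :
    ∫ x in (D : Set (Rd d)), f x * φ x = ∫ x, f x * φ x :=
  setIntegral_eq_integral_of_forall_compl_eq_zero fun x hx => by
    rw [test_eq_zero_of_notMem φ hx, mul_zero]

theorem integral_test_mul_fderiv_test {U' : Opens (Rd d)} (ψ : 𝓓(U, ℝ)) (φ : 𝓓(U', ℝ))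
    (v : Rd d) : ∫ x, ψ x * (∂_{v} φ) x = -∫ x, (∂_{v} ψ) x * φ x := by
  simp only [lineDeriv_test_apply]
  refine integral_mul_fderiv_eq_neg_fderiv_mul_of_integrable ?_ ?_ ?_
    (fun x _ => test_differentiable ψ x) (fun x _ => test_differentiable φ x)
  · simpa only [lineDeriv_test_apply] using integrable_test_mul_test (∂_{v} ψ) φ volume
  · simpa only [lineDeriv_test_apply] using integrable_test_mul_test ψ (∂_{v} φ) volume
  · exact integrable_test_mul_test ψ φ volume

/-- The gradient of a test function as an element of `L²(D; ℝ^d)`. -/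
def testGrad (D : Opens (Rd d)) (ψ : 𝓓(U, ℝ)) : L2Vec D :=
  (memLp_gradient_test ψ (volume.restrict (D : Set (Rd d)))).toLp

theorem coeFn_testGrad (ψ : 𝓓(U, ℝ)) :
    testGrad D ψ =ᵐ[volume.restrict (D : Set (Rd d))] gradient ψ := MemLp.coeFn_toLp _

/-- Since φ is supported in D, the integrals over D are integrals over ℝ^d, where integration by
parts has no boundary term. -/
theorem ofTest_mem_H1Sub (D : Opens (Rd d)) (ψ : 𝓓(U, ℝ)) :
    WithLp.toLp 2 (testL2 D ψ, testGrad D ψ) ∈ H1Sub D := by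
  rw [mem_H1Sub_iff]
  intro φ v
  have h1 : ∫ x in (D : Set (Rd d)), testL2 D ψ x * (∂_{v} φ) x = ∫ x, ψ x * (∂_{v} φ) x := by
    rw [← setIntegral_mul_test]
    refine integral_congr_ae ?_
    filter_upwards [coeFn_testL2 (D := D) ψ] with x hx
    rw [hx]
  have h2 : ∫ x in (D : Set (Rd d)), ⟪testGrad D ψ x, v⟫_ℝ * φ x
      = ∫ x, (∂_{v} ψ) x * φ x := by
    rw [← setIntegral_mul_test]
    refine integral_congr_ae ?_
    filter_upwards [coeFn_testGrad (D := D) ψ] with x hx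
    rw [hx, inner_gradient, lineDeriv_test_apply]
  rw [WithLp.toLp_fst, WithLp.toLp_snd, inner_testL2, inner_testVec, h1, h2,
    integral_test_mul_fderiv_test, neg_add_cancel]

/-- The restriction to `D` of a smooth compactly supported function. -/
def H1.ofTest (D : Opens (Rd d)) (ψ : 𝓓(U, ℝ)) : H1 D := ⟨_, ofTest_mem_H1Sub D ψ⟩

theorem H1.toL2_ofTest (ψ : 𝓓(U, ℝ)) : H1.toL2 D (H1.ofTest D ψ) = testL2 D ψ := rfl

theorem H1.coeFn_grad_ofTest (ψ : 𝓓(U, ℝ)) :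
    H1.grad D (H1.ofTest D ψ) =ᵐ[volume.restrict (D : Set (Rd d))] gradient ψ :=
  MemLp.coeFn_toLp (memLp_gradient_test ψ _)

/-! ### Density of test functions in L²(D) -/

theorem locallyIntegrableOn_of_L2 (u : L2 D) : LocallyIntegrableOn u (D : Set (Rd d)) := by
  rw [locallyIntegrableOn_iff D.isOpen.isLocallyClosed]
  intro k hk hkc
  have h := (Lp.memLp u).mono_measure (Measure.restrict_mono hk le_rfl)
  have : IsFiniteMeasure (volume.restrict k) := ⟨by simpa using hkc.measure_lt_top⟩
  exact (h.integrable (by norm_num))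

/-- An element of `L²(D)` which is orthogonal to all test functions vanishes. -/
theorem L2_eq_zero_of_forall_test {u : L2 D} (h : ∀ φ : 𝓓(D, ℝ), ⟪u, testL2 D φ⟫_ℝ = 0) :
    u = 0 := by
  have h1 : ∀ᵐ x ∂(volume : Measure (Rd d)), x ∈ (D : Set (Rd d)) → u x = 0 := by
    refine D.isOpen.ae_eq_zero_of_integral_contDiff_smul_eq_zero (locallyIntegrableOn_of_L2 u) ?_
    intro g hg hc hs
    have h2 := h ⟨g, hg, hc, hs⟩
    rw [inner_testL2] at h2
    rw [← h2, ← setIntegral_eq_integral_of_forall_compl_eq_zero (s := (D : Set (Rd d)))]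
    · exact integral_congr_ae (ae_of_all _ fun x => mul_comm _ _)
    · intro x hx
      rw [image_eq_zero_of_notMem_tsupport (f := g) fun h => hx (hs h), zero_smul]
  refine (Lp.eq_zero_iff_ae_eq_zero).2 ?_
  exact (ae_restrict_iff' D.isOpen.measurableSet).2 h1

theorem L2_ext_test {u w : L2 D} (h : ∀ φ : 𝓓(D, ℝ), ⟪u, testL2 D φ⟫_ℝ = ⟪w, testL2 D φ⟫_ℝ) :
    u = w := by
  rw [← sub_eq_zero]
  refine L2_eq_zero_of_forall_test fun φ => ?_
  rw [inner_sub_left, h φ, sub_self]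

/-- The linear map `φ ↦ φ` from test functions to `L²(D)`. -/
def testL2ₗ (D : Opens (Rd d)) : 𝓓(D, ℝ) →ₗ[ℝ] L2 D where
  toFun := testL2 D
  map_add' := testL2_add
  map_smul' := testL2_smul

theorem denseRange_testL2 (D : Opens (Rd d)) : DenseRange (testL2ₗ D) := by
  have h : (LinearMap.range (testL2ₗ D)).topologicalClosure = ⊤ := by
    rw [Submodule.topologicalClosure_eq_top_iff, Submodule.eq_bot_iff]
    intro u hu
    refine L2_eq_zero_of_forall_test fun φ => ?_
    exact (Submodule.mem_orthogonal' _ _).1 hu _ ⟨φ, rfl⟩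
  have h2 := congrArg (fun S : Submodule ℝ (L2 D) => (S : Set (L2 D))) h
  rw [DenseRange, dense_iff_closure_eq]
  simpa [LinearMap.coe_range] using h2

/-- Testing shows that u = 0 forces each component of the weak gradient to vanish. Identities in
H¹(D) can therefore be checked in L²(D). -/
theorem H1.toL2_injective (D : Opens (Rd d)) : Function.Injective (H1.toL2 D) := by
  rw [injective_iff_map_eq_zero]
  intro u hu
  have hg : H1.grad D u = 0 := by
    have key : ∀ v : Rd d, ∀ᵐ x ∂(volume.restrict (D : Set (Rd d))), ⟪H1.grad D u x, v⟫_ℝ = 0 := by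
      intro v
      have hm : MemLp (fun x => ⟪H1.grad D u x, v⟫_ℝ) 2 (volume.restrict (D : Set (Rd d))) :=
        (Lp.memLp _).inner_const v
      have h0 : hm.toLp = 0 := by
        refine L2_eq_zero_of_forall_test fun φ => ?_
        have h1 := boundaryForm_eq_zero φ v u
        rw [boundaryForm_apply', hu, inner_zero_left, zero_add, inner_testVec] at h1
        rw [inner_testL2, ← h1]
        refine integral_congr_ae ?_
        filter_upwards [hm.coeFn_toLp] with x hx
        rw [hx]
      have h1 := hm.coeFn_toLp
      rw [h0] at h1
      filter_upwards [h1, Lp.coeFn_zero ℝ 2 (volume.restrict (D : Set (Rd d)))] with x hx h2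
      rw [← hx, h2]
      rfl
    refine (Lp.eq_zero_iff_ae_eq_zero).2 ?_
    have := ae_all_iff.2 fun i : Fin d => key (EuclideanSpace.single i 1)
    filter_upwards [this] with x hx
    ext i
    simpa [EuclideanSpace.inner_single_right] using hx i
  have := H1.norm_sq_eq u
  rw [hu, hg] at this
  simpa using this

/-- The linear map that restricts smooth compactly supported functions to `D`. -/
def H1.ofTestₗ (D U : Opens (Rd d)) : 𝓓(U, ℝ) →ₗ[ℝ] H1 D where
  toFun := H1.ofTest D
  map_add' φ ψ := H1.toL2_injective D (by rw [map_add]; exact testL2_add _ _)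
  map_smul' c φ := H1.toL2_injective D (by rw [map_smul]; exact testL2_smul _ _)

/-! ### The weak Laplacian and Green's formula -/

theorem hasLaplacian_iff (u g : L2 D) : HasLaplacian u g ↔
    ∀ φ : 𝓓(D, ℝ), ⟪g, testL2 D φ⟫_ℝ = ⟪u, testL2 D (testLaplacian φ)⟫_ℝ := by
  simp only [inner_testL2]
  rfl

theorem HasLaplacian.unique {u g g' : L2 D} (h : HasLaplacian u g) (h' : HasLaplacian u g') :
    g = g' :=
  L2_ext_test fun φ => by rw [(hasLaplacian_iff _ _).1 h, (hasLaplacian_iff _ _).1 h']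

theorem HasLaplacian.laplacian_eq {u g : L2 D} (h : HasLaplacian u g) : laplacian u = g := by
  have hex : ∃ g, HasLaplacian u g := ⟨g, h⟩
  rw [laplacian, dif_pos hex]
  exact hex.choose_spec.unique h

theorem testLaplacian_apply (φ : 𝓓(D, ℝ)) : testL2 D (testLaplacian φ)
    = ∑ i : Fin d, testL2 D (∂_{EuclideanSpace.single i (1 : ℝ)}
      (∂_{EuclideanSpace.single i (1 : ℝ)} φ)) :=
  map_sum (testL2ₗ D) _ _

/-- Green's formula for `u ∈ H¹(D)` and test functions. -/
theorem inner_testLaplacian (u : H1 D) (φ : 𝓓(D, ℝ)) :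
    ⟪H1.toL2 D u, testL2 D (testLaplacian φ)⟫_ℝ = -⟪H1.grad D u, H1.grad D (H1.ofTest D φ)⟫_ℝ := by
  rw [testLaplacian_apply, inner_sum, eq_neg_iff_add_eq_zero]
  have h : ∀ i : Fin d, ⟪H1.toL2 D u, testL2 D (∂_{EuclideanSpace.single i (1 : ℝ)}
      (∂_{EuclideanSpace.single i (1 : ℝ)} φ))⟫_ℝ
      = -⟪H1.grad D u, testVec D (∂_{EuclideanSpace.single i (1 : ℝ)} φ)
        (EuclideanSpace.single i (1 : ℝ))⟫_ℝ := fun i => by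
    rw [eq_neg_iff_add_eq_zero, ← boundaryForm_apply']
    exact boundaryForm_eq_zero _ _ _
  rw [Finset.sum_congr rfl fun i _ => h i, Finset.sum_neg_distrib, neg_add_eq_zero, ← inner_sum]
  congr 1
  refine Lp.ext ?_
  have h2 : ∀ᵐ x ∂(volume.restrict (D : Set (Rd d))), ∀ i : Fin d,
      testVec D (∂_{EuclideanSpace.single i (1 : ℝ)} φ) (EuclideanSpace.single i (1 : ℝ)) x
      = (∂_{EuclideanSpace.single i (1 : ℝ)} φ) x • EuclideanSpace.single i (1 : ℝ) :=
    ae_all_iff.2 fun i => MemLp.coeFn_toLp _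
  filter_upwards [Lp.coeFn_finsetSum Finset.univ fun i : Fin d =>
    testVec D (∂_{EuclideanSpace.single i (1 : ℝ)} φ) (EuclideanSpace.single i (1 : ℝ)), h2,
    H1.coeFn_grad_ofTest (D := D) φ] with x h3 h4 h5
  rw [h3, h5, Finset.sum_apply]
  refine ext_inner_right ℝ fun v => ?_
  rw [inner_gradient, sum_inner]
  simp only [h4, lineDeriv_test_apply, inner_smul_left, EuclideanSpace.inner_single_left]
  conv_rhs => rw [← (EuclideanSpace.basisFun (Fin d) ℝ).sum_repr v]
  simp [map_sum, mul_comm]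

end

section

variable {d : ℕ} {D U : Opens (Rd d)}

/-! ### Weak approximation by convolution -/

open scoped Convolution

/-- By the inequality |ab| ≤ a² + b² the integrand is dominated by a²|k| + |k|b², a product
integrand plus a convolution integrand of integrable functions. This justifies Fubini below. -/
theorem integrable_prod_mul_convolution_integrand {a b k : Rd d → ℝ} (ha : MemLp a 2 volume)
    (hb : MemLp b 2 volume) (hk : Integrable k) :
    Integrable (fun p : Rd d × Rd d => a p.1 * (k p.2 * b (p.1 - p.2))) := by
  have ha2 : Integrable (fun x => a x ^ 2) := ha.integrable_sq
  have hb2 : Integrable (fun x => b x ^ 2) := hb.integrable_sq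
  have h1 : Integrable (fun p : Rd d × Rd d => a p.1 ^ 2 * ‖k p.2‖) := ha2.mul_prod hk.norm
  have h2 : Integrable (fun p : Rd d × Rd d => ‖k p.2‖ * b (p.1 - p.2) ^ 2) :=
    hk.norm.convolution_integrand (ContinuousLinearMap.mul ℝ ℝ) hb2
  refine (h1.add h2).mono ?_ (ae_of_all _ fun p => ?_)
  · refine (ha.1.comp_fst (ν := volume)).mul ((hk.1.comp_snd (μ := volume)).mul ?_)
    exact hb.1.comp_quasiMeasurePreserving (quasiMeasurePreserving_sub_of_right_invariant _ _)
  · refine le_trans ?_ (le_abs_self _)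
    rw [Pi.add_apply, norm_mul, norm_mul, Real.norm_eq_abs (a _), Real.norm_eq_abs (b _)]
    have h3 := norm_nonneg (k p.2)
    nlinarith [sq_nonneg (|a p.1| - |b (p.1 - p.2)|), sq_abs (a p.1), sq_abs (b (p.1 - p.2)),
      abs_nonneg (a p.1), abs_nonneg (b (p.1 - p.2)),
      mul_nonneg h3 (sq_nonneg (|a p.1| - |b (p.1 - p.2)|)),
      mul_nonneg h3 (sq_nonneg (a p.1)), mul_nonneg h3 (sq_nonneg (b (p.1 - p.2)))]

/-- Translation is continuous in L², so its pairing with a fixed element is continuous. -/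
theorem continuous_integral_mul_translate {a b : Rd d → ℝ} (ha : MemLp a 2 volume)
    (hb : MemLp b 2 volume) : Continuous fun y : Rd d => ∫ x, a x * b (x - y) := by
  let τ : Rd d → C(Rd d, Rd d) := fun y => ⟨fun x => x - y, by fun_prop⟩
  have hτ : Continuous τ := by
    refine ContinuousMap.continuous_of_continuous_uncurry _ ?_
    exact continuous_snd.sub continuous_fst
  have hmp : ∀ y, MeasurePreserving (τ y) (volume : Measure (Rd d)) volume := fun y =>
    measurePreserving_sub_right volume y
  have h := (continuous_const (y := hb.toLp)).compMeasurePreservingLp hτ hmp (by norm_num)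
  have h2 : Continuous fun y => ⟪ha.toLp, Lp.compMeasurePreserving (τ y) (hmp y) hb.toLp⟫_ℝ :=
    continuous_const.inner h
  refine h2.congr fun y => ?_
  rw [L2.inner_def]
  refine integral_congr_ae ?_
  filter_upwards [ha.coeFn_toLp, Lp.coeFn_compMeasurePreserving hb.toLp (hmp y),
    (hmp y).quasiMeasurePreserving.ae_eq_comp hb.coeFn_toLp] with x h1 h2 h3
  rw [h1, h2, h3]
  exact mul_comm _ _

theorem integral_mul_convolution {a b k : Rd d → ℝ} (ha : MemLp a 2 volume)
    (hb : MemLp b 2 volume) (hk : Integrable k) :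
    ∫ x, a x * (k ⋆[ContinuousLinearMap.lsmul ℝ ℝ] b) x
      = ∫ y, k y * ∫ x, a x * b (x - y) := by
  have h := integrable_prod_mul_convolution_integrand ha hb hk
  have h2 := integral_integral_swap (f := fun x y => a x * (k y * b (x - y))) h
  simp only [integral_const_mul, mul_left_comm (a _) (k _)] at h2
  rw [← h2]
  refine integral_congr_ae (ae_of_all _ fun x => ?_)
  simp only [← mul_left_comm (a _) (k _), integral_const_mul]
  rfl

/-- Convolutions with an approximate identity converge weakly in `L²`. -/
theorem tendsto_integral_mul_convolution {a b : Rd d → ℝ} (ha : MemLp a 2 volume)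
    (hb : MemLp b 2 volume) {k : ℕ → Rd d → ℝ} (hk : ∀ n, Integrable (k n))
    (h0 : ∀ n x, 0 ≤ k n x) (h1 : ∀ n, ∫ x, k n x = 1)
    (hs : Tendsto (fun n => Function.support (k n)) atTop (𝓝 (0 : Rd d)).smallSets) :
    Tendsto (fun n => ∫ x, a x * (k n ⋆[ContinuousLinearMap.lsmul ℝ ℝ] b) x) atTop
      (𝓝 (∫ x, a x * b x)) := by
  simp only [integral_mul_convolution ha hb (hk _)]
  have hc := continuous_integral_mul_translate ha hb
  -- The reflection y ↦ -y writes ∫ k(y) F(y) dy as the value at 0 of a convolution, to which the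
  -- approximate identity theorem applies.
  have hc' : Continuous fun y : Rd d => ∫ x, a x * b (x - -y) := hc.comp continuous_neg
  have h := convolution_tendsto_right (μ := (volume : Measure (Rd d)))
    (φ := k) (l := atTop) (g := fun _ y => ∫ x, a x * b (x - -y)) (k := fun _ => 0) (x₀ := 0)
    (z₀ := ∫ x, a x * b (x - -0)) (Eventually.of_forall h0) (Eventually.of_forall h1) hs
    (Eventually.of_forall fun _ => hc'.aestronglyMeasurable)
    ((hc'.tendsto 0).comp tendsto_snd) tendsto_const_nhds
  simp only [convolution_def, ContinuousLinearMap.lsmul_apply, zero_sub, neg_neg, neg_zero,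
    sub_zero, smul_eq_mul] at h
  exact h

end

section

variable {d : ℕ} {D U : Opens (Rd d)}

/-! ### Mollification of functions in `H¹(D)` -/

open scoped Convolution

/-- Extension by zero of a function on `D`. -/
def zeroExt (D : Opens (Rd d)) (f : Rd d → ℝ) : Rd d → ℝ := (D : Set (Rd d)).indicator f

theorem memLp_zeroExt {f : Rd d → ℝ} (hf : MemLp f 2 (volume.restrict (D : Set (Rd d)))) :
    MemLp (zeroExt D f) 2 volume :=
  (memLp_indicator_iff_restrict D.isOpen.measurableSet).2 hf

theorem integral_zeroExt_mul (f h : Rd d → ℝ) :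
    ∫ x, zeroExt D f x * h x = ∫ x in (D : Set (Rd d)), f x * h x := by
  rw [← integral_indicator D.isOpen.measurableSet]
  refine integral_congr_ae (ae_of_all _ fun x => ?_)
  by_cases hx : x ∈ (D : Set (Rd d)) <;> simp [zeroExt, hx]

theorem test_bounded (φ : 𝓓(U, ℝ)) : ∃ C, ∀ x, ‖φ x‖ ≤ C :=
  φ.continuous.bounded_above_of_compact_support φ.hasCompactSupport

theorem memLp_test_mul (χ : 𝓓(U, ℝ)) {f : Rd d → ℝ} {μ : Measure (Rd d)} (hf : MemLp f 2 μ) :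
    MemLp (fun x => χ x * f x) 2 μ := by
  obtain ⟨C, hC⟩ := test_bounded χ
  refine hf.of_le_mul (c := C) (χ.continuous.aestronglyMeasurable.mul hf.1) (ae_of_all _ fun x => ?_)
  rw [norm_mul]
  exact mul_le_mul_of_nonneg_right (hC x) (norm_nonneg _)

/-- The directional derivative of `χ u`, as a function on `D`. -/
def cutoffDeriv (χ : TestRd d) (u : H1 D) (v x : Rd d) : ℝ :=
  χ x * ⟪H1.grad D u x, v⟫_ℝ + (∂_{v} χ) x * H1.toL2 D u x

theorem memLp_cutoffDeriv (χ : TestRd d) (u : H1 D) (v : Rd d) :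
    MemLp (cutoffDeriv χ u v) 2 (volume.restrict (D : Set (Rd d))) :=
  (memLp_test_mul χ ((Lp.memLp _).inner_const v)).add (memLp_test_mul _ (Lp.memLp _))

theorem memLp_cutoff (χ : TestRd d) (u : H1 D) :
    MemLp (fun x => χ x * H1.toL2 D u x) 2 (volume.restrict (D : Set (Rd d))) :=
  memLp_test_mul χ (Lp.memLp _)

/-- The zero extension of `χ u`. -/
def cutoff (χ : TestRd d) (u : H1 D) : Rd d → ℝ := zeroExt D fun x => χ x * H1.toL2 D u x

theorem locallyIntegrable_of_memLp_two {f : Rd d → ℝ} (hf : MemLp f 2 volume) :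
    LocallyIntegrable f :=
  hf.locallyIntegrable (by norm_num)

theorem hasCompactSupport_cutoff (χ : TestRd d) (u : H1 D) : HasCompactSupport (cutoff χ u) := by
  refine χ.hasCompactSupport.mono' ((Function.support_subset_iff'.2 fun x hx => ?_))
  rw [cutoff, zeroExt]
  refine Set.indicator_apply_eq_zero.2 fun _ => ?_
  rw [image_eq_zero_of_notMem_tsupport hx, zero_mul]

/-- The convolution of a kernel `k` with the zero extension of `χ u`. -/
def mollify (k χ : TestRd d) (u : H1 D) : TestRd d :=
  TestRd.mk (k ⋆[ContinuousLinearMap.lsmul ℝ ℝ] cutoff χ u)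
    (k.hasCompactSupport.contDiff_convolution_left _ k.contDiff
      (locallyIntegrable_of_memLp_two (memLp_zeroExt (memLp_cutoff χ u))))
    (k.hasCompactSupport.convolution _ (hasCompactSupport_cutoff χ u))

/-- The function `y ↦ k (x - y)`. -/
def reflectTest (k : TestRd d) (x : Rd d) : TestRd d :=
  TestRd.mk (fun y => k (x - y)) (k.contDiff.comp (contDiff_const.sub contDiff_id))
    (k.hasCompactSupport.comp_homeomorph (Homeomorph.subLeft x))

theorem reflectTest_apply (k : TestRd d) (x y : Rd d) : reflectTest k x y = k (x - y) := rfl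

theorem fderiv_reflectTest (k : TestRd d) (x y v : Rd d) :
    fderiv ℝ (reflectTest k x) y v = -fderiv ℝ k (x - y) v := by
  have h := (test_differentiable k (x - y)).hasFDerivAt.comp y
    ((hasFDerivAt_const x y).sub (hasFDerivAt_id y))
  have h2 : fderiv ℝ (reflectTest k x) y = _ := h.fderiv
  rw [h2]
  simp

theorem convolution_eq_setIntegral (k : Rd d → ℝ) (f : Rd d → ℝ) (x : Rd d) :
    (k ⋆[ContinuousLinearMap.lsmul ℝ ℝ] zeroExt D f) x
      = ∫ y in (D : Set (Rd d)), f y * k (x - y) := by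
  rw [← integral_zeroExt_mul, convolution_eq_swap]
  refine integral_congr_ae (ae_of_all _ fun y => ?_)
  simp [mul_comm]

/-- Differentiating the kernel and integrating by parts over D moves the derivative to χu; the price
is exactly the boundary form of χ · k(x - ·). Mollification commutes with the derivative at those x
where this form vanishes. -/
theorem fderiv_mollify (k χ : TestRd d) (u : H1 D) (x v : Rd d) :
    fderiv ℝ (mollify k χ u) x v
      = (k ⋆[ContinuousLinearMap.lsmul ℝ ℝ] zeroExt D (cutoffDeriv χ u v)) x
        - boundaryForm D (mulTest χ (reflectTest k x)) v u := by
  have hloc := locallyIntegrable_of_memLp_two (memLp_zeroExt (memLp_cutoff χ u))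
  have h1 := k.hasCompactSupport.hasFDerivAt_convolution_left (ContinuousLinearMap.lsmul ℝ ℝ)
    (k.contDiff.of_le (by exact_mod_cast le_top)) hloc x
  have h2 : fderiv ℝ (mollify k χ u) x v
      = ((fun t => fderiv ℝ k t v) ⋆[ContinuousLinearMap.lsmul ℝ ℝ] cutoff χ u) x := by
    rw [show fderiv ℝ (mollify k χ u) x = _ from h1.fderiv, convolution_def, convolution_def,
      ContinuousLinearMap.integral_apply]
    · rfl
    · exact (k.hasCompactSupport.fderiv (𝕜 := ℝ)).convolutionExists_left _
        (continuous_fderiv_test k) hloc x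
  rw [h2, cutoff, convolution_eq_setIntegral, convolution_eq_setIntegral, boundaryForm_apply]
  have hφ := testFunction_memLp (reflectTest k x) (volume.restrict (D : Set (Rd d)))
  have hφ' := testFunction_memLp (∂_{v} (mulTest χ (reflectTest k x)) : TestRd d)
    (volume.restrict (D : Set (Rd d)))
  have hφ'' := testFunction_memLp (mulTest χ (reflectTest k x))
    (volume.restrict (D : Set (Rd d)))
  have hB : Integrable (fun y => cutoffDeriv χ u v y * k (x - y))
      (volume.restrict (D : Set (Rd d))) := (memLp_cutoffDeriv χ u v).integrable_mul hφ
  have hC : Integrable (fun y => H1.toL2 D u y * fderiv ℝ (mulTest χ (reflectTest k x)) y v)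
      (volume.restrict (D : Set (Rd d))) := by
    have := (Lp.memLp (H1.toL2 D u)).integrable_mul hφ'
    simpa only [Pi.mul_def, lineDeriv_test_apply] using this
  have hE : Integrable (fun y => ⟪H1.grad D u y, v⟫_ℝ * mulTest χ (reflectTest k x) y)
      (volume.restrict (D : Set (Rd d))) :=
    ((Lp.memLp (H1.grad D u)).inner_const v).integrable_mul hφ''
  rw [← integral_add' hC hE, ← integral_sub' hB (hC.add hE)]
  refine integral_congr_ae (ae_of_all _ fun y => ?_)
  simp only [Pi.add_apply, Pi.sub_apply, fderiv_mulTest, fderiv_reflectTest, mulTest_apply, cutoffDeriv,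
    lineDeriv_test_apply, reflectTest_apply]
  ring

theorem H1.inner_ofTest (z : H1 D) (ψ : 𝓓(U, ℝ)) :
    ⟪z, H1.ofTest D ψ⟫_ℝ = (∫ x in (D : Set (Rd d)), H1.toL2 D z x * ψ x)
      + ∑ i : Fin d, ∫ x in (D : Set (Rd d)),
        ⟪H1.grad D z x, EuclideanSpace.single i (1 : ℝ)⟫_ℝ
          * fderiv ℝ ψ x (EuclideanSpace.single i (1 : ℝ)) := by
  rw [H1.inner_eq, H1.toL2_ofTest, inner_testL2, ← integral_finsetSum]
  · congr 1
    rw [L2.inner_def]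
    refine integral_congr_ae ?_
    filter_upwards [H1.coeFn_grad_ofTest (D := D) ψ] with x hx
    rw [hx, PiLp.inner_apply]
    refine Finset.sum_congr rfl fun i _ => ?_
    rw [← inner_gradient, EuclideanSpace.inner_single_right, EuclideanSpace.inner_single_right]
    simp [mul_comm]
  · intro i _
    have := ((Lp.memLp (H1.grad D z)).inner_const
      (EuclideanSpace.single i (1 : ℝ))).integrable_mul (testFunction_memLp
        (∂_{EuclideanSpace.single i (1 : ℝ)} ψ) (volume.restrict (D : Set (Rd d))))
    simpa only [Pi.mul_def, lineDeriv_test_apply] using this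

/-- The inner product in `H¹(D)` of `z` with `χ u`. -/
def innerCutoff (z u : H1 D) (χ : TestRd d) : ℝ :=
  (∫ x in (D : Set (Rd d)), H1.toL2 D z x * (χ x * H1.toL2 D u x))
    + ∑ i : Fin d, ∫ x in (D : Set (Rd d)), ⟪H1.grad D z x, EuclideanSpace.single i (1 : ℝ)⟫_ℝ
      * cutoffDeriv χ u (EuclideanSpace.single i (1 : ℝ)) x

theorem integral_zeroExt_mul_zeroExt (f h : Rd d → ℝ) :
    ∫ x, zeroExt D f x * zeroExt D h x = ∫ x in (D : Set (Rd d)), f x * h x := by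
  rw [integral_zeroExt_mul]
  refine setIntegral_congr_fun D.isOpen.measurableSet fun x hx => ?_
  simp only [zeroExt]
  rw [Set.indicator_of_mem hx]

/-- If the boundary terms vanish, then the mollifications of `χ u` converge weakly to `χ u`. -/
theorem tendsto_inner_mollify (z u : H1 D) (χ : TestRd d) {k : ℕ → TestRd d}
    (h0 : ∀ n x, 0 ≤ k n x) (h1 : ∀ n, ∫ x, k n x = 1)
    (hs : Tendsto (fun n => Function.support (k n)) atTop (𝓝 (0 : Rd d)).smallSets)
    (hb : ∀ n, ∀ x ∈ D, ∀ v, boundaryForm D (mulTest χ (reflectTest (k n) x)) v u = 0) :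
    Tendsto (fun n => ⟪z, H1.ofTest D (mollify (k n) χ u)⟫_ℝ) atTop
      (𝓝 (innerCutoff z u χ)) := by
  have hk : ∀ n, Integrable (k n) := fun n =>
    (k n).continuous.integrable_of_hasCompactSupport (k n).hasCompactSupport
  simp only [H1.inner_ofTest]
  refine Tendsto.add ?_ (tendsto_finsetSum _ fun i _ => ?_)
  · have := tendsto_integral_mul_convolution (memLp_zeroExt (Lp.memLp (H1.toL2 D z)))
      (memLp_zeroExt (memLp_cutoff χ u)) hk h0 h1 hs
    rw [integral_zeroExt_mul_zeroExt] at this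
    refine this.congr fun n => ?_
    rw [integral_zeroExt_mul]
    rfl
  · have := tendsto_integral_mul_convolution
      (memLp_zeroExt ((Lp.memLp (H1.grad D z)).inner_const (EuclideanSpace.single i (1 : ℝ))))
      (memLp_zeroExt (memLp_cutoffDeriv χ u (EuclideanSpace.single i (1 : ℝ)))) hk h0 h1 hs
    rw [integral_zeroExt_mul_zeroExt] at this
    refine this.congr fun n => ?_
    rw [integral_zeroExt_mul]
    refine setIntegral_congr_fun D.isOpen.measurableSet fun x hx => ?_
    rw [fderiv_mollify, hb n x hx, sub_zero]

theorem sum_fderiv_eq_zero {ι : Type*} [Fintype ι] {χ : ι → TestRd d}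
    (h : ∀ x ∈ D, ∑ i, χ i x = 1) {x : Rd d} (hx : x ∈ D) (v : Rd d) :
    ∑ i, fderiv ℝ (χ i) x v = 0 := by
  have h1 : HasFDerivAt (fun y => ∑ i, χ i y) (∑ i, fderiv ℝ (χ i) x) x :=
    HasFDerivAt.fun_sum fun i _ => (test_differentiable (χ i) x).hasFDerivAt
  have h2 : HasFDerivAt (fun y => ∑ i, χ i y) (0 : Rd d →L[ℝ] ℝ) x := by
    refine (hasFDerivAt_const (1 : ℝ) x).congr_of_eventuallyEq ?_
    filter_upwards [D.isOpen.mem_nhds hx] with y hy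
    exact h y hy
  have h3 := congrArg (fun L : Rd d →L[ℝ] ℝ => L v) (h1.unique h2)
  simpa using h3

theorem inner_single_one (v : Rd d) (i : Fin d) : ⟪v, EuclideanSpace.single i (1 : ℝ)⟫_ℝ = v i := by
  simp [EuclideanSpace.inner_single_right]

/-- On the open set D the cutoffs sum to 1, so their derivatives sum to 0 and the product-rule terms
cancel. This reassembles u from its localized pieces. -/
theorem sum_innerCutoff {ι : Type*} [Fintype ι] {χ : ι → TestRd d}
    (h : ∀ x ∈ D, ∑ i, χ i x = 1) (z u : H1 D) : ∑ i, innerCutoff z u (χ i) = ⟪z, u⟫_ℝ := by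
  simp only [innerCutoff]
  rw [Finset.sum_add_distrib, Finset.sum_comm, ← integral_finsetSum, H1.inner_eq]
  · congr 1
    · rw [L2.inner_def]
      refine setIntegral_congr_fun D.isOpen.measurableSet fun x hx => ?_
      rw [← Finset.mul_sum, ← Finset.sum_mul, h x hx, one_mul]
      exact mul_comm _ _
    · rw [L2.inner_def]
      have hi : ∀ j : Fin d, ∀ i : ι, Integrable (fun x =>
          ⟪H1.grad D z x, EuclideanSpace.single j (1 : ℝ)⟫_ℝ
            * cutoffDeriv (χ i) u (EuclideanSpace.single j (1 : ℝ)) x)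
          (volume.restrict (D : Set (Rd d))) := fun j i =>
        ((Lp.memLp (H1.grad D z)).inner_const _).integrable_mul (memLp_cutoffDeriv _ _ _)
      rw [Finset.sum_congr rfl fun j _ => (integral_finsetSum _ fun i _ => hi j i).symm,
        ← integral_finsetSum _ fun j _ => integrable_finsetSum _ fun i _ => hi j i]
      refine setIntegral_congr_fun D.isOpen.measurableSet fun x hx => ?_
      rw [PiLp.inner_apply]
      refine Finset.sum_congr rfl fun j _ => ?_
      rw [← Finset.mul_sum]
      simp only [cutoffDeriv, lineDeriv_test_apply]
      rw [Finset.sum_add_distrib, ← Finset.sum_mul, ← Finset.sum_mul, h x hx,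
        sum_fderiv_eq_zero h hx, zero_mul, add_zero, one_mul]
      rw [inner_single_one, inner_single_one]
      exact mul_comm _ _
  · exact fun i _ => (Lp.memLp (H1.toL2 D z)).integrable_mul (memLp_cutoff _ _)

end

section

variable {d : ℕ} {D U : Opens (Rd d)}

/-! ### Graph charts and density of smooth functions in `H¹(D)` -/

open scoped Convolution Pointwise Manifold ContDiff

theorem norm_sub_inner_smul_le {e : Rd d} (he : ‖e‖ = 1) (w : Rd d) :
    ‖w - ⟪w, e⟫_ℝ • e‖ ≤ ‖w‖ := by
  refine abs_le_of_sq_le_sq' ?_ (norm_nonneg _) |>.2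
  rw [norm_sub_sq_real, inner_smul_right, norm_smul, he, Real.norm_eq_abs, mul_one, sq_abs]
  nlinarith [sq_nonneg (⟪w, e⟫_ℝ)]

/-- The region below the graph of `γ` in direction `e`. -/
def subgraph (e : Rd d) (γ : Rd d → ℝ) : Set (Rd d) := {x | ⟪x, e⟫_ℝ < γ (x - ⟪x, e⟫_ℝ • e)}

theorem abs_height_sub_le {e : Rd d} (he : ‖e‖ = 1) {γ : Rd d → ℝ} {K : ℝ≥0}
    (hγ : LipschitzWith K γ) (x w : Rd d) :
    |γ (x - w - ⟪x - w, e⟫_ℝ • e) - γ (x - ⟪x, e⟫_ℝ • e)| ≤ K * ‖w‖ := by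
  have h := hγ.dist_le_mul (x - w - ⟪x - w, e⟫_ℝ • e) (x - ⟪x, e⟫_ℝ • e)
  rw [Real.dist_eq, dist_eq_norm] at h
  refine h.trans (mul_le_mul_of_nonneg_left ?_ K.2)
  rw [show x - w - ⟪x - w, e⟫_ℝ • e - (x - ⟪x, e⟫_ℝ • e) = -(w - ⟪w, e⟫_ℝ • e) by
    rw [inner_sub_left, sub_smul]; abel, norm_neg]
  exact norm_sub_inner_smul_le he w

theorem abs_inner_le_of_norm_eq_one {e : Rd d} (he : ‖e‖ = 1) (w : Rd d) : |⟪w, e⟫_ℝ| ≤ ‖w‖ := by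
  simpa [he] using abs_real_inner_le_norm w e

/-- The uniform cone property. Moving down by h gains h of vertical room; the error w = s - h e
costs at most ‖w‖ in height and K‖w‖ in the graph, together at most h. -/
theorem sub_mem_subgraph {e : Rd d} (he : ‖e‖ = 1) {γ : Rd d → ℝ} {K : ℝ≥0}
    (hγ : LipschitzWith K γ) {x s : Rd d} (hx : x ∈ subgraph e γ) {h : ℝ}
    (hs : ‖s - h • e‖ ≤ h / (1 + K)) : x - s ∈ subgraph e γ := by
  have hee : ⟪e, e⟫_ℝ = 1 := by rw [real_inner_self_eq_norm_sq, he, one_pow]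
  set w := s - h • e with hw
  have hsw : s = h • e + w := by rw [hw]; abel
  have h1 : x - s - ⟪x - s, e⟫_ℝ • e = x - w - ⟪x - w, e⟫_ℝ • e := by
    rw [hsw, inner_sub_left, inner_sub_left, inner_add_left, inner_smul_left, hee]
    simp only [conj_trivial, mul_one, sub_smul, add_smul]
    abel
  have h2 := abs_le.1 (abs_height_sub_le he hγ x w)
  have h3 := abs_le.1 (abs_inner_le_of_norm_eq_one he w)
  have hK : (0 : ℝ) < 1 + K := by positivity
  have h4 : ‖w‖ * (1 + K) ≤ h := (le_div_iff₀ hK).1 hs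
  change ⟪x - s, e⟫_ℝ < γ (x - s - ⟪x - s, e⟫_ℝ • e)
  have h5 : ⟪x - s, e⟫_ℝ = ⟪x, e⟫_ℝ - h - ⟪w, e⟫_ℝ := by
    rw [hsw, inner_sub_left, inner_add_left, inner_smul_left, hee]
    simp only [conj_trivial, mul_one]
    ring
  have hx' : ⟪x, e⟫_ℝ < γ (x - ⟪x, e⟫_ℝ • e) := hx
  rw [h1, h5]
  nlinarith [h2.1, h3.1]

/-- In the open set `V` the domain `D` is the region below the graph of a Lipschitz function. -/
structure IsGraphChart (D : Opens (Rd d)) (V : Set (Rd d)) (e : Rd d) (γ : Rd d → ℝ) (K : ℝ≥0) :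
    Prop where
  isOpen : IsOpen V
  norm_eq : ‖e‖ = 1
  lipschitz : LipschitzWith K γ
  mem_iff : ∀ x ∈ V, x ∈ D ↔ x ∈ subgraph e γ

/-- The support of `χ` lies in `D` or in a graph chart of `D`. -/
def IsChartCutoff (D : Opens (Rd d)) (χ : TestRd d) : Prop :=
  tsupport χ ⊆ D ∨ ∃ V e γ K, IsGraphChart D V e γ K ∧ tsupport χ ⊆ V

/-! ### Mollification kernels adapted to a graph chart -/

theorem exists_kernel (c : Rd d) {ρ : ℝ} (hρ : 0 < ρ) : ∃ k : TestRd d, (∀ x, 0 ≤ k x) ∧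
    ∫ x, k x = 1 ∧ tsupport k = Metric.closedBall c ρ := by
  let f : ContDiffBump c := ⟨ρ / 2, ρ, by positivity, by linarith⟩
  refine ⟨TestRd.mk (f.normed volume) f.contDiff_normed f.hasCompactSupport_normed,
    fun x => f.nonneg_normed x, f.integral_normed, f.tsupport_normed_eq⟩

/-- The kernel sits around h e, so its convolution at x ∈ D only uses points y lying below x inside
the cone, all of them in D. No boundary term appears, whatever the boundary values of u. -/
theorem exists_outward_kernel {χ : TestRd d} (hχ : IsChartCutoff D χ) {ε : ℝ} (hε : 0 < ε) :
    ∃ k : TestRd d, (∀ x, 0 ≤ k x) ∧ ∫ x, k x = 1 ∧ tsupport k ⊆ Metric.closedBall 0 ε ∧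
      ∀ x ∈ D, ∀ y ∈ tsupport χ, x - y ∈ tsupport k → y ∈ D := by
  rcases hχ with hχ | ⟨V, e, γ, K, hV, hχ⟩
  · obtain ⟨k, h0, h1, hk⟩ := exists_kernel (0 : Rd d) hε
    exact ⟨k, h0, h1, hk.subset, fun x _ y hy _ => hχ hy⟩
  · obtain ⟨δ, hδ, hδV⟩ := χ.hasCompactSupport.isCompact.exists_thickening_subset_open
      hV.isOpen hχ
    -- Displacements have norm at most 2h: the bound ε/2 keeps the support in the ε-ball, and δ/3
    -- gives 2h < δ, which keeps shifted points in the chart.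
    set h := min (ε / 2) (δ / 3) with hh
    have hpos : 0 < h := lt_min (by positivity) (by positivity)
    have hK : (0 : ℝ) < 1 + K := by positivity
    have hρ : h / (1 + K) ≤ h := div_le_self hpos.le (by simp)
    have hball : ∀ s ∈ Metric.closedBall (h • e) (h / (1 + K)), ‖s‖ ≤ 2 * h := fun s hs => by
      have h1 : ‖s - h • e‖ ≤ h / (1 + K) := by simpa [dist_eq_norm] using hs
      have h2 : ‖h • e‖ = h := by rw [norm_smul, hV.norm_eq, mul_one, Real.norm_of_nonneg hpos.le]
      have h3 := norm_le_norm_add_norm_sub' s (h • e)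
      linarith
    obtain ⟨k, h0, h1, hk⟩ := exists_kernel (h • e) (div_pos hpos hK)
    refine ⟨k, h0, h1, fun s hs => ?_, fun x hx y hy hxy => ?_⟩
    · rw [hk] at hs
      have := hball s hs
      have h2 := min_le_left (ε / 2) (δ / 3)
      simp only [mem_closedBall_zero_iff]
      linarith
    · rw [hk] at hxy
      have h2 := hball _ hxy
      have h3 := min_le_right (ε / 2) (δ / 3)
      have hxV : x ∈ V := hδV (Metric.mem_thickening_iff.2 ⟨y, hy, by
        rw [dist_eq_norm]; linarith⟩)
      rw [hV.mem_iff x hxV] at hx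
      rw [hV.mem_iff y (hχ hy)]
      have h4 := sub_mem_subgraph hV.norm_eq hV.lipschitz hx (s := x - y) (h := h)
        (by simpa [dist_eq_norm] using hxy)
      simpa using h4

/-- The kernel sits around -h e and pushes the support of χu strictly into D, so mollifications
become test functions on D. -/
theorem exists_inward_kernel {χ : TestRd d} (hχ : IsChartCutoff D χ) {ε : ℝ} (hε : 0 < ε) :
    ∃ k : TestRd d, (∀ x, 0 ≤ k x) ∧ ∫ x, k x = 1 ∧ tsupport k ⊆ Metric.closedBall 0 ε ∧
      ∀ y ∈ closure (D : Set (Rd d)) ∩ tsupport χ, ∀ s ∈ tsupport k, y + s ∈ D := by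
  rcases hχ with hχ | ⟨V, e, γ, K, hV, hχ⟩
  · obtain ⟨δ, hδ, hδD⟩ := χ.hasCompactSupport.isCompact.exists_thickening_subset_open
      D.isOpen hχ
    obtain ⟨k, h0, h1, hk⟩ := exists_kernel (0 : Rd d) (lt_min hε (half_pos hδ))
    refine ⟨k, h0, h1, fun s hs => ?_, fun y hy s hs => ?_⟩
    · rw [hk] at hs
      exact Metric.closedBall_subset_closedBall (min_le_left _ _) hs
    · rw [hk, mem_closedBall_zero_iff] at hs
      refine hδD (Metric.mem_thickening_iff.2 ⟨y, hy.2, ?_⟩)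
      have := min_le_right ε (δ / 2)
      rw [dist_eq_norm, add_sub_cancel_left]
      linarith
  · obtain ⟨δ, hδ, hδV⟩ := χ.hasCompactSupport.isCompact.exists_thickening_subset_open
      hV.isOpen hχ
    set h := min (ε / 2) (δ / 3) with hh
    have hpos : 0 < h := lt_min (by positivity) (by positivity)
    have hK : (0 : ℝ) < 1 + K := by positivity
    have hρ : h / (1 + K) ≤ h := div_le_self hpos.le (by simp)
    have hρ' : 0 < h / (1 + K) := div_pos hpos hK
    -- Only half the cone radius is used; the other half absorbs the replacement of a point y of the
    -- closure by a nearby y' in D.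
    have hball : ∀ s ∈ Metric.closedBall (-(h • e)) (h / (1 + K) / 2), ‖s‖ ≤ 2 * h :=
      fun s hs => by
      have h1 : ‖s - -(h • e)‖ ≤ h / (1 + K) / 2 := by
          rw [← dist_eq_norm]; exact hs
      have h2 : ‖-(h • e)‖ = h := by
        rw [norm_neg, norm_smul, hV.norm_eq, mul_one, Real.norm_of_nonneg hpos.le]
      have h3 := norm_le_norm_add_norm_sub' s (-(h • e))
      linarith
    obtain ⟨k, h0, h1, hk⟩ := exists_kernel (-(h • e)) (half_pos hρ')
    refine ⟨k, h0, h1, fun s hs => ?_, fun y hy s hs => ?_⟩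
    · rw [hk] at hs
      have := hball s hs
      have h2 := min_le_left (ε / 2) (δ / 3)
      simp only [mem_closedBall_zero_iff]
      linarith
    · rw [hk] at hs
      have h2 := hball _ hs
      have h3 := min_le_right (ε / 2) (δ / 3)
      have hyV : y + s ∈ V := hδV (Metric.mem_thickening_iff.2 ⟨y, hy.2, by
        rw [dist_eq_norm, add_sub_cancel_left]; linarith⟩)
      obtain ⟨y', ⟨hy'V, hy'ρ⟩, hy'D⟩ := mem_closure_iff_nhds.1 hy.1
        (V ∩ Metric.ball y (h / (1 + K) / 2))
        (Filter.inter_mem (hV.isOpen.mem_nhds (hχ hy.2)) (Metric.ball_mem_nhds _ (half_pos hρ')))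
      have hy'G := (hV.mem_iff y' hy'V).1 hy'D
      rw [hV.mem_iff _ hyV]
      have h4 := sub_mem_subgraph hV.norm_eq hV.lipschitz hy'G (s := y' - (y + s)) (h := h) ?_
      · simpa using h4
      · have h5 : ‖y' - y‖ ≤ h / (1 + K) / 2 := by
          rw [← dist_eq_norm]; exact (Metric.mem_ball.1 hy'ρ).le
        have h6 : ‖s - -(h • e)‖ ≤ h / (1 + K) / 2 := by
          rw [← dist_eq_norm]; exact hs
        have h7 : y' - (y + s) - h • e = (y' - y) - (s - -(h • e)) := by abel
        rw [h7]
        have := norm_sub_le (y' - y) (s - -(h • e))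
        linarith

theorem exists_kernel_seq {p : TestRd d → Prop} (h : ∀ ε > 0, ∃ k : TestRd d, (∀ x, 0 ≤ k x) ∧
    ∫ x, k x = 1 ∧ tsupport k ⊆ Metric.closedBall 0 ε ∧ p k) :
    ∃ k : ℕ → TestRd d, (∀ n x, 0 ≤ k n x) ∧ (∀ n, ∫ x, k n x = 1) ∧
      Tendsto (fun n => Function.support (k n)) atTop (𝓝 (0 : Rd d)).smallSets ∧
      ∀ n, p (k n) := by
  choose k h0 h1 hs hp using fun n : ℕ => h (1 / ((n : ℝ) + 1)) Nat.one_div_pos_of_nat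
  refine ⟨k, h0, h1, ?_, hp⟩
  rw [tendsto_smallSets_iff]
  intro t ht
  obtain ⟨ε, hε, hεt⟩ := Metric.nhds_basis_closedBall.mem_iff.1 ht
  filter_upwards [tendsto_one_div_add_atTop_nhds_zero_nat.eventually_lt_const hε] with n hn
  exact (subset_tsupport _).trans ((hs n).trans
    ((Metric.closedBall_subset_closedBall hn.le).trans hεt))

/-- A smooth partition of unity on a bounded Lipschitz domain subordinate to graph charts. -/
theorem exists_chart_partition (hD : IsBoundedLipschitzDomain D) :
    ∃ (ι : Type) (_ : Fintype ι) (χ : ι → TestRd d), (∀ i, IsChartCutoff D (χ i)) ∧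
      (∀ i x, 0 ≤ χ i x) ∧ (∀ i x, χ i x ≤ 1) ∧ ∀ x ∈ closure (D : Set (Rd d)), ∑ i, χ i x = 1 := by
  choose! e γ K ε he hγ hε hmem using hD.locally_graph
  have hcpt : IsCompact (frontier (D : Set (Rd d))) :=
    Metric.isCompact_of_isClosed_isBounded isClosed_frontier
      (hD.bounded.closure.subset frontier_subset_closure)
  obtain ⟨t, hcov⟩ := hcpt.elim_nhds_subcover' (fun x hx => Metric.ball x (ε x))
    fun x hx => Metric.ball_mem_nhds x (hε x hx)
  let V : Option (Fin t.card) → Set (Rd d) := fun i => i.elim (D : Set (Rd d))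
    fun j => Metric.ball (t.equivFin.symm j : frontier (D : Set (Rd d)))
      (ε (t.equivFin.symm j : frontier (D : Set (Rd d))))
  have hVo : ∀ i, IsOpen (V i) := by
    rintro (_ | j)
    · exact D.isOpen
    · exact Metric.isOpen_ball
  have hVb : ∀ i, Bornology.IsBounded (V i) := by
    rintro (_ | j)
    · exact hD.bounded
    · exact Metric.isBounded_ball
  have hVcov : closure (D : Set (Rd d)) ⊆ ⋃ i, V i := by
    intro x hx
    by_cases hxD : x ∈ (D : Set (Rd d))
    · exact Set.mem_iUnion.2 ⟨none, hxD⟩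
    · have hxf : x ∈ frontier (D : Set (Rd d)) := ⟨hx, by rwa [D.isOpen.interior_eq]⟩
      obtain ⟨y, hy, hxy⟩ := Set.mem_iUnion₂.1 (hcov hxf)
      refine Set.mem_iUnion.2 ⟨some (t.equivFin ⟨y, hy⟩), ?_⟩
      change x ∈ Metric.ball _ _
      rw [Equiv.symm_apply_apply]
      exact hxy
  obtain ⟨f, hf⟩ := SmoothPartitionOfUnity.exists_isSubordinate 𝓘(ℝ, Rd d)
    (isClosed_closure (s := (D : Set (Rd d)))) V hVo hVcov
  have hcs : ∀ i, HasCompactSupport (f i) := fun i =>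
    Metric.isCompact_of_isClosed_isBounded (isClosed_tsupport _) ((hVb i).subset (hf i))
  refine ⟨Option (Fin t.card), inferInstance, fun i => TestRd.mk (f i)
    (contMDiff_iff_contDiff.1 (f i).contMDiff) (hcs i), ?_, fun i x => f.nonneg i x,
    fun i x => f.le_one i x, fun x hx => ?_⟩
  · rintro (_ | j)
    · exact Or.inl (hf none)
    · let x₀ : frontier (D : Set (Rd d)) := t.equivFin.symm j
      exact Or.inr ⟨_, e x₀, γ x₀, K x₀, ⟨hVo (some j), he _ x₀.2, hγ _ x₀.2, hmem _ x₀.2⟩,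
        hf (some j)⟩
  · have := f.sum_eq_one hx
    rwa [finsum_eq_sum_of_fintype] at this

theorem tsupport_reflectTest_subset (k : TestRd d) (x : Rd d) :
    tsupport (reflectTest k x) ⊆ {y | x - y ∈ tsupport k} := by
  refine closure_minimal (fun y hy => subset_tsupport _ hy) ?_
  exact (isClosed_tsupport _).preimage (continuous_const.sub continuous_id)

/-- Weak approximation suffices: the closure of a subspace is its double orthogonal. Hence only weak
convergence of mollifications is ever needed. -/
theorem H1.mem_closure_of_orthogonal {S : Submodule ℝ (H1 D)} {u : H1 D}
    (h : ∀ z ∈ Sᗮ, ⟪z, u⟫_ℝ = 0) : u ∈ S.topologicalClosure := by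
  rw [← Submodule.orthogonal_orthogonal_eq_closure]
  exact (Submodule.mem_orthogonal _ _).2 h

/-- Smooth functions on `ℝ^d` are dense in `H¹(D)`. -/
theorem H1.closure_ofTest_eq_top (hD : IsBoundedLipschitzDomain D) :
    (LinearMap.range (H1.ofTestₗ D ⊤)).topologicalClosure = ⊤ := by
  refine eq_top_iff.2 fun u _ => H1.mem_closure_of_orthogonal fun z hz => ?_
  obtain ⟨ι, _, χ, hχ, -, -, h1⟩ := exists_chart_partition hD
  rw [← sum_innerCutoff (fun x hx => h1 x (subset_closure hx)) z u]
  refine Finset.sum_eq_zero fun i _ => ?_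
  obtain ⟨k, hk0, hk1, hks, hk⟩ := exists_kernel_seq fun ε hε => exists_outward_kernel (hχ i) hε
  -- The localized inner product is the limit of the inner products of z with mollifications. All of
  -- these vanish, since z is orthogonal to the smooth functions.
  refine tendsto_nhds_unique (tendsto_inner_mollify z u (χ i) hk0 hk1 hks fun n x hx v =>
    boundaryForm_eq_zero_of_tsupport_subset _ (fun y hy => ?_) v u) ?_
  · refine hk n x hx y (tsupport_mul_subset_left hy) ?_
    exact tsupport_reflectTest_subset _ _ (tsupport_mul_subset_right (f := χ i) hy)
  · refine tendsto_const_nhds.congr fun n => ?_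
    exact ((Submodule.mem_orthogonal' _ _).1 hz _ ⟨_, rfl⟩).symm

/-- The support lies in the sum of the kernel's support and the compact set closure(D) ∩ supp χ,
which the hypothesis places in D. -/
theorem tsupport_mollify_subset (k χ : TestRd d) (u : H1 D)
    (h : ∀ y ∈ closure (D : Set (Rd d)) ∩ tsupport χ, ∀ s ∈ tsupport k, y + s ∈ D) :
    tsupport (mollify k χ u) ⊆ D := by
  have hc : IsCompact (tsupport k + (closure (D : Set (Rd d)) ∩ tsupport χ)) :=
    k.hasCompactSupport.isCompact.add (χ.hasCompactSupport.isCompact.inter_left isClosed_closure)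
  have h1 : tsupport (mollify k χ u) ⊆ tsupport k + (closure (D : Set (Rd d)) ∩ tsupport χ) := by
    refine closure_minimal ?_ hc.isClosed
    refine (support_convolution_subset _).trans (Set.add_subset_add (subset_tsupport _) ?_)
    intro y hy
    have hy' : cutoff χ u y ≠ 0 := hy
    have hyD : y ∈ (D : Set (Rd d)) := by
      by_contra hn
      exact hy' (Set.indicator_of_notMem (f := fun x => χ x * H1.toL2 D u x) hn)
    refine ⟨subset_closure hyD, subset_tsupport _ fun h0 => hy' ?_⟩
    rw [cutoff, zeroExt, Set.indicator_of_mem hyD, h0, zero_mul]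
  refine h1.trans ?_
  rintro _ ⟨s, hs, y, hy, rfl⟩
  have := h y hy s hs
  rwa [add_comm] at this

/-- A function in `H¹(D)` without boundary terms is a limit of test functions on `D`. -/
theorem H1.mem_closure_of_boundaryForm_eq_zero (hD : IsBoundedLipschitzDomain D) {u : H1 D}
    (hu : ∀ (φ : TestRd d) (v : Rd d), boundaryForm D φ v u = 0) :
    u ∈ (LinearMap.range (H1.ofTestₗ D D)).topologicalClosure := by
  refine H1.mem_closure_of_orthogonal fun z hz => ?_
  obtain ⟨ι, _, χ, hχ, -, -, h1⟩ := exists_chart_partition hD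
  rw [← sum_innerCutoff (fun x hx => h1 x (subset_closure hx)) z u]
  refine Finset.sum_eq_zero fun i _ => ?_
  obtain ⟨k, hk0, hk1, hks, hk⟩ := exists_kernel_seq fun ε hε => exists_inward_kernel (hχ i) hε
  refine tendsto_nhds_unique (tendsto_inner_mollify z u (χ i) hk0 hk1 hks fun n x hx v =>
    hu _ _) ?_
  refine tendsto_const_nhds.congr fun n => ?_
  let ψ : 𝓓(D, ℝ) := ⟨mollify (k n) (χ i) u, (mollify (k n) (χ i) u).contDiff,
    (mollify (k n) (χ i) u).hasCompactSupport, tsupport_mollify_subset _ _ u (hk n)⟩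
  exact ((Submodule.mem_orthogonal' _ _).1 hz _ ⟨ψ, rfl⟩).symm

end

section

variable {d : ℕ} {D U : Opens (Rd d)}

/-! ### Boundary integrals -/

open scoped Convolution
open Measure

theorem euclideanHausdorffMeasure_image_le {X Y : Type*} [MetricSpace X] [MetricSpace Y]
    [MeasurableSpace X] [BorelSpace X] [MeasurableSpace Y] [BorelSpace Y] {f : X → Y}
    (hf : LipschitzWith 1 f) (n : ℕ) (s : Set X) :
    (euclideanHausdorffMeasure n : Measure Y) (f '' s) ≤ euclideanHausdorffMeasure n s := by
  rw [euclideanHausdorffMeasure_def, euclideanHausdorffMeasure_def, Measure.smul_apply,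
    Measure.smul_apply]
  gcongr
  simpa using hf.hausdorffMeasure_image_le (d := n) (by positivity) s

/-- The coordinates `(y, t) ↦ y + t e` with `y ⊥ e`. -/
def orthCoord (e : Rd d) (he : ‖e‖ = 1) : ((ℝ ∙ e)ᗮ × ℝ) ≃L[ℝ] Rd d :=
  LinearEquiv.toContinuousLinearEquiv
    { toFun := fun p => (p.1 : Rd d) + p.2 • e
      map_add' := fun p q => by simp [add_smul]; abel
      map_smul' := fun c p => by simp [mul_smul]
      invFun := fun x => (⟨x - ⟪x, e⟫_ℝ • e, by
        rw [Submodule.mem_orthogonal_singleton_iff_inner_left, inner_sub_left, inner_smul_left,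
          real_inner_self_eq_norm_sq, he]
        simp⟩, ⟪x, e⟫_ℝ)
      left_inv := fun p => by
        have h1 : ⟪(p.1 : Rd d), e⟫_ℝ = 0 :=
          (Submodule.mem_orthogonal_singleton_iff_inner_left).1 p.1.2
        have h2 : ⟪(p.1 : Rd d) + p.2 • e, e⟫_ℝ = p.2 := by
          rw [inner_add_left, h1, inner_smul_left, real_inner_self_eq_norm_sq, he]
          simp
        ext1
        · exact Subtype.ext (by simp [h2])
        · exact h2
      right_inv := fun x => by simp }

theorem orthCoord_apply (e : Rd d) (he : ‖e‖ = 1) (p : (ℝ ∙ e)ᗮ × ℝ) :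
    orthCoord e he p = (p.1 : Rd d) + p.2 • e := rfl

theorem inner_orthCoord (e : Rd d) (he : ‖e‖ = 1) (p : (ℝ ∙ e)ᗮ × ℝ) :
    ⟪(p.1 : Rd d) + p.2 • e, e⟫_ℝ = p.2 :=
  congrArg Prod.snd ((orthCoord e he).symm_apply_apply p)

/-- Uniqueness of Haar measure; the value of the constant plays no role, since only inequalities up
to a constant are needed. -/
theorem exists_volume_eq_smul_map_orthCoord (e : Rd d) (he : ‖e‖ = 1) : ∃ c : ℝ≥0,
    (volume : Measure (Rd d)) = c • ((volume : Measure (ℝ ∙ e)ᗮ).prod volume).map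
      (orthCoord e he) := by
  have h := (orthCoord e he).isAddHaarMeasure_map
    ((volume : Measure (ℝ ∙ e)ᗮ).prod (volume : Measure ℝ))
  exact ⟨_, isAddLeftInvariant_eq_smul _ _⟩

/-- The part of a graph chart near the boundary. -/
def graphStrip (e : Rd d) (γ : Rd d → ℝ) (δ : ℝ) : Set (Rd d) :=
  {x | |⟪x, e⟫_ℝ - γ (x - ⟪x, e⟫_ℝ • e)| ≤ δ}

theorem isClosed_graphStrip {e : Rd d} {γ : Rd d → ℝ} (hγ : Continuous γ) (δ : ℝ) :
    IsClosed (graphStrip e γ δ) :=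
  isClosed_le (by fun_prop) continuous_const

theorem orthCoord_mem_graphStrip {e : Rd d} (he : ‖e‖ = 1) (γ : Rd d → ℝ) (δ : ℝ)
    (y : (ℝ ∙ e)ᗮ) (t : ℝ) : (y : Rd d) + t • e ∈ graphStrip e γ δ ↔ |t - γ y| ≤ δ := by
  have h := inner_orthCoord e he (y, t)
  simp only at h
  rw [graphStrip, Set.mem_ofPred_eq, h, add_sub_cancel_right]

/-- Fubini in the coordinates (y, t): each vertical section of the strip is an interval of length
2δ. -/
theorem lintegral_graphStrip_le {e : Rd d} (he : ‖e‖ = 1) {γ : Rd d → ℝ} (hγ : Continuous γ)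
    {c : ℝ≥0} (hc : (volume : Measure (Rd d))
      = c • ((volume : Measure (ℝ ∙ e)ᗮ).prod volume).map (orthCoord e he))
    {f : Rd d → ℝ≥0∞} (hf : Measurable f) {δ : ℝ} {g : (ℝ ∙ e)ᗮ → ℝ≥0∞}
    (hg : ∀ (y : (ℝ ∙ e)ᗮ) (t : ℝ), |t| ≤ δ → f ((y : Rd d) + (γ y + t) • e) ≤ g y) :
    ∫⁻ x in graphStrip e γ δ, f x ≤ c * ENNReal.ofReal (2 * δ) * ∫⁻ y, g y := by
  have hm := (isClosed_graphStrip (e := e) hγ δ).measurableSet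
  have hind : Measurable ((graphStrip e γ δ).indicator f) := hf.indicator hm
  have hind' : Measurable fun p => (graphStrip e γ δ).indicator f (orthCoord e he p) :=
    hind.comp (orthCoord e he).continuous.measurable
  rw [← lintegral_indicator hm, hc, lintegral_smul_measure, lintegral_map hind
    (orthCoord e he).continuous.measurable, lintegral_prod _ hind'.aemeasurable, ENNReal.smul_def,
    smul_eq_mul, mul_assoc]
  gcongr
  refine (lintegral_mono (g := fun y => ENNReal.ofReal (2 * δ) * g y) fun y => ?_).trans
    (lintegral_const_mul' _ _ ENNReal.ofReal_ne_top).le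
  calc ∫⁻ t, (graphStrip e γ δ).indicator f (orthCoord e he (y, t))
      ≤ ∫⁻ t, (Set.Icc (γ y - δ) (γ y + δ)).indicator (fun _ => g y) t := by
        refine lintegral_mono fun t => ?_
        rw [orthCoord_apply]
        by_cases ht : |t - γ y| ≤ δ
        · have h1 : t ∈ Set.Icc (γ y - δ) (γ y + δ) := by
            rw [abs_le] at ht
            exact ⟨by linarith, by linarith⟩
          rw [Set.indicator_of_mem ((orthCoord_mem_graphStrip he γ δ y t).2 ht),
            Set.indicator_of_mem h1]
          have := hg y (t - γ y) ht
          rwa [add_sub_cancel] at this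
        · rw [Set.indicator_of_notMem fun h => ht ((orthCoord_mem_graphStrip he γ δ y t).1 h)]
          exact zero_le
    _ = ENNReal.ofReal (2 * δ) * g y := by
        rw [lintegral_indicator_const measurableSet_Icc, Real.volume_Icc, mul_comm]
        congr 2
        ring

/-- The points of the graph in a graph chart are boundary points. -/
theorem IsGraphChart.graph_mem_frontier {V : Set (Rd d)} {e : Rd d} {γ : Rd d → ℝ} {K : ℝ≥0}
    (hV : IsGraphChart D V e γ K) {x : Rd d} (hx : x ∈ V)
    (h : ⟪x, e⟫_ℝ = γ (x - ⟪x, e⟫_ℝ • e)) : x ∈ frontier (D : Set (Rd d)) := by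
  refine ⟨?_, ?_⟩
  · have hee : ⟪e, e⟫_ℝ = 1 := by rw [real_inner_self_eq_norm_sq, hV.norm_eq, one_pow]
    have hc : Tendsto (fun t : ℝ => x - t • e) (𝓝[>] 0) (𝓝 x) := by
      have : Tendsto (fun t : ℝ => x - t • e) (𝓝 0) (𝓝 (x - (0 : ℝ) • e)) := by
        apply Continuous.tendsto; fun_prop
      rw [zero_smul, sub_zero] at this
      exact this.mono_left nhdsWithin_le_nhds
    refine mem_closure_of_tendsto hc ?_
    filter_upwards [hc.eventually (hV.isOpen.mem_nhds hx), self_mem_nhdsWithin] with t ht ht0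
    refine (hV.mem_iff _ ht).2 ?_
    change ⟪x - t • e, e⟫_ℝ < γ (x - t • e - ⟪x - t • e, e⟫_ℝ • e)
    have h1 : ⟪x - t • e, e⟫_ℝ = ⟪x, e⟫_ℝ - t := by
      rw [inner_sub_left, inner_smul_left, hee]; simp
    have h2 : x - t • e - ⟪x - t • e, e⟫_ℝ • e = x - ⟪x, e⟫_ℝ • e := by
      rw [h1, sub_smul]; abel
    rw [h2, h1, ← h]
    exact sub_lt_self _ ht0
  · rw [D.isOpen.interior_eq]
    intro hxD
    exact ((hV.mem_iff x hx).1 hxD).ne h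

/-- Projection along e is 1-Lipschitz and maps the graph onto the hyperplane, so Hausdorff measure
on the boundary dominates Lebesgue measure below it. This one-sided bound replaces the area formula.
-/
theorem lintegral_graph_le (hd : 1 ≤ d) {V : Set (Rd d)} {e : Rd d} {γ : Rd d → ℝ} {K : ℝ≥0}
    (hV : IsGraphChart D V e γ K) {f : Rd d → ℝ≥0∞} (hf : Measurable f)
    (hfV : Function.support f ⊆ V) :
    ∫⁻ y : (ℝ ∙ e)ᗮ, f ((y : Rd d) + γ y • e) ≤ ∫⁻ x, f x ∂(surfaceMeasure D) := by
  have hp : Measurable fun y : (ℝ ∙ e)ᗮ => (y : Rd d) + γ y • e := by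
    have := hV.lipschitz.continuous
    apply Continuous.measurable
    fun_prop
  have hrank : Module.finrank ℝ (ℝ ∙ e)ᗮ = d - 1 := by
    have he : e ≠ 0 := fun h => by simpa [h] using hV.norm_eq
    have h1 := Submodule.finrank_add_finrank_orthogonal (ℝ ∙ e)
    rw [finrank_span_singleton he, finrank_euclideanSpace_fin] at h1
    omega
  have hle : ((volume : Measure (ℝ ∙ e)ᗮ).map fun y : (ℝ ∙ e)ᗮ => (y : Rd d) + γ y • e).restrict V
      ≤ surfaceMeasure D := by
    refine Measure.le_iff.2 fun A hA => ?_
    rw [Measure.restrict_apply hA, Measure.map_apply hp (hA.inter hV.isOpen.measurableSet),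
      surfaceMeasure, Measure.restrict_apply hA,
      ← InnerProductSpace.euclideanHausdorffMeasure_eq_volume, hrank]
    let π : Rd d → (ℝ ∙ e)ᗮ := fun x => ((orthCoord e hV.norm_eq).symm x).1
    have hπ : LipschitzWith 1 π := by
      refine LipschitzWith.of_dist_le_mul fun x y => ?_
      rw [dist_eq_norm, dist_eq_norm, NNReal.coe_one, one_mul, ← Prod.fst_sub, ← map_sub]
      exact norm_sub_inner_smul_le hV.norm_eq (x - y)
    refine le_trans (measure_mono ?_) (euclideanHausdorffMeasure_image_le hπ (d - 1) _)
    intro y hy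
    have h0 := inner_orthCoord e hV.norm_eq (y, γ y)
    simp only at h0
    refine ⟨_, ⟨hy.1, hV.graph_mem_frontier hy.2 ?_⟩, ?_⟩
    · rw [h0, add_sub_cancel_right]
    · exact congrArg Prod.fst ((orthCoord e hV.norm_eq).symm_apply_apply (y, γ y))
  calc ∫⁻ y : (ℝ ∙ e)ᗮ, f ((y : Rd d) + γ y • e)
      = ∫⁻ x in V, f x ∂((volume : Measure (ℝ ∙ e)ᗮ).map fun y : (ℝ ∙ e)ᗮ => (y : Rd d) + γ y • e) := by
        rw [← lintegral_map hf hp, setLIntegral_eq_of_support_subset hfV]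
    _ ≤ _ := lintegral_mono' hle le_rfl

/-! ### Gauss-type inequality by translation of subgraphs -/

theorem isOpen_subgraph {e : Rd d} {γ : Rd d → ℝ} (hγ : Continuous γ) : IsOpen (subgraph e γ) :=
  isOpen_lt (by fun_prop) (by fun_prop)

theorem mem_graphStrip_of_mem_subgraph_iff_not {e : Rd d} (he : ‖e‖ = 1) {γ : Rd d → ℝ} {K : ℝ≥0}
    (hγ : LipschitzWith K γ) {x h : Rd d} (hx : ¬(x - h ∈ subgraph e γ ↔ x ∈ subgraph e γ)) :
    x ∈ graphStrip e γ ((1 + K) * ‖h‖) := by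
  have h2 := abs_le.1 (abs_height_sub_le he hγ x h)
  have h3 := abs_le.1 (abs_inner_le_of_norm_eq_one he h)
  have h4 : ⟪x - h, e⟫_ℝ = ⟪x, e⟫_ℝ - ⟪h, e⟫_ℝ := inner_sub_left _ _ _
  simp only [subgraph, Set.mem_ofPred_eq] at hx
  rw [graphStrip, Set.mem_ofPred_eq, abs_le]
  by_cases h5 : ⟪x, e⟫_ℝ < γ (x - ⟪x, e⟫_ℝ • e)
  · have h6 : γ (x - h - ⟪x - h, e⟫_ℝ • e) ≤ ⟪x - h, e⟫_ℝ := by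
      by_contra hn
      exact hx ⟨fun _ => h5, fun _ => not_le.1 hn⟩
    constructor <;> nlinarith [norm_nonneg h, K.2]
  · have h6 : ⟪x - h, e⟫_ℝ < γ (x - h - ⟪x - h, e⟫_ℝ • e) := by
      by_contra hn
      exact hx ⟨fun h7 => absurd h7 hn, fun h7 => absurd h7 h5⟩
    constructor <;> nlinarith [norm_nonneg h, K.2]

/-- In a thin strip F is uniformly close to its value on the graph at the same y, so the strip
integral is at most 2δ times the graph integral plus a small error. The graph integral is bounded by
the surface integral. -/
theorem lintegral_graphStrip_test_le (hd : 1 ≤ d) {V : Set (Rd d)} {e : Rd d} {γ : Rd d → ℝ}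
    {K : ℝ≥0} (hV : IsGraphChart D V e γ K) : ∃ c : ℝ≥0, ∀ F : TestRd d, tsupport F ⊆ V →
      ∀ B : ℝ, 0 ≤ B → ∫⁻ x, ‖F x‖ₑ ∂(surfaceMeasure D) ≤ ENNReal.ofReal B → ∀ η > 0,
      ∃ δ₀ > 0, ∀ δ, 0 ≤ δ → δ ≤ δ₀ → ∫⁻ x in graphStrip e γ δ, ‖F x‖ₑ
        ≤ ENNReal.ofReal (c * (2 * δ) * (B + η)) := by
  have he := hV.norm_eq
  obtain ⟨c, hc⟩ := exists_volume_eq_smul_map_orthCoord e he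
  refine ⟨c, fun F hF B hB hFB η hη => ?_⟩
  obtain ⟨R, hR⟩ := F.hasCompactSupport.isCompact.isBounded.exists_norm_le
  set m : ℝ := ((volume : Measure (ℝ ∙ e)ᗮ) (Metric.closedBall 0 R)).toReal with hm
  have hm0 : 0 ≤ m := ENNReal.toReal_nonneg
  -- The oscillation η' occurs over a set of volume m, hence m η' ≤ η; the 1 avoids division by
  -- zero.
  set η' : ℝ := η / (m + 1) with hη'
  have hη'0 : 0 < η' := by positivity
  obtain ⟨δ₀, hδ₀, hu⟩ := Metric.uniformContinuous_iff.1
    (F.hasCompactSupport.uniformContinuous_of_continuous F.continuous) η' hη'0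
  refine ⟨δ₀ / 2, half_pos hδ₀, fun δ hδ0 hδ => ?_⟩
  have key := lintegral_graphStrip_le he hV.lipschitz.continuous hc (f := fun x => ‖F x‖ₑ) (δ := δ)
    F.continuous.enorm.measurable
    (g := fun y => ‖F ((y : Rd d) + γ y • e)‖ₑ
      + (Metric.closedBall 0 R).indicator (fun _ => ENNReal.ofReal η') y) ?_
  · refine key.trans ?_
    have h1 : Measurable fun y : (ℝ ∙ e)ᗮ => ‖F ((y : Rd d) + γ y • e)‖ₑ := by
      have := hV.lipschitz.continuous
      have hFc := F.continuous
      apply Continuous.measurable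
      fun_prop
    rw [lintegral_add_left h1, lintegral_indicator_const Metric.isClosed_closedBall.measurableSet]
    have h2 := lintegral_graph_le hd hV (f := fun x => ‖F x‖ₑ) F.continuous.enorm.measurable
      (fun x hx => hF (subset_tsupport _ (by simpa using hx)))
    have h3 : ENNReal.ofReal η' * (volume : Measure (ℝ ∙ e)ᗮ) (Metric.closedBall 0 R)
        ≤ ENNReal.ofReal η := by
      rw [← ENNReal.ofReal_toReal (measure_closedBall_lt_top (x := (0 : (ℝ ∙ e)ᗮ))
        (r := R)).ne, ← ENNReal.ofReal_mul hη'0.le]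
      refine ENNReal.ofReal_le_ofReal ?_
      rw [← hm, hη', div_mul_eq_mul_div, div_le_iff₀ (by positivity)]
      nlinarith
    calc _ ≤ (c : ℝ≥0∞) * ENNReal.ofReal (2 * δ) * (ENNReal.ofReal B + ENNReal.ofReal η) := by
          gcongr
          exact h2.trans hFB
      _ = ENNReal.ofReal (c * (2 * δ) * (B + η)) := by
          rw [← ENNReal.ofReal_add hB hη.le, ENNReal.ofReal_mul (p := c * (2 * δ)) (by positivity),
            ENNReal.ofReal_mul (p := c) (by positivity), ENNReal.ofReal_coe_nnreal]
  · intro y t ht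
    by_cases h0 : F ((y : Rd d) + (γ y + t) • e) = 0
    · simp [h0]
    · have h1 := hR _ (subset_tsupport _ h0)
      have h2 : ‖(y : Rd d)‖ ≤ R := by
        have h3 := norm_sub_inner_smul_le he ((y : Rd d) + (γ y + t) • e)
        have h4 := inner_orthCoord e he (y, γ y + t)
        simp only at h4
        rw [h4, add_sub_cancel_right] at h3
        exact h3.trans h1
      have h5 : y ∈ Metric.closedBall (0 : (ℝ ∙ e)ᗮ) R := by simpa using h2
      simp only [Set.indicator_of_mem h5]
      have h6 : dist ((y : Rd d) + (γ y + t) • e) ((y : Rd d) + γ y • e) < δ₀ := by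
        rw [dist_eq_norm, add_sub_add_left_eq_sub, ← sub_smul, add_sub_cancel_left, norm_smul, he,
          mul_one, Real.norm_eq_abs]
        linarith
      have h7 := hu h6
      rw [← ofReal_norm, ← ofReal_norm,
        ← ENNReal.ofReal_add (norm_nonneg _) hη'0.le]
      refine ENNReal.ofReal_le_ofReal ?_
      rw [dist_eq_norm] at h7
      have h8 := norm_le_norm_add_norm_sub' (F ((y : Rd d) + (γ y + t) • e))
        (F ((y : Rd d) + γ y • e))
      linarith

theorem fderiv_test_eq_zero_of_notMem (F : TestRd d) {x : Rd d} (hx : x ∉ tsupport F) (v : Rd d) :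
    fderiv ℝ F x v = 0 := by
  rw [fderiv_of_notMem_tsupport (𝕜 := ℝ) hx, zero_apply]

theorem integrable_fderiv_test (F : TestRd d) (v : Rd d) (μ : Measure (Rd d))
    [IsFiniteMeasureOnCompacts μ] : Integrable (fun x => fderiv ℝ F x v) μ := by
  have := (∂_{v} F : TestRd d).continuous.integrable_of_hasCompactSupport (μ := μ)
    (∂_{v} F : TestRd d).hasCompactSupport
  exact this.congr (ae_of_all _ fun x => lineDeriv_test_apply F v x)

theorem integrable_test (F : 𝓓(U, ℝ)) (μ : Measure (Rd d)) [IsFiniteMeasureOnCompacts μ] :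
    Integrable F μ :=
  F.continuous.integrable_of_hasCompactSupport F.hasCompactSupport

theorem setIntegral_translate_sub {G : Set (Rd d)} (hG : MeasurableSet G) (F : TestRd d)
    (h : Rd d) : (∫ x in G, F (x + h)) - ∫ x in G, F x
      = ∫ x, (G.indicator (fun _ => (1 : ℝ)) (x - h) - G.indicator (fun _ => 1) x) * F x := by
  have hF := integrable_test F volume
  have h1 : ∀ f : Rd d → ℝ, ∫ x in G, f x = ∫ x, G.indicator (fun _ => (1 : ℝ)) x * f x := by
    intro f
    rw [← integral_indicator hG]
    refine integral_congr_ae (ae_of_all _ fun x => ?_)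
    by_cases hx : x ∈ G <;> simp [hx]
  have h2 : ∀ s : Set (Rd d), MeasurableSet s →
      Integrable (fun x => s.indicator (fun _ => (1 : ℝ)) x * F x) := fun s hs => by
    refine (hF.indicator hs).congr (ae_of_all _ fun x => ?_)
    by_cases hx : x ∈ s <;> simp [hx]
  rw [h1, h1, ← integral_sub_right_eq_self (fun x => G.indicator (fun _ => (1 : ℝ)) x * F (x + h)) h,
    ← integral_sub]
  · refine integral_congr_ae (ae_of_all _ fun x => ?_)
    simp only [sub_add_cancel, sub_mul]
  · simp only [sub_add_cancel]
    exact h2 ((fun x => x - h) ⁻¹' G) (hG.preimage (measurable_id.sub_const h))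
  · exact h2 G hG

/-- The translated integral is the convolution of F with the indicator of -G, and a convolution is
differentiated through its smooth factor. -/
theorem hasFDerivAt_setIntegral_translate {G : Set (Rd d)} (hG : MeasurableSet G) (F : TestRd d) :
    ∃ L : Rd d →L[ℝ] ℝ, HasFDerivAt (fun h => ∫ x in G, F (x + h)) L 0 ∧
      ∀ v, L v = ∫ x in G, fderiv ℝ F x v := by
  let f : Rd d → ℝ := (-G).indicator fun _ => 1
  have hG' : MeasurableSet (-G) := hG.neg
  have hf : LocallyIntegrable f := (locallyIntegrable_const (1 : ℝ)).indicator hG'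
  have h := F.hasCompactSupport.hasFDerivAt_convolution_right (ContinuousLinearMap.lsmul ℝ ℝ)
    hf (F.contDiff.of_le (by exact_mod_cast le_top)) (0 : Rd d)
  have key : ∀ (g : Rd d → ℝ) (x : Rd d), ∫ t, f t * g (x - t) = ∫ y in G, g (y + x) := by
    intro g x
    rw [← integral_neg_eq_self, ← integral_indicator hG]
    refine integral_congr_ae (ae_of_all _ fun y => ?_)
    by_cases hy : y ∈ G <;> simp [f, hy, add_comm]
  refine ⟨_, h.congr_of_eventuallyEq (Eventually.of_forall fun x => (key F x).symm), fun v => ?_⟩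
  rw [convolution_precompR_apply _ hf (F.hasCompactSupport.fderiv (𝕜 := ℝ))
    (continuous_fderiv_test F)]
  have := key (fun y => fderiv ℝ F y v) 0
  simp only [add_zero] at this
  exact this

/-- In a graph chart, the integral of a derivative is controlled by a boundary integral. -/
theorem IsGraphChart.setIntegral_fderiv_le (hd : 1 ≤ d) {V : Set (Rd d)} {e : Rd d}
    {γ : Rd d → ℝ} {K : ℝ≥0} (hV : IsGraphChart D V e γ K) : ∃ C : ℝ, 0 ≤ C ∧
      ∀ F : TestRd d, tsupport F ⊆ V → ∀ B : ℝ, 0 ≤ B →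
      ∫⁻ x, ‖F x‖ₑ ∂(surfaceMeasure D) ≤ ENNReal.ofReal B → ∀ v,
      |∫ x in (D : Set (Rd d)), fderiv ℝ F x v| ≤ C * ‖v‖ * B := by
  obtain ⟨c, hc⟩ := lintegral_graphStrip_test_le hd hV
  refine ⟨c * (2 * (1 + K)), by positivity, fun F hF B hB hFB v => ?_⟩
  have hG := (isOpen_subgraph (e := e) hV.lipschitz.continuous).measurableSet
  obtain ⟨L, hL, hLv⟩ := hasFDerivAt_setIntegral_translate hG F
  -- F is supported in the chart, where D and the subgraph coincide, so the whole subgraph may be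
  -- used.
  have hDG : ∫ x in (D : Set (Rd d)), fderiv ℝ F x v = L v := by
    rw [hLv, ← integral_indicator hG, ← integral_indicator D.isOpen.measurableSet]
    refine integral_congr_ae (ae_of_all _ fun x => ?_)
    by_cases hx : x ∈ tsupport F
    · have := hV.mem_iff x (hF hx)
      by_cases hxD : x ∈ D
      · rw [Set.indicator_of_mem (this.1 hxD), Set.indicator_of_mem (s := (D : Set (Rd d))) hxD]
      · rw [Set.indicator_of_notMem fun h => hxD (this.2 h),
          Set.indicator_of_notMem (s := (D : Set (Rd d))) hxD]
    · have h0 := fderiv_test_eq_zero_of_notMem F hx v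
      have hz : ∀ s : Set (Rd d), s.indicator (fun x => fderiv ℝ F x v) x = 0 := fun s =>
        Set.indicator_apply_eq_zero.2 fun _ => h0
      rw [hz, hz]
  -- A translation by h changes membership in the subgraph only inside the strip of half-width (1 +
  -- K)‖h‖. The integral over this strip bounds the difference quotient of h ↦ ∫ F(x + h) at 0, and
  -- so the norm of its derivative L.
  have hbound : ∀ η > 0, ‖L‖ ≤ c * (2 * (1 + K)) * (B + η) := by
    intro η hη
    obtain ⟨δ₀, hδ₀, hstrip⟩ := hc F hF B hB hFB η hη
    refine hL.le_of_lip' (by positivity) ?_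
    have hK : (0 : ℝ) < 1 + K := by positivity
    filter_upwards [Metric.closedBall_mem_nhds (0 : Rd d) (div_pos hδ₀ hK)] with h hh
    rw [mem_closedBall_zero_iff, le_div_iff₀ hK] at hh
    have h1 := hstrip ((1 + K) * ‖h‖) (by positivity) (by linarith)
    simp only [add_zero, sub_zero]
    rw [setIntegral_translate_sub hG]
    have h2 : ‖∫ x, ((subgraph e γ).indicator (fun _ => (1 : ℝ)) (x - h)
        - (subgraph e γ).indicator (fun _ => 1) x) * F x‖ₑ
        ≤ ∫⁻ x in graphStrip e γ ((1 + K) * ‖h‖), ‖F x‖ₑ := by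
      refine (enorm_integral_le_lintegral_enorm _).trans ?_
      rw [← lintegral_indicator (isClosed_graphStrip hV.lipschitz.continuous _).measurableSet]
      refine lintegral_mono fun x => ?_
      classical
      by_cases hx : (x - h ∈ subgraph e γ ↔ x ∈ subgraph e γ)
      · have : (subgraph e γ).indicator (fun _ => (1 : ℝ)) (x - h)
            - (subgraph e γ).indicator (fun _ => 1) x = 0 := by
          rw [Set.indicator_apply, Set.indicator_apply, if_congr hx rfl rfl, sub_self]
        simp [this]
      · rw [Set.indicator_of_mem
          (mem_graphStrip_of_mem_subgraph_iff_not hV.norm_eq hV.lipschitz hx), enorm_mul]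
        refine mul_le_of_le_one_left (zero_le) ?_
        rw [← ofReal_norm, ← ENNReal.ofReal_one]
        refine ENNReal.ofReal_le_ofReal ?_
        rw [Real.norm_eq_abs, Set.indicator_apply, Set.indicator_apply]
        split_ifs <;> simp
    have h3 := h2.trans h1
    rw [← ofReal_norm, ENNReal.ofReal_le_ofReal_iff (by positivity)] at h3
    refine h3.trans (le_of_eq ?_)
    ring
  have hL' : ‖L‖ ≤ c * (2 * (1 + K)) * B := by
    refine le_of_forall_pos_le_add fun ε hε => ?_
    have hM : (0 : ℝ) ≤ c * (2 * (1 + K)) := by positivity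
    refine (hbound (ε / (c * (2 * (1 + K)) + 1)) (by positivity)).trans ?_
    rw [mul_add, mul_div_assoc']
    gcongr
    rw [div_le_iff₀ (by positivity)]
    nlinarith
  rw [hDG, ← Real.norm_eq_abs]
  refine (L.le_opNorm v).trans ?_
  calc ‖L‖ * ‖v‖ ≤ c * (2 * (1 + K)) * B * ‖v‖ := by gcongr
    _ = _ := by ring

/-- The integral over `D` of a derivative is controlled by a boundary integral. -/
theorem setIntegral_fderiv_le (hd : 1 ≤ d) (hD : IsBoundedLipschitzDomain D) : ∃ C : ℝ, 0 ≤ C ∧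
    ∀ F : TestRd d, ∀ B : ℝ, 0 ≤ B →
      ∫⁻ x, ‖F x‖ₑ ∂(surfaceMeasure D) ≤ ENNReal.ofReal B → ∀ v,
      |∫ x in (D : Set (Rd d)), fderiv ℝ F x v| ≤ C * ‖v‖ * B := by
  obtain ⟨ι, _, χ, hχ, hχ0, hχ1, h1⟩ := exists_chart_partition hD
  have hloc : ∀ i, ∃ C : ℝ, 0 ≤ C ∧ ∀ F : TestRd d, tsupport F ⊆ tsupport (χ i) → ∀ B : ℝ, 0 ≤ B →
      ∫⁻ x, ‖F x‖ₑ ∂(surfaceMeasure D) ≤ ENNReal.ofReal B → ∀ v,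
      |∫ x in (D : Set (Rd d)), fderiv ℝ F x v| ≤ C * ‖v‖ * B := by
    intro i
    rcases hχ i with h | ⟨V, e, γ, K, hV, h⟩
    · refine ⟨0, le_rfl, fun F hF B hB _ v => ?_⟩
      rw [setIntegral_eq_integral_of_forall_compl_eq_zero fun x hx =>
        fderiv_test_eq_zero_of_notMem F (fun hx' => hx (h (hF hx'))) v, integral_fderiv_test]
      simp
    · obtain ⟨C, hC, hCF⟩ := hV.setIntegral_fderiv_le hd
      exact ⟨C, hC, fun F hF => hCF F (hF.trans h)⟩
  choose C hC hCF using hloc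
  refine ⟨∑ i, C i, Finset.sum_nonneg fun i _ => hC i, fun F B hB hFB v => ?_⟩
  have hsum : ∫ x in (D : Set (Rd d)), fderiv ℝ F x v
      = ∑ i, ∫ x in (D : Set (Rd d)), fderiv ℝ (mulTest (χ i) F) x v := by
    rw [← integral_finsetSum _ fun i _ => integrable_fderiv_test _ v _]
    refine setIntegral_congr_fun D.isOpen.measurableSet fun x hx => ?_
    have h1' : ∀ x ∈ D, ∑ i, χ i x = 1 := fun x hx => h1 x (subset_closure hx)
    simp only [fderiv_mulTest]
    rw [Finset.sum_add_distrib, ← Finset.sum_mul, ← Finset.sum_mul, h1' x hx,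
      sum_fderiv_eq_zero h1' hx, zero_mul, zero_add, one_mul]
  rw [hsum, Finset.sum_mul, Finset.sum_mul]
  refine (Finset.abs_sum_le_sum_abs _ _).trans (Finset.sum_le_sum fun i _ => ?_)
  refine hCF i _ (tsupport_mul_subset_left (f := χ i) (g := F)) B hB
    (le_trans (lintegral_mono fun x => ?_) hFB) v
  rw [mulTest_apply, enorm_mul]
  refine mul_le_of_le_one_left (zero_le) ?_
  rw [← ofReal_norm, ← ENNReal.ofReal_one]
  refine ENNReal.ofReal_le_ofReal ?_
  rw [Real.norm_of_nonneg (hχ0 i x)]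
  exact hχ1 i x

end

section

variable {d : ℕ} {D U : Opens (Rd d)}

/-! ### The trace operator -/

/-- If no trace operator existed, the default value 0 would make (ker Tr)^⊥ trivial, contradicting
the unit vector g 0. The given basis of H^{1/2}(∂D) thus supplies the trace. -/
theorem isTraceOperator_trace (g : HilbertBasis ℕ ℝ (HHalf D)) : IsTraceOperator D (trace D) := by
  by_cases h : ∃ τ, IsTraceOperator D τ
  · rw [trace, dif_pos h]
    exact h.choose_spec
  · exfalso
    have h0 : trace D = 0 := by rw [trace, dif_neg h]
    have h1 := (g 0).2
    have h2 : ((g 0 : HHalf D) : H1 D) = 0 := by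
      refine inner_self_eq_zero (𝕜 := ℝ).1 ((Submodule.mem_orthogonal _ _).1 h1 _ ?_)
      rw [LinearMap.mem_ker, h0]
      rfl
    have h3 := g.orthonormal.1 0
    rw [Submodule.coe_norm, h2, norm_zero] at h3
    exact zero_ne_one h3

theorem IsTraceOperator.ofTest_ae_eq {τ : H1 D →L[ℝ] L2Boundary D} (hτ : IsTraceOperator D τ)
    (ψ : 𝓓(U, ℝ)) : τ (H1.ofTest D ψ) =ᵐ[surfaceMeasure D] ψ :=
  hτ ψ ψ.contDiff ψ.hasCompactSupport _ (coeFn_testL2 ψ)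

theorem ae_surfaceMeasure_mem_frontier :
    ∀ᵐ x ∂(surfaceMeasure D), x ∈ frontier (D : Set (Rd d)) :=
  ae_restrict_mem isClosed_frontier.measurableSet

theorem IsTraceOperator.ofTest_eq_zero {τ : H1 D →L[ℝ] L2Boundary D} (hτ : IsTraceOperator D τ)
    (φ : 𝓓(D, ℝ)) : τ (H1.ofTest D φ) = 0 := by
  refine (Lp.eq_zero_iff_ae_eq_zero).2 ?_
  filter_upwards [hτ.ofTest_ae_eq φ, ae_surfaceMeasure_mem_frontier] with x h1 h2
  rw [h1]
  refine test_eq_zero_of_notMem φ fun h => ?_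
  have h3 := h2.2
  rw [D.isOpen.interior_eq] at h3
  exact h3 h

/-- A smooth compactly supported function which equals `1` on the closure of `D`. -/
theorem exists_test_eq_one (hD : IsBoundedLipschitzDomain D) :
    ∃ ζ : TestRd d, ∀ x ∈ closure (D : Set (Rd d)), ζ x = 1 := by
  obtain ⟨ι, _, χ, -, -, -, h1⟩ := exists_chart_partition hD
  refine ⟨∑ i, χ i, fun x hx => ?_⟩
  rw [← h1 x hx]
  simp

/-- The trace of a cutoff equal to 1 on the closure is the constant 1, and it is square integrable.
-/
theorem IsTraceOperator.isFiniteMeasure (hD : IsBoundedLipschitzDomain D)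
    {τ : H1 D →L[ℝ] L2Boundary D} (hτ : IsTraceOperator D τ) :
    IsFiniteMeasure (surfaceMeasure D) := by
  obtain ⟨ζ, hζ⟩ := exists_test_eq_one hD
  have h1 : MemLp (fun _ => (1 : ℝ)) 2 (surfaceMeasure D) := by
    refine (Lp.memLp (τ (H1.ofTest D ζ))).ae_eq ?_
    filter_upwards [hτ.ofTest_ae_eq ζ, ae_surfaceMeasure_mem_frontier] with x h1 h2
    rw [h1, hζ x (frontier_subset_closure h2)]
  rw [memLp_const_iff (by norm_num) (by norm_num)] at h1
  exact ⟨h1.resolve_left one_ne_zero⟩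

theorem boundaryForm_ofTest (φ ψ : TestRd d) (v : Rd d) :
    boundaryForm D φ v (H1.ofTest D ψ) = ∫ x in (D : Set (Rd d)), fderiv ℝ (mulTest ψ φ) x v := by
  rw [boundaryForm_apply, ← integral_add]
  · refine integral_congr_ae ?_
    filter_upwards [coeFn_testL2 (D := D) ψ, H1.coeFn_grad_ofTest (D := D) ψ] with x h1 h2
    rw [H1.toL2_ofTest, h1, h2, inner_gradient, fderiv_mulTest]
    ring
  · have := (Lp.memLp (H1.toL2 D (H1.ofTest D ψ))).integrable_mul
      (testFunction_memLp (∂_{v} φ : TestRd d) (volume.restrict (D : Set (Rd d))))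
    exact this.congr (ae_of_all _ fun x => by rw [Pi.mul_apply, lineDeriv_test_apply])
  · exact ((Lp.memLp _).inner_const v).integrable_mul (testFunction_memLp φ _)

theorem lintegral_enorm_le_norm_mul {μ : Measure (Rd d)} [IsFiniteMeasure μ] (f : Lp ℝ 2 μ) :
    ∫⁻ x, ‖f x‖ₑ ∂μ ≤ ENNReal.ofReal (‖f‖ * (μ.real Set.univ) ^ (1 / 2 : ℝ)) := by
  have h := eLpNorm_le_eLpNorm_mul_rpow_measure_univ (p := 1) (q := 2) (by norm_num)
    (Lp.aestronglyMeasurable f)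
  rw [eLpNorm_one_eq_lintegral_enorm] at h
  refine h.trans (le_of_eq ?_)
  rw [ENNReal.ofReal_mul (norm_nonneg _), Lp.norm_def, ENNReal.ofReal_toReal (Lp.eLpNorm_ne_top f),
    measureReal_def, ENNReal.toReal_rpow, ENNReal.ofReal_toReal]
  · norm_num
  · exact ENNReal.rpow_ne_top_of_nonneg (by norm_num) (measure_ne_top _ _)

/-- The boundary term in the formula of integration by parts is controlled by the trace. -/
theorem IsTraceOperator.abs_boundaryForm_le (hd : 1 ≤ d) (hD : IsBoundedLipschitzDomain D)
    {τ : H1 D →L[ℝ] L2Boundary D} (hτ : IsTraceOperator D τ) : ∃ C : ℝ, 0 ≤ C ∧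
      ∀ (φ : TestRd d) (M : ℝ), 0 ≤ M → (∀ x, |φ x| ≤ M) → ∀ (v : Rd d) (u : H1 D),
      |boundaryForm D φ v u| ≤ C * ‖v‖ * M * ‖τ u‖ := by
  have hfin := hτ.isFiniteMeasure hD
  obtain ⟨C, hC, hCF⟩ := setIntegral_fderiv_le hd hD
  set s : ℝ := ((surfaceMeasure D).real Set.univ) ^ (1 / 2 : ℝ) with hs
  have hs0 : 0 ≤ s := by positivity
  refine ⟨C * s, by positivity, fun φ M hM hφ v u => ?_⟩
  -- Both sides are continuous in u, so the estimate need only be proved for smooth functions. The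
  -- factor s comes from Cauchy–Schwarz on the boundary.
  have hcl : IsClosed {u : H1 D | |boundaryForm D φ v u| ≤ C * s * ‖v‖ * M * ‖τ u‖} :=
    isClosed_le (boundaryForm D φ v).continuous.abs (continuous_const.mul τ.continuous.norm)
  have hsub : ((LinearMap.range (H1.ofTestₗ D ⊤)).topologicalClosure : Set (H1 D))
      ⊆ {u : H1 D | |boundaryForm D φ v u| ≤ C * s * ‖v‖ * M * ‖τ u‖} := by
    refine closure_minimal ?_ hcl
    rintro _ ⟨ψ, rfl⟩
    change |boundaryForm D φ v (H1.ofTest D ψ)| ≤ C * s * ‖v‖ * M * ‖τ (H1.ofTest D ψ)‖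
    rw [boundaryForm_ofTest]
    refine (hCF (mulTest ψ φ) (M * (‖τ (H1.ofTest D ψ)‖ * s)) (by positivity) ?_ v).trans
      (le_of_eq (by ring))
    rw [ENNReal.ofReal_mul hM]
    refine le_trans ?_ (mul_le_mul_right (lintegral_enorm_le_norm_mul (τ (H1.ofTest D ψ))) _)
    rw [← lintegral_const_mul' _ _ ENNReal.ofReal_ne_top]
    refine lintegral_mono_ae ?_
    filter_upwards [hτ.ofTest_ae_eq ψ] with x hx
    rw [hx, mulTest_apply, enorm_mul, mul_comm, ← ofReal_norm (φ x), Real.norm_eq_abs]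
    gcongr
    exact hφ x
  exact hsub (by rw [H1.closure_ofTest_eq_top hD]; trivial)

/-- The functions with zero trace are the limits of test functions. -/
theorem IsTraceOperator.ker_eq (hd : 1 ≤ d) (hD : IsBoundedLipschitzDomain D)
    {τ : H1 D →L[ℝ] L2Boundary D} (hτ : IsTraceOperator D τ) :
    τ.ker = (LinearMap.range (H1.ofTestₗ D D)).topologicalClosure := by
  refine le_antisymm (fun u hu => ?_) ?_
  · obtain ⟨C, hC, h⟩ := hτ.abs_boundaryForm_le hd hD
    refine H1.mem_closure_of_boundaryForm_eq_zero hD fun φ v => ?_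
    obtain ⟨M, hM⟩ := test_bounded φ
    have hM0 : 0 ≤ M := (norm_nonneg _).trans (hM 0)
    have h1 := h φ M hM0 hM v u
    have h2 : τ u = 0 := hu
    rw [h2, norm_zero, mul_zero] at h1
    exact abs_nonpos_iff.1 h1
  · refine Submodule.topologicalClosure_minimal _ ?_ τ.isClosed_ker
    rintro _ ⟨φ, rfl⟩
    exact hτ.ofTest_eq_zero φ

/-! ### Decay of Fourier coefficients -/

theorem isFiniteMeasure_restrict (hD : IsBoundedLipschitzDomain D) :
    IsFiniteMeasure (volume.restrict (D : Set (Rd d))) :=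
  ⟨by rw [Measure.restrict_apply_univ]; exact hD.bounded.measure_lt_top⟩

theorem abs_integral_mul_le_of_bounded [IsFiniteMeasure (volume.restrict (D : Set (Rd d)))]
    (f : L2 D) {w : Rd d → ℝ} (hw1 : ∀ x, |w x| ≤ 1) :
    |∫ x in (D : Set (Rd d)), f x * w x|
      ≤ ‖f‖ * ((volume.restrict (D : Set (Rd d))).real Set.univ) ^ (1 / 2 : ℝ) := by
  rw [← Real.norm_eq_abs, ← ENNReal.ofReal_le_ofReal_iff (by positivity), ofReal_norm]
  refine (enorm_integral_le_lintegral_enorm _).trans ?_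
  refine le_trans (lintegral_mono fun x => ?_) (lintegral_enorm_le_norm_mul f)
  rw [enorm_mul]
  refine mul_le_of_le_one_right zero_le ?_
  rw [← ofReal_norm, ← ENNReal.ofReal_one]
  exact ENNReal.ofReal_le_ofReal (hw1 x)

/-- Integration by parts leaves a gradient term and a boundary term, and both see w only through its
supremum. For oscillating w nothing is lost in the frequency. -/
theorem IsTraceOperator.abs_integral_mul_fderiv_le (hd : 1 ≤ d) (hD : IsBoundedLipschitzDomain D)
    {τ : H1 D →L[ℝ] L2Boundary D} (hτ : IsTraceOperator D τ) : ∃ C : ℝ, 0 ≤ C ∧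
      ∀ w : Rd d → ℝ, ContDiff ℝ (⊤ : ℕ∞) w → (∀ x, |w x| ≤ 1) → ∀ (v : Rd d) (u : H1 D),
      |∫ x in (D : Set (Rd d)), H1.toL2 D u x * fderiv ℝ w x v| ≤ C * ‖v‖ * ‖u‖ := by
  have hfin := isFiniteMeasure_restrict hD
  obtain ⟨C, hC, hCb⟩ := hτ.abs_boundaryForm_le hd hD
  obtain ⟨ζ, hζ⟩ := exists_test_eq_one hD
  obtain ⟨M, hM⟩ := test_bounded ζ
  have hM0 : 0 ≤ M := (norm_nonneg _).trans (hM 0)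
  set s : ℝ := ((volume.restrict (D : Set (Rd d))).real Set.univ) ^ (1 / 2 : ℝ) with hs
  have hs0 : 0 ≤ s := by positivity
  refine ⟨C * M * ‖τ‖ + s, by positivity, fun w hw hw1 v u => ?_⟩
  -- The cutoff ζ makes w compactly supported without changing it on D.
  let φ : TestRd d := TestRd.mk (fun x => ζ x * w x) (ζ.contDiff.mul hw)
    ζ.hasCompactSupport.mul_right
  have hφw : ∀ x ∈ (D : Set (Rd d)), φ x = w x := fun x hx => by
    rw [TestRd.mk_apply, hζ x (subset_closure hx), one_mul]
  have hφw' : ∀ x ∈ (D : Set (Rd d)), fderiv ℝ φ x v = fderiv ℝ w x v := fun x hx => by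
    have : φ =ᶠ[𝓝 x] w := by
      filter_upwards [D.isOpen.mem_nhds hx] with y hy
      exact hφw y hy
    rw [this.fderiv_eq]
  have h1 := hCb φ M hM0 (fun x => by
    rw [TestRd.mk_apply, abs_mul]
    calc |ζ x| * |w x| ≤ M * 1 := mul_le_mul (hM x) (hw1 x) (abs_nonneg _) hM0
      _ = M := mul_one M) v u
  rw [boundaryForm_apply, setIntegral_congr_fun D.isOpen.measurableSet
    (g := fun x => H1.toL2 D u x * fderiv ℝ w x v) fun x hx => by
      simp only [hφw' x hx], setIntegral_congr_fun D.isOpen.measurableSet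
    (f := fun x => ⟪H1.grad D u x, v⟫_ℝ * φ x)
    (g := fun x => ⟪H1.grad D u x, v⟫_ℝ * w x) fun x hx => by simp only [hφw x hx]] at h1
  have hm : MemLp (fun x => ⟪H1.grad D u x, v⟫_ℝ) 2 (volume.restrict (D : Set (Rd d))) :=
    (Lp.memLp _).inner_const v
  have h2 : |∫ x in (D : Set (Rd d)), ⟪H1.grad D u x, v⟫_ℝ * w x| ≤ ‖v‖ * ‖u‖ * s := by
    have h3 := abs_integral_mul_le_of_bounded hm.toLp hw1
    rw [integral_congr_ae (g := fun x => ⟪H1.grad D u x, v⟫_ℝ * w x) (by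
      filter_upwards [hm.coeFn_toLp] with x hx
      rw [hx])] at h3
    refine h3.trans ?_
    gcongr
    refine (Lp.norm_le_mul_norm_of_ae_le_mul (c := ‖v‖) (g := H1.grad D u) ?_).trans ?_
    · filter_upwards [hm.coeFn_toLp] with x hx
      rw [hx, mul_comm]
      exact norm_inner_le_norm _ _
    · gcongr
      exact H1.norm_grad_le u
  have h4 : ‖τ u‖ ≤ ‖τ‖ * ‖u‖ := τ.le_opNorm u
  have h5 : C * ‖v‖ * M * ‖τ u‖ ≤ C * ‖v‖ * M * (‖τ‖ * ‖u‖) := by gcongr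
  have h6 := abs_sub_abs_le_abs_sub (∫ x in (D : Set (Rd d)), H1.toL2 D u x * fderiv ℝ w x v)
    (-∫ x in (D : Set (Rd d)), ⟪H1.grad D u x, v⟫_ℝ * w x)
  rw [abs_neg, sub_neg_eq_add] at h6
  nlinarith

theorem memLp_of_bounded [IsFiniteMeasure (volume.restrict (D : Set (Rd d)))] {w : Rd d → ℝ}
    (hw : Continuous w) (hw1 : ∀ x, |w x| ≤ 1) : MemLp w 2 (volume.restrict (D : Set (Rd d))) :=
  MemLp.of_bound hw.aestronglyMeasurable 1 (ae_of_all _ hw1)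

theorem fderiv_comp_inner {f : ℝ → ℝ} {f' : ℝ} (ξ x v : Rd d)
    (hf : HasDerivAt f f' (2 * Real.pi * ⟪x, ξ⟫_ℝ)) :
    fderiv ℝ (fun x => f (2 * Real.pi * ⟪x, ξ⟫_ℝ)) x v = f' * (2 * Real.pi * ⟪v, ξ⟫_ℝ) := by
  have h1 : HasFDerivAt (fun x : Rd d => 2 * Real.pi * ⟪x, ξ⟫_ℝ)
      ((2 * Real.pi) • (innerSL ℝ ξ)) x := by
    have := ((innerSL ℝ ξ).hasFDerivAt (x := x)).const_mul (2 * Real.pi)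
    refine this.congr_of_eventuallyEq (Eventually.of_forall fun y => ?_)
    simp only [innerSL_apply_apply, real_inner_comm]
  have h2 := (hf.comp_hasFDerivAt x h1).fderiv
  change fderiv ℝ (f ∘ fun x => 2 * Real.pi * ⟪x, ξ⟫_ℝ) x v = _
  rw [h2]
  simp [real_inner_comm]

/-- Decay of the Fourier coefficients of the zero extensions of functions in `H¹(D)`. -/
theorem IsTraceOperator.abs_integral_trig_le (hd : 1 ≤ d)
    (hD : IsBoundedLipschitzDomain D) {τ : H1 D →L[ℝ] L2Boundary D} (hτ : IsTraceOperator D τ) :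
    ∃ C : ℝ, 0 ≤ C ∧ ∀ (ξ : Rd d) (u : H1 D),
      |∫ x in (D : Set (Rd d)), H1.toL2 D u x * Real.cos (2 * Real.pi * ⟪x, ξ⟫_ℝ)|
        ≤ C * (1 + ‖ξ‖ ^ 2) ^ (-(1 / 2) : ℝ) * ‖u‖ ∧
      |∫ x in (D : Set (Rd d)), H1.toL2 D u x * Real.sin (2 * Real.pi * ⟪x, ξ⟫_ℝ)|
        ≤ C * (1 + ‖ξ‖ ^ 2) ^ (-(1 / 2) : ℝ) * ‖u‖ := by
  have hfin := isFiniteMeasure_restrict hD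
  obtain ⟨C, hC, hCb⟩ := hτ.abs_integral_mul_fderiv_le hd hD
  set s : ℝ := ((volume.restrict (D : Set (Rd d))).real Set.univ) ^ (1 / 2 : ℝ) with hs
  have hs0 : 0 ≤ s := by positivity
  have hlin : ∀ ξ : Rd d, ContDiff ℝ (⊤ : ℕ∞) fun x : Rd d => 2 * Real.pi * ⟪x, ξ⟫_ℝ :=
    fun ξ => contDiff_const.mul (contDiff_id.inner ℝ contDiff_const)
  have main : ∀ (ξ : Rd d) (u : H1 D) (f g : ℝ → ℝ), ContDiff ℝ (⊤ : ℕ∞) f →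
      ContDiff ℝ (⊤ : ℕ∞) g → (∀ t, |f t| ≤ 1) → (∀ t, |g t| ≤ 1) → (∀ t, HasDerivAt g (f t) t) →
      |∫ x in (D : Set (Rd d)), H1.toL2 D u x * f (2 * Real.pi * ⟪x, ξ⟫_ℝ)|
        ≤ (C + s) * (1 + ‖ξ‖ ^ 2) ^ (-(1 / 2) : ℝ) * ‖u‖ := by
    intro ξ u f g hf hg hf1 hg1 hfg
    set I := ∫ x in (D : Set (Rd d)), H1.toL2 D u x * f (2 * Real.pi * ⟪x, ξ⟫_ℝ) with hI
    -- Differentiating the antiderivative g of f in the direction v = ξ produces the factor 2π|ξ|²,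
    -- against ‖v‖ = |ξ| on the right: one power of |ξ| is gained. The trivial bound `h3` covers
    -- small ξ.
    have h1 := hCb (fun x => g (2 * Real.pi * ⟪x, ξ⟫_ℝ)) (hg.comp (hlin ξ)) (fun x => hg1 _) ξ u
    have h2 : ∀ x, H1.toL2 D u x * fderiv ℝ (fun x => g (2 * Real.pi * ⟪x, ξ⟫_ℝ)) x ξ
        = 2 * Real.pi * ‖ξ‖ ^ 2 * (H1.toL2 D u x * f (2 * Real.pi * ⟪x, ξ⟫_ℝ)) := fun x => by
      rw [fderiv_comp_inner ξ x ξ (hfg _), real_inner_self_eq_norm_sq]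
      ring
    simp only [h2] at h1
    rw [integral_const_mul, abs_mul, abs_of_nonneg (by positivity), ← hI] at h1
    have h3 : |I| ≤ s * ‖u‖ := by
      have := abs_integral_mul_le_of_bounded (H1.toL2 D u)
        (w := fun x => f (2 * Real.pi * ⟪x, ξ⟫_ℝ)) (fun x => hf1 _)
      refine this.trans ?_
      rw [mul_comm]
      gcongr
      exact H1.norm_toL2_le u
    have h4 : ‖ξ‖ * |I| ≤ C * ‖u‖ := by
      rcases (norm_nonneg ξ).eq_or_lt with h0 | h0
      · rw [← h0, zero_mul]; positivity
      · have hpi : 1 ≤ 2 * Real.pi := by linarith [Real.pi_gt_three]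
        have h5 : ‖ξ‖ * (‖ξ‖ * |I|) ≤ ‖ξ‖ * (C * ‖u‖) := by
          have h6 : ‖ξ‖ ^ 2 * |I| ≤ 2 * Real.pi * ‖ξ‖ ^ 2 * |I| := by
            rw [mul_assoc]
            exact le_mul_of_one_le_left (by positivity) hpi
          nlinarith
        exact le_of_mul_le_mul_left h5 h0
    have h7 : (1 + ‖ξ‖ ^ 2) ^ (1 / 2 : ℝ) ≤ 1 + ‖ξ‖ := by
      rw [← Real.sqrt_eq_rpow]
      refine Real.sqrt_le_iff.2 ⟨by positivity, ?_⟩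
      nlinarith [norm_nonneg ξ]
    have h8 : (0 : ℝ) < (1 + ‖ξ‖ ^ 2) ^ (1 / 2 : ℝ) := by positivity
    rw [Real.rpow_neg (by positivity), mul_right_comm, ← div_eq_mul_inv, le_div_iff₀ h8]
    calc |I| * (1 + ‖ξ‖ ^ 2) ^ (1 / 2 : ℝ) ≤ |I| * (1 + ‖ξ‖) := by gcongr
      _ ≤ (C + s) * ‖u‖ := by linarith
  refine ⟨C + s, by positivity, fun ξ u => ⟨?_, ?_⟩⟩
  · exact main ξ u Real.cos Real.sin Real.contDiff_cos Real.contDiff_sin Real.abs_cos_le_one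
      Real.abs_sin_le_one Real.hasDerivAt_sin
  · refine main ξ u Real.sin (fun t => -Real.cos t) Real.contDiff_sin Real.contDiff_cos.neg
      Real.abs_sin_le_one (fun t => by rw [abs_neg]; exact Real.abs_cos_le_one t) fun t => ?_
    have := (Real.hasDerivAt_cos t).neg
    rw [neg_neg] at this
    exact this

end

section

variable {d : ℕ} {D : Opens (Rd d)}

/-! ### The embedding of `H¹(D)` into `H^{-r}(D)` is a Hilbert–Schmidt operator -/

theorem toHNeg_apply (r : ℝ≥0) (u : L2 D) (φ : 𝓓(D, ℝ)) :
    toHNeg r D u (TestH.of r φ) = ⟪u, testL2 D φ⟫_ℝ := by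
  rw [inner_testL2]
  rfl

theorem norm_TestH_of (r : ℝ≥0) (φ : 𝓓(D, ℝ)) :
    ‖TestH.of r φ‖ = ‖(memLp_weightedFourier (r : ℝ) φ).toLp‖ := rfl

/-- The Fourier transform of the extension of `u` by zero. -/
def fourierZeroExt (u : L2 D) (ξ : Rd d) : ℂ :=
  𝓕 (Set.indicator (D : Set (Rd d)) fun x => ((u x : ℝ) : ℂ)) ξ

theorem integrable_coe_L2 (hD : IsBoundedLipschitzDomain D) (u : L2 D) :
    Integrable u (volume.restrict (D : Set (Rd d))) := by
  have := isFiniteMeasure_restrict hD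
  exact (Lp.memLp u).integrable one_le_two

theorem integrable_indicator_coe_L2 (hD : IsBoundedLipschitzDomain D) (u : L2 D) :
    Integrable (Set.indicator (D : Set (Rd d)) fun x => ((u x : ℝ) : ℂ)) volume :=
  (integrable_indicator_iff D.isOpen.measurableSet).2 (integrable_coe_L2 hD u).ofReal

theorem continuous_fourierZeroExt (hD : IsBoundedLipschitzDomain D) (u : L2 D) :
    Continuous (fourierZeroExt u) :=
  VectorFourier.fourierIntegral_continuous Real.continuous_fourierChar
    (by exact continuous_inner) (integrable_indicator_coe_L2 hD u)

theorem fourierZeroExt_eq (hD : IsBoundedLipschitzDomain D) (u : L2 D) (ξ : Rd d) :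
    fourierZeroExt u ξ
      = ((∫ x in (D : Set (Rd d)), u x * Real.cos (2 * Real.pi * ⟪x, ξ⟫_ℝ) : ℝ) : ℂ)
        - ((∫ x in (D : Set (Rd d)), u x * Real.sin (2 * Real.pi * ⟪x, ξ⟫_ℝ) : ℝ) : ℂ)
          * Complex.I := by
  have := isFiniteMeasure_restrict hD
  rw [fourierZeroExt, Real.fourier_eq', ← integral_complex_ofReal, ← integral_complex_ofReal,
    ← integral_mul_const, ← integral_sub]
  · rw [← integral_indicator D.isOpen.measurableSet]
    refine integral_congr_ae (ae_of_all _ fun x => ?_)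
    by_cases hx : x ∈ (D : Set (Rd d))
    · simp only [Set.indicator_of_mem hx, smul_eq_mul]
      rw [Complex.exp_mul_I]
      push_cast
      rw [show (-2 * (Real.pi : ℂ) * (⟪x, ξ⟫_ℝ : ℂ)) = -(2 * Real.pi * (⟪x, ξ⟫_ℝ : ℂ)) by ring,
        Complex.cos_neg, Complex.sin_neg]
      ring
    · simp only [Set.indicator_of_notMem hx, smul_zero]
  · refine Integrable.ofReal ?_
    exact (Lp.memLp u).integrable_mul (memLp_of_bounded (by fun_prop)
      fun x => Real.abs_cos_le_one _)
  · refine (Integrable.ofReal ?_).mul_const _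
    exact (Lp.memLp u).integrable_mul (memLp_of_bounded (by fun_prop)
      fun x => Real.abs_sin_le_one _)

/-- The multiplication formula for the Fourier transform, applied to the zero extension of u and the
inverse transform of φ. No inversion theorem for u is needed. -/
theorem inner_testL2_eq_integral (hD : IsBoundedLipschitzDomain D) (u : L2 D) (φ : 𝓓(D, ℝ)) :
    ((⟪u, testL2 D φ⟫_ℝ : ℝ) : ℂ)
      = ∫ ξ, fourierZeroExt u ξ * (𝓕⁻ (testSchwartz φ)) ξ := by
  have h1 : 𝓕 (𝓕⁻ (testSchwartz φ)) = testSchwartz φ :=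
    FourierTransform.fourier_fourierInv_eq (testSchwartz φ)
  have h2 := VectorFourier.integral_fourierIntegral_smul_eq_flip (L := innerₗ (Rd d))
    (μ := volume) (ν := volume)
    Real.continuous_fourierChar (by exact continuous_inner) (integrable_indicator_coe_L2 hD u)
    ((𝓕⁻ (testSchwartz φ)).integrable (μ := volume))
  simp only [smul_eq_mul] at h2
  refine Eq.trans ?_ h2.symm
  rw [inner_testL2, ← integral_complex_ofReal, ← integral_indicator D.isOpen.measurableSet]
  refine integral_congr_ae (ae_of_all _ fun x => ?_)
  have h3 : VectorFourier.fourierIntegral Real.fourierChar volume (innerₗ (Rd d)).flip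
      (𝓕⁻ (testSchwartz φ) : 𝓢(Rd d, ℂ)) x = ((φ x : ℝ) : ℂ) := by
    rw [flip_innerₗ]
    exact DFunLike.congr_fun h1 x
  simp only [h3]
  by_cases hx : x ∈ (D : Set (Rd d))
  · simp only [Set.indicator_of_mem hx]
    push_cast
    rfl
  · simp only [Set.indicator_of_notMem hx, zero_mul]

theorem lintegral_fourierInv_testSchwartz (r : ℝ≥0) (φ : 𝓓(D, ℝ)) :
    ∫⁻ ξ, ENNReal.ofReal ((1 + ‖ξ‖ ^ 2) ^ (r : ℝ)) * ‖(𝓕⁻ (testSchwartz φ)) ξ‖ₑ ^ 2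
      = ENNReal.ofReal (‖TestH.of r φ‖ ^ 2) := by
  have h1 : ENNReal.ofReal (‖TestH.of r φ‖ ^ 2)
      = ∫⁻ ξ, ‖weightedFourier (r : ℝ) φ ξ‖ₑ ^ 2 := by
    rw [norm_TestH_of, Lp.norm_toLp, ENNReal.ofReal_pow ENNReal.toReal_nonneg,
      ENNReal.ofReal_toReal (memLp_weightedFourier (r : ℝ) φ).2.ne]
    rw [eLpNorm_eq_lintegral_rpow_enorm_toReal (by norm_num) (by norm_num)]
    rw [← ENNReal.rpow_natCast, ← ENNReal.rpow_mul]
    simp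
  -- The reflection ξ ↦ -ξ turns the transform of φ into its inverse transform; the weight is even.
  rw [h1, ← lintegral_neg_eq_self (μ := (volume : Measure (Rd d)))
    (fun ξ => ‖weightedFourier (r : ℝ) φ ξ‖ₑ ^ 2)]
  refine lintegral_congr fun ξ => ?_
  rw [weightedFourier_eq, enorm_mul, mul_pow, norm_neg]
  have h2 : (𝓕 (testSchwartz φ)) (-ξ) = (𝓕⁻ (testSchwartz φ)) ξ := by
    rw [SchwartzMap.fourier_coe, SchwartzMap.fourierInv_coe, Real.fourierInv_eq_fourier_neg]
  rw [h2]
  congr 1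
  rw [← ofReal_norm, Complex.norm_real, Real.norm_of_nonneg (by positivity),
    ← ENNReal.ofReal_pow (by positivity), ← Real.rpow_mul_natCast (by positivity)]
  norm_num

/-- Duality on the Fourier side: Cauchy–Schwarz with the weight (1+|ξ|²)^{r/2} on the test function
and its inverse on u. -/
theorem enorm_toHNeg_sq_le (hD : IsBoundedLipschitzDomain D) (r : ℝ≥0) (u : L2 D) :
    ‖toHNeg r D u‖ₑ ^ 2
      ≤ ∫⁻ ξ, ENNReal.ofReal ((1 + ‖ξ‖ ^ 2) ^ (-(r : ℝ))) * ‖fourierZeroExt u ξ‖ₑ ^ 2 := by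
  set K := ∫⁻ ξ, ENNReal.ofReal ((1 + ‖ξ‖ ^ 2) ^ (-(r : ℝ))) * ‖fourierZeroExt u ξ‖ₑ ^ 2 with hK
  rcases eq_or_ne K ⊤ with h | h
  · rw [h]; exact le_top
  have key : ∀ φ : 𝓓(D, ℝ), ‖toHNeg r D u (TestH.of r φ)‖ ≤ √(K.toReal) * ‖TestH.of r φ‖ := by
    intro φ
    have h1 : ‖toHNeg r D u (TestH.of r φ)‖ₑ
        ≤ ∫⁻ ξ, (ENNReal.ofReal ((1 + ‖ξ‖ ^ 2) ^ (-(r : ℝ) / 2)) * ‖fourierZeroExt u ξ‖ₑ)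
          * (ENNReal.ofReal ((1 + ‖ξ‖ ^ 2) ^ ((r : ℝ) / 2)) * ‖(𝓕⁻ (testSchwartz φ)) ξ‖ₑ) := by
      have h2 := inner_testL2_eq_integral hD u φ
      rw [toHNeg_apply, ← ofReal_norm, ← Complex.norm_real, h2, ofReal_norm]
      refine (enorm_integral_le_lintegral_enorm _).trans (lintegral_mono fun ξ => ?_)
      rw [enorm_mul, mul_mul_mul_comm, ← ENNReal.ofReal_mul (by positivity),
        ← Real.rpow_add (by positivity)]
      simp [neg_div]
    have hm1 : AEMeasurable (fun ξ : Rd d =>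
        ENNReal.ofReal ((1 + ‖ξ‖ ^ 2) ^ (-(r : ℝ) / 2)) * ‖fourierZeroExt u ξ‖ₑ) volume := by
      have := (continuous_fourierZeroExt hD u).measurable
      fun_prop
    have hm2 : AEMeasurable (fun ξ : Rd d =>
        ENNReal.ofReal ((1 + ‖ξ‖ ^ 2) ^ ((r : ℝ) / 2)) * ‖(𝓕⁻ (testSchwartz φ)) ξ‖ₑ) volume := by
      have := (𝓕⁻ (testSchwartz φ)).continuous.measurable
      fun_prop
    have h3 := h1.trans (ENNReal.lintegral_mul_le_Lp_mul_Lq volume Real.HolderConjugate.two_two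
      hm1 hm2)
    have e1 : ∀ (ξ : Rd d) (t : ℝ) (z : ℂ),
        (ENNReal.ofReal ((1 + ‖ξ‖ ^ 2) ^ (t / 2)) * ‖z‖ₑ) ^ (2 : ℝ)
          = ENNReal.ofReal ((1 + ‖ξ‖ ^ 2) ^ t) * ‖z‖ₑ ^ 2 := by
      intro ξ t z
      rw [ENNReal.mul_rpow_of_nonneg _ _ (by norm_num)]
      congr 1
      · rw [ENNReal.ofReal_rpow_of_nonneg (by positivity) (by norm_num),
          ← Real.rpow_mul (by positivity)]
        norm_num
      · exact ENNReal.rpow_natCast _ 2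
    simp only [e1, lintegral_fourierInv_testSchwartz] at h3
    rw [← hK] at h3
    have h4 : K ^ (1 / 2 : ℝ) * ENNReal.ofReal (‖TestH.of r φ‖ ^ 2) ^ (1 / 2 : ℝ)
        = ENNReal.ofReal (√(K.toReal) * ‖TestH.of r φ‖) := by
      rw [ENNReal.ofReal_mul (by positivity), Real.sqrt_eq_rpow,
        ← ENNReal.ofReal_rpow_of_nonneg ENNReal.toReal_nonneg (by norm_num),
        ENNReal.ofReal_toReal h, ENNReal.ofReal_rpow_of_nonneg (by positivity) (by norm_num),
        ← Real.sqrt_eq_rpow, Real.sqrt_sq (norm_nonneg _)]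
    rw [h4, ← ofReal_norm] at h3
    exact (ENNReal.ofReal_le_ofReal_iff (by positivity)).1 h3
  have h5 : ‖toHNeg r D u‖ ≤ √(K.toReal) :=
    ContinuousLinearMap.opNorm_le_bound _ (by positivity) fun φ => key ((TestH.of r).symm φ)
  rw [← ofReal_norm, ← ENNReal.ofReal_pow (norm_nonneg _), ← ENNReal.ofReal_toReal h]
  refine ENNReal.ofReal_le_ofReal ?_
  calc ‖toHNeg r D u‖ ^ 2 ≤ √(K.toReal) ^ 2 := by gcongr
    _ = K.toReal := Real.sq_sqrt ENNReal.toReal_nonneg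

theorem sum_sq_apply_le {H ι : Type*} [NormedAddCommGroup H] [InnerProductSpace ℝ H]
    [CompleteSpace H] {e : ι → H} (he : Orthonormal ℝ e) (L : StrongDual ℝ H) (F : Finset ι) :
    ∑ k ∈ F, L (e k) ^ 2 ≤ ‖L‖ ^ 2 := by
  have h := he.sum_inner_products_le (s := F) ((InnerProductSpace.toDual ℝ H).symm L)
  rw [LinearIsometryEquiv.norm_map] at h
  refine le_trans (le_of_eq (Finset.sum_congr rfl fun k _ => ?_)) h
  rw [real_inner_comm, InnerProductSpace.toDual_symm_apply, Real.norm_eq_abs, sq_abs]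

/-- Bessel's inequality is applied to the Fourier functional at each ξ before integrating in ξ. The
dimension enters only through the integrability of (1+|ξ|²)^{-(r+1)}. -/
theorem summable_sq_norm_toHNeg (hd : 1 ≤ d) (hD : IsBoundedLipschitzDomain D)
    {τ : H1 D →L[ℝ] L2Boundary D} (hτ : IsTraceOperator D τ) {r : ℝ≥0}
    (hr : (d : ℝ) / 2 - 1 < r) {H ι : Type*} [NormedAddCommGroup H] [InnerProductSpace ℝ H]
    [CompleteSpace H] {e : ι → H} (he : Orthonormal ℝ e) (S : H →L[ℝ] H1 D) :
    Summable fun k => ‖toHNeg r D (H1.toL2 D (S (e k)))‖ ^ 2 := by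
  obtain ⟨C, hC, hCb⟩ := hτ.abs_integral_trig_le hd hD
  have bessel : ∀ (w : Rd d → ℝ) (hw : Continuous w) (hw1 : ∀ x, |w x| ≤ 1) (M : ℝ), 0 ≤ M →
      (∀ u : H1 D, |∫ x in (D : Set (Rd d)), H1.toL2 D u x * w x| ≤ M * ‖u‖) → ∀ F : Finset ι,
      ∑ k ∈ F, (∫ x in (D : Set (Rd d)), H1.toL2 D (S (e k)) x * w x) ^ 2
        ≤ (M * ‖S‖) ^ 2 := by
    intro w hw hw1 M hM0 hM F
    have := isFiniteMeasure_restrict hD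
    have hmem := memLp_of_bounded (D := D) hw hw1
    have hint : ∀ u : H1 D, ∫ x in (D : Set (Rd d)), H1.toL2 D u x * w x
        = ⟪hmem.toLp, H1.toL2 D u⟫_ℝ := fun u => by
      rw [L2.inner_def]
      refine integral_congr_ae ?_
      filter_upwards [hmem.coeFn_toLp] with x hx
      rw [hx]
      rfl
    set L : StrongDual ℝ H := (innerSL ℝ hmem.toLp).comp ((H1.toL2 D).comp S) with hL
    have hLe : ∀ x, L x = ∫ y in (D : Set (Rd d)), H1.toL2 D (S x) y * w y :=
      fun x => (hint _).symm
    have hLn : ‖L‖ ≤ M * ‖S‖ := by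
      refine ContinuousLinearMap.opNorm_le_bound _ (by positivity) fun x => ?_
      rw [hLe, Real.norm_eq_abs, mul_assoc]
      refine (hM _).trans ?_
      gcongr
      exact S.le_opNorm x
    simp only [← hLe]
    exact (sum_sq_apply_le he L F).trans (by gcongr)
  -- The factor 2 counts the cosine and the sine part of the Fourier transform.
  set K : ℝ := 2 * (C * ‖S‖) ^ 2
  have hpt : ∀ (F : Finset ι) (ξ : Rd d),
      ∑ k ∈ F, ‖fourierZeroExt (H1.toL2 D (S (e k))) ξ‖ₑ ^ 2
        ≤ ENNReal.ofReal (K * (1 + ‖ξ‖ ^ 2) ^ (-1 : ℝ)) := by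
    intro F ξ
    have h1 : ∀ k, ‖fourierZeroExt (H1.toL2 D (S (e k))) ξ‖ₑ ^ 2 = ENNReal.ofReal (
        (∫ x in (D : Set (Rd d)), H1.toL2 D (S (e k)) x * Real.cos (2 * Real.pi * ⟪x, ξ⟫_ℝ)) ^ 2
        + (∫ x in (D : Set (Rd d)), H1.toL2 D (S (e k)) x
            * Real.sin (2 * Real.pi * ⟪x, ξ⟫_ℝ)) ^ 2) := by
      intro k
      rw [← ofReal_norm, ← ENNReal.ofReal_pow (norm_nonneg _), fourierZeroExt_eq hD,
        Complex.sq_norm, Complex.normSq_apply]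
      congr 1
      simp
      ring
    simp only [h1]
    rw [← ENNReal.ofReal_sum_of_nonneg fun k _ => by positivity]
    refine ENNReal.ofReal_le_ofReal ?_
    rw [Finset.sum_add_distrib]
    have hM : 0 ≤ C * (1 + ‖ξ‖ ^ 2) ^ (-(1 / 2) : ℝ) := by positivity
    have h2 := bessel (fun x => Real.cos (2 * Real.pi * ⟪x, ξ⟫_ℝ)) (by fun_prop)
      (fun x => Real.abs_cos_le_one _) _ hM (fun u => (hCb ξ u).1) F
    have h3 := bessel (fun x => Real.sin (2 * Real.pi * ⟪x, ξ⟫_ℝ)) (by fun_prop)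
      (fun x => Real.abs_sin_le_one _) _ hM (fun u => (hCb ξ u).2) F
    have h4 : ((1 + ‖ξ‖ ^ 2) ^ (-(1 / 2) : ℝ)) ^ 2 = (1 + ‖ξ‖ ^ 2) ^ (-1 : ℝ) := by
      rw [← Real.rpow_natCast, ← Real.rpow_mul (by positivity)]
      norm_num
    have h5 : (C * (1 + ‖ξ‖ ^ 2) ^ (-(1 / 2) : ℝ) * ‖S‖) ^ 2
        = (C * ‖S‖) ^ 2 * (1 + ‖ξ‖ ^ 2) ^ (-1 : ℝ) := by rw [← h4]; ring
    rw [h5] at h2 h3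
    simp only [K]
    linarith
  have hI : Integrable (fun ξ : Rd d => (1 + ‖ξ‖ ^ 2) ^ (-(2 * r + 2 : ℝ) / 2)) volume :=
    integrable_rpow_neg_one_add_norm_sq (by rw [finrank_euclideanSpace_fin]; linarith)
  have hsum : ∀ F : Finset ι, ∑ k ∈ F, ‖toHNeg r D (H1.toL2 D (S (e k)))‖ₑ ^ 2
      ≤ ENNReal.ofReal (∫ ξ : Rd d, K * (1 + ‖ξ‖ ^ 2) ^ (-(2 * r + 2 : ℝ) / 2)) := by
    intro F
    calc ∑ k ∈ F, ‖toHNeg r D (H1.toL2 D (S (e k)))‖ₑ ^ 2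
        ≤ ∑ k ∈ F, ∫⁻ ξ, ENNReal.ofReal ((1 + ‖ξ‖ ^ 2) ^ (-(r : ℝ)))
            * ‖fourierZeroExt (H1.toL2 D (S (e k))) ξ‖ₑ ^ 2 :=
          Finset.sum_le_sum fun k _ => enorm_toHNeg_sq_le hD r _
      _ = ∫⁻ ξ, ∑ k ∈ F, ENNReal.ofReal ((1 + ‖ξ‖ ^ 2) ^ (-(r : ℝ)))
            * ‖fourierZeroExt (H1.toL2 D (S (e k))) ξ‖ₑ ^ 2 := by
          rw [lintegral_finsetSum]
          intro k _
          have := (continuous_fourierZeroExt hD (H1.toL2 D (S (e k)))).measurable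
          fun_prop
      _ ≤ ∫⁻ ξ, ENNReal.ofReal (K * (1 + ‖ξ‖ ^ 2) ^ (-(2 * r + 2 : ℝ) / 2)) := by
          refine lintegral_mono fun ξ => ?_
          rw [← Finset.mul_sum]
          refine (mul_le_mul_right (hpt F ξ) _).trans ?_
          rw [← ENNReal.ofReal_mul (by positivity)]
          refine ENNReal.ofReal_le_ofReal (le_of_eq ?_)
          rw [mul_left_comm, ← Real.rpow_add (by positivity)]
          congr 2
          ring
      _ = _ := by
          rw [ofReal_integral_eq_lintegral_ofReal (hI.const_mul K)]
          exact ae_of_all _ fun ξ => by positivity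
  refine summable_of_sum_le (fun k => by positivity) (c := ∫ ξ : Rd d, K * (1 + ‖ξ‖ ^ 2) ^ (-(2 * r + 2 : ℝ) / 2))
    fun F => ?_
  have h := hsum F
  simp only [← ofReal_norm, ← ENNReal.ofReal_pow (norm_nonneg _)] at h
  rw [← ENNReal.ofReal_sum_of_nonneg fun k _ => by positivity] at h
  exact (ENNReal.ofReal_le_ofReal_iff (integral_nonneg fun ξ => by positivity)).1 h

end

section

variable {d : ℕ} {D : Opens (Rd d)}

/-! ### The deterministic boundary value problem -/

/-- The Lax–Milgram theorem on a closed subspace, with loads from another Hilbert space. -/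
theorem exists_solution_operator {H F : Type*} [NormedAddCommGroup H] [InnerProductSpace ℝ H]
    [CompleteSpace H] [NormedAddCommGroup F] [InnerProductSpace ℝ F] [CompleteSpace F]
    (K : Submodule ℝ H) (hK : IsClosed (K : Set H)) (b : H →L[ℝ] H →L[ℝ] ℝ) {m : ℝ} (hm : 0 < m)
    (hb : ∀ u, m * ‖u‖ * ‖u‖ ≤ b u u) (A : H →L[ℝ] F) :
    ∃ T : F →L[ℝ] H, ∀ f u, (u ∈ K ∧ ∀ w ∈ K, b u w = ⟪f, A w⟫_ℝ) ↔ u = T f := by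
  have : CompleteSpace K := hK.completeSpace_coe
  have hc : IsCoercive (b.bilinearComp K.subtypeL K.subtypeL) := ⟨m, hm, fun u => hb u⟩
  refine ⟨K.subtypeL.comp (hc.continuousLinearEquivOfBilin.symm.toContinuousLinearMap.comp
    (ContinuousLinearMap.adjoint (A.comp K.subtypeL))), fun f u => ?_⟩
  have key : ∀ v : K, (∀ w ∈ K, b v w = ⟪f, A w⟫_ℝ) ↔
      v = hc.continuousLinearEquivOfBilin.symm
        (ContinuousLinearMap.adjoint (A.comp K.subtypeL) f) := by
    intro v
    rw [← hc.continuousLinearEquivOfBilin.injective.eq_iff,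
      ContinuousLinearEquiv.apply_symm_apply]
    constructor
    · intro h
      refine ext_inner_right ℝ fun w => ?_
      rw [hc.continuousLinearEquivOfBilin_apply, ContinuousLinearMap.adjoint_inner_left]
      exact h w w.2
    · intro h w hw
      have := hc.continuousLinearEquivOfBilin_apply v ⟨w, hw⟩
      rw [h, ContinuousLinearMap.adjoint_inner_left] at this
      exact this.symm
  constructor
  · rintro ⟨hu, h⟩
    exact congrArg Subtype.val ((key ⟨u, hu⟩).1 h)
  · rintro rfl
    exact ⟨Subtype.coe_prop _, (key _).2 rfl⟩

/-- The bilinear form `λ ∫ u w + ∫ ∇u · ∇w + c ∫_∂D Tr u Tr w dσ` on `H¹(D)`. -/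
def bvpForm (D : Opens (Rd d)) (lam c : ℝ) : H1 D →L[ℝ] H1 D →L[ℝ] ℝ :=
  lam • (innerSL ℝ).bilinearComp (H1.toL2 D) (H1.toL2 D)
    + (innerSL ℝ).bilinearComp (H1.grad D) (H1.grad D)
    + c • (innerSL ℝ).bilinearComp (trace D) (trace D)

theorem bvpForm_apply (lam c : ℝ) (u w : H1 D) : bvpForm D lam c u w
    = lam * ⟪H1.toL2 D u, H1.toL2 D w⟫_ℝ + ⟪H1.grad D u, H1.grad D w⟫_ℝ
      + c * ⟪trace D u, trace D w⟫_ℝ := rfl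

theorem bvpForm_coercive {lam c : ℝ} (hc : 0 ≤ c) (u : H1 D) :
    min lam 1 * ‖u‖ * ‖u‖ ≤ bvpForm D lam c u u := by
  rw [bvpForm_apply, mul_assoc, ← sq, H1.norm_sq_eq, real_inner_self_eq_norm_sq,
    real_inner_self_eq_norm_sq, real_inner_self_eq_norm_sq]
  have h1 := mul_le_mul_of_nonneg_right (min_le_left lam 1) (sq_nonneg ‖H1.toL2 D u‖)
  have h2 := mul_le_mul_of_nonneg_right (min_le_right lam 1) (sq_nonneg ‖H1.grad D u‖)
  have h3 : 0 ≤ c * ‖trace D u‖ ^ 2 := by positivity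
  linarith

/-- Green's formula gives the identity for test functions, and these are dense in ker Tr. The
boundary integral vanishes there, which is why c is arbitrary. -/
theorem hasLaplacian_iff_bvpForm (hd : 1 ≤ d) (hD : IsBoundedLipschitzDomain D)
    (hτ : IsTraceOperator D (trace D)) (lam c : ℝ) (f : L2 D) (u : H1 D) :
    HasLaplacian (H1.toL2 D u) (lam • H1.toL2 D u - f)
      ↔ ∀ w ∈ (trace D).ker, bvpForm D lam c u w = ⟪f, H1.toL2 D w⟫_ℝ := by
  have h0 : ∀ φ : 𝓓(D, ℝ), H1.ofTest D φ ∈ (trace D).ker := fun φ => by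
    rw [hτ.ker_eq hd hD]
    exact Submodule.le_topologicalClosure _ (LinearMap.mem_range_self (H1.ofTestₗ D D) φ)
  have h1 : ∀ φ : 𝓓(D, ℝ), bvpForm D lam c u (H1.ofTest D φ) = ⟪f, H1.toL2 D (H1.ofTest D φ)⟫_ℝ ↔
      ⟪lam • H1.toL2 D u - f, testL2 D φ⟫_ℝ
        = ⟪H1.toL2 D u, testL2 D (testLaplacian φ)⟫_ℝ := by
    intro φ
    have h2 : trace D (H1.ofTest D φ) = 0 := h0 φ
    rw [inner_testLaplacian, bvpForm_apply, h2, inner_zero_right, mul_zero, add_zero,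
      inner_sub_left, real_inner_smul_left, H1.toL2_ofTest]
    constructor <;> intro h <;> linarith
  rw [hasLaplacian_iff]
  constructor
  · intro h w hw
    rw [hτ.ker_eq hd hD] at hw
    have hcl : IsClosed {w : H1 D | bvpForm D lam c u w = ⟪f, H1.toL2 D w⟫_ℝ} :=
      isClosed_eq (bvpForm D lam c u).continuous
        (continuous_const.inner (H1.toL2 D).continuous)
    refine closure_minimal ?_ hcl hw
    rintro _ ⟨φ, rfl⟩
    exact (h1 φ).2 (h φ)
  · intro h φ
    exact (h1 φ).1 (h _ (h0 φ))

theorem isClosed_ker_trace (D : Opens (Rd d)) : IsClosed ((trace D).ker : Set (H1 D)) :=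
  (trace D).isClosed_ker

theorem exists_add_mem_HHalf (u : H1 D) :
    ∃ y ∈ (trace D).ker, ∃ z ∈ HHalf D, u = y + z := by
  have : CompleteSpace (trace D).ker := (isClosed_ker_trace D).completeSpace_coe
  exact (trace D).ker.exists_add_mem_mem_orthogonal u

/-- Functionals in H^{-1/2}(∂D) see only (ker Tr)^⊥, but the component of u there already carries
its whole trace; pairing with it gives ‖Tr u‖². -/
theorem boundaryIncl_trace_eq_zero_iff (u : H1 D) :
    boundaryIncl D (trace D u) = 0 ↔ trace D u = 0 := by
  constructor
  · intro h
    obtain ⟨y, hy, z, hz, hu⟩ := exists_add_mem_HHalf u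
    have h1 : trace D u = trace D z := by
      rw [hu, map_add, show trace D y = 0 from hy, zero_add]
    have h2 : ⟪trace D u, trace D z⟫_ℝ = 0 := DFunLike.congr_fun h (⟨z, hz⟩ : HHalf D)
    rw [← h1] at h2
    exact inner_self_eq_zero.1 h2
  · intro h
    rw [h]
    ext z
    exact inner_zero_left (𝕜 := ℝ) (trace D (z : H1 D))

theorem conormal_add_eq_zero_iff {lam c : ℝ} {f : L2 D} {u : H1 D}
    (h : HasLaplacian (H1.toL2 D u) (lam • H1.toL2 D u - f)) :
    conormal D u + c • boundaryIncl D (trace D u) = 0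
      ↔ ∀ w ∈ HHalf D, bvpForm D lam c u w = ⟪f, H1.toL2 D w⟫_ℝ := by
  have h1 : ∀ w : HHalf D, (conormal D u + c • boundaryIncl D (trace D u)) w
      = bvpForm D lam c u w - ⟪f, H1.toL2 D w⟫_ℝ := by
    intro w
    have h2 : (conormal D u + c • boundaryIncl D (trace D u)) w
        = ⟪H1.grad D u, H1.grad D w⟫_ℝ + ⟪laplacian (H1.toL2 D u), H1.toL2 D w⟫_ℝ
          + c * ⟪trace D u, trace D w⟫_ℝ := rfl
    rw [h2, h.laplacian_eq, bvpForm_apply, inner_sub_left, real_inner_smul_left]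
    ring
  rw [ContinuousLinearMap.ext_iff]
  constructor
  · intro hz w hw
    have := hz ⟨w, hw⟩
    rw [h1] at this
    exact sub_eq_zero.1 this
  · intro hz w
    rw [h1, hz w w.2, sub_self]
    rfl

theorem solvesBVP_dirichlet_iff (hd : 1 ≤ d) (hD : IsBoundedLipschitzDomain D)
    (hτ : IsTraceOperator D (trace D)) (lam β : ℝ) (f : L2 D) (u : H1 D) :
    SolvesBVP D lam β .dirichlet f u ↔ u ∈ (trace D).ker ∧
      ∀ w ∈ (trace D).ker, bvpForm D lam 0 u w = ⟪f, H1.toL2 D w⟫_ℝ := by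
  rw [SolvesBVP, hasLaplacian_iff_bvpForm hd hD hτ lam 0, and_comm]
  exact and_congr_left fun _ => boundaryIncl_trace_eq_zero_iff u

/-- The equation is the variational identity on ker Tr, the boundary condition is the same identity
on (ker Tr)^⊥, and the two subspaces span H¹(D). -/
theorem hasLaplacian_and_conormal_iff (hd : 1 ≤ d) (hD : IsBoundedLipschitzDomain D)
    (hτ : IsTraceOperator D (trace D)) (lam c : ℝ) (f : L2 D) (u : H1 D) :
    (HasLaplacian (H1.toL2 D u) (lam • H1.toL2 D u - f) ∧
      conormal D u + c • boundaryIncl D (trace D u) = 0) ↔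
      ∀ w, bvpForm D lam c u w = ⟪f, H1.toL2 D w⟫_ℝ := by
  constructor
  · rintro ⟨h1, h2⟩ w
    have h3 := (conormal_add_eq_zero_iff h1).1 h2
    obtain ⟨y, hy, z, hz, rfl⟩ := exists_add_mem_HHalf w
    rw [map_add, map_add, inner_add_right, h3 z hz,
      (hasLaplacian_iff_bvpForm hd hD hτ lam c f u).1 h1 y hy]
  · intro h
    have h1 := (hasLaplacian_iff_bvpForm hd hD hτ lam c f u).2 fun w _ => h w
    exact ⟨h1, (conormal_add_eq_zero_iff h1).2 fun w _ => h w⟩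

theorem exists_bvp_operator (hd : 1 ≤ d) (hD : IsBoundedLipschitzDomain D)
    (hτ : IsTraceOperator D (trace D)) {lam β : ℝ} (hlam : 0 < lam) (hβ : 0 ≤ β)
    (bc : BoundaryCondition) :
    ∃ T : L2 D →L[ℝ] H1 D, ∀ f u, SolvesBVP D lam β bc f u ↔ u = T f := by
  have hm : 0 < min lam 1 := lt_min hlam one_pos
  have hnat : ∀ c : ℝ, 0 ≤ c → ∃ T : L2 D →L[ℝ] H1 D, ∀ f u,
      (HasLaplacian (H1.toL2 D u) (lam • H1.toL2 D u - f) ∧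
        conormal D u + c • boundaryIncl D (trace D u) = 0) ↔ u = T f := by
    intro c hc
    obtain ⟨T, hT⟩ := exists_solution_operator (⊤ : Submodule ℝ (H1 D)) isClosed_univ
      (bvpForm D lam c) hm (bvpForm_coercive hc) (H1.toL2 D)
    refine ⟨T, fun f u => ?_⟩
    rw [hasLaplacian_and_conormal_iff hd hD hτ, ← hT f u]
    simp
  cases bc with
  | dirichlet =>
    obtain ⟨T, hT⟩ := exists_solution_operator (trace D).ker (isClosed_ker_trace D)
      (bvpForm D lam 0) hm (bvpForm_coercive le_rfl) (H1.toL2 D)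
    exact ⟨T, fun f u => (solvesBVP_dirichlet_iff hd hD hτ lam β f u).trans (hT f u)⟩
  | neumann =>
    obtain ⟨T, hT⟩ := hnat 0 le_rfl
    refine ⟨T, fun f u => ?_⟩
    rw [← hT f u, zero_smul, add_zero]
    rfl
  | robin => exact hnat β hβ

end

section

/-! ### Series of independent random variables in a Hilbert space -/

section IndependentSeries

variable {Ω : Type*} [MeasurableSpace Ω] {μ : Measure Ω}
  {H : Type*} [NormedAddCommGroup H] [InnerProductSpace ℝ H] {ξ : ℕ → Ω → ℝ}

theorem memLp_sum_smul (h2 : ∀ k, MemLp (ξ k) 2 μ) (v : ℕ → H) (n : ℕ) :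
    MemLp (fun ω => ∑ k ∈ Finset.range n, ξ k ω • v k) 2 μ :=
  memLp_finsetSum _ fun k _ => by
    have := (ContinuousLinearMap.toSpanSingleton ℝ (v k)).comp_memLp' (h2 k)
    exact this

/-- The coefficient with index n + 1 is centered and independent of everything measurable with
respect to the first ones. This kills the cross term in Pythagoras' identity, even on events of the
filtration. -/
theorem setIntegral_mul_inner_sum_eq_zero (hm : ∀ k, StronglyMeasurable (ξ k))
    (hind : iIndepFun ξ μ) (h0 : ∀ k, ∫ ω, ξ k ω ∂μ = 0)
    (v : ℕ → H) (n : ℕ) {s : Set Ω} (hs : MeasurableSet[Filtration.natural ξ hm n] s) :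
    ∫ ω in s, ξ (n + 1) ω * ⟪∑ k ∈ Finset.range (n + 1), ξ k ω • v k, v (n + 1)⟫_ℝ ∂μ = 0 := by
  have hs' : MeasurableSet s := (Filtration.natural ξ hm).le n s hs
  set A : Ω → ℝ := s.indicator fun ω => ⟪∑ k ∈ Finset.range (n + 1), ξ k ω • v k, v (n + 1)⟫_ℝ
    with hA
  have hmeas : StronglyMeasurable[Filtration.natural ξ hm n]
      fun ω => ⟪∑ k ∈ Finset.range (n + 1), ξ k ω • v k, v (n + 1)⟫_ℝ := by
    have h1 : ∀ k ∈ Finset.range (n + 1),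
        StronglyMeasurable[Filtration.natural ξ hm n] fun ω => ξ k ω • v k := fun k hk =>
      ((Filtration.stronglyAdapted_natural hm k).mono
        ((Filtration.natural ξ hm).mono (Nat.lt_succ_iff.1 (Finset.mem_range.1 hk)))).smul_const _
    have h2 := Finset.stronglyMeasurable_fun_sum _ h1
    exact h2.inner stronglyMeasurable_const
  have hAm : Measurable[Filtration.natural ξ hm n] A := (hmeas.indicator hs).measurable
  have hI : IndepFun (ξ (n + 1)) A μ := by
    rw [IndepFun_iff_Indep]
    exact indep_of_indep_of_le_right (hind.indep_comap_natural_of_lt hm (Nat.lt_succ_self n))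
      hAm.comap_le
  rw [← integral_indicator hs']
  have h3 : (s.indicator fun ω =>
      ξ (n + 1) ω * ⟪∑ k ∈ Finset.range (n + 1), ξ k ω • v k, v (n + 1)⟫_ℝ)
      = fun ω => ξ (n + 1) ω * A ω := by
    funext ω
    by_cases hω : ω ∈ s <;> simp [hA, hω]
  rw [h3, hI.integral_fun_mul_eq_mul_integral (hm _).aestronglyMeasurable
    (hAm.mono ((Filtration.natural ξ hm).le n) le_rfl).aestronglyMeasurable, h0, zero_mul]

theorem setIntegral_sq_norm_sum_succ (hm : ∀ k, StronglyMeasurable (ξ k))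
    (hind : iIndepFun ξ μ) (h2 : ∀ k, MemLp (ξ k) 2 μ) (h0 : ∀ k, ∫ ω, ξ k ω ∂μ = 0)
    (v : ℕ → H) (n : ℕ) {s : Set Ω} (hs : MeasurableSet[Filtration.natural ξ hm n] s) :
    ∫ ω in s, ‖∑ k ∈ Finset.range (n + 2), ξ k ω • v k‖ ^ 2 ∂μ
      = ∫ ω in s, ‖∑ k ∈ Finset.range (n + 1), ξ k ω • v k‖ ^ 2 ∂μ
        + ‖v (n + 1)‖ ^ 2 * ∫ ω in s, ξ (n + 1) ω ^ 2 ∂μ := by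
  have hpt : ∀ ω, ‖∑ k ∈ Finset.range (n + 2), ξ k ω • v k‖ ^ 2
      = ‖∑ k ∈ Finset.range (n + 1), ξ k ω • v k‖ ^ 2
        + 2 * (ξ (n + 1) ω * ⟪∑ k ∈ Finset.range (n + 1), ξ k ω • v k, v (n + 1)⟫_ℝ)
        + ‖v (n + 1)‖ ^ 2 * ξ (n + 1) ω ^ 2 := by
    intro ω
    rw [Finset.sum_range_succ _ (n + 1), norm_add_sq_real, real_inner_smul_right, norm_smul,
      mul_pow, Real.norm_eq_abs, sq_abs]
    ring
  simp only [hpt]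
  have i1 : Integrable (fun ω => ‖∑ k ∈ Finset.range (n + 1), ξ k ω • v k‖ ^ 2) μ :=
    (memLp_two_iff_integrable_sq_norm (memLp_sum_smul h2 v _).1).1 (memLp_sum_smul h2 v _)
  have i2 : Integrable (fun ω =>
      2 * (ξ (n + 1) ω * ⟪∑ k ∈ Finset.range (n + 1), ξ k ω • v k, v (n + 1)⟫_ℝ)) μ :=
    ((h2 (n + 1)).integrable_mul ((memLp_sum_smul h2 v (n + 1)).inner_const (v (n + 1)))).const_mul 2
  have i3 : Integrable (fun ω => ‖v (n + 1)‖ ^ 2 * ξ (n + 1) ω ^ 2) μ :=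
    ((h2 (n + 1)).integrable_sq).const_mul _
  rw [integral_add (by exact (i1.add i2).integrableOn) i3.integrableOn,
    integral_add i1.integrableOn i2.integrableOn, integral_const_mul,
    setIntegral_mul_inner_sum_eq_zero hm hind h0 v n hs, mul_zero, add_zero, integral_const_mul]

theorem integral_sq_norm_sum (hm : ∀ k, StronglyMeasurable (ξ k))
    (hind : iIndepFun ξ μ) (h2 : ∀ k, MemLp (ξ k) 2 μ) (h0 : ∀ k, ∫ ω, ξ k ω ∂μ = 0)
    (h1 : ∀ k, ∫ ω, ξ k ω ^ 2 ∂μ = 1) (v : ℕ → H) (n : ℕ) :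
    ∫ ω, ‖∑ k ∈ Finset.range (n + 1), ξ k ω • v k‖ ^ 2 ∂μ
      = ∑ k ∈ Finset.range (n + 1), ‖v k‖ ^ 2 := by
  induction n with
  | zero =>
    simp only [zero_add, Finset.range_one, Finset.sum_singleton, norm_smul, mul_pow,
      Real.norm_eq_abs, sq_abs]
    rw [integral_mul_const, h1, one_mul]
  | succ n ih =>
    have := setIntegral_sq_norm_sum_succ hm hind h2 h0 v n (s := Set.univ) MeasurableSet.univ
    simp only [Measure.restrict_univ] at this
    rw [this, ih, h1, mul_one, Finset.sum_range_succ _ (n + 1)]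

variable [IsProbabilityMeasure μ]

/-- On each event of the filtration the increment is ‖v‖² times the integral of a square. This opens
the way to Doob's maximal inequality. -/
theorem submartingale_sq_norm_sum (hm : ∀ k, StronglyMeasurable (ξ k))
    (hind : iIndepFun ξ μ) (h2 : ∀ k, MemLp (ξ k) 2 μ) (h0 : ∀ k, ∫ ω, ξ k ω ∂μ = 0) (v : ℕ → H) :
    Submartingale (fun n ω => ‖∑ k ∈ Finset.range (n + 1), ξ k ω • v k‖ ^ 2)
      (Filtration.natural ξ hm) μ := by
  refine submartingale_of_setIntegral_le_succ (fun n => ?_) (fun n => ?_) fun n s hs => ?_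
  · have h1 : ∀ k ∈ Finset.range (n + 1),
        StronglyMeasurable[Filtration.natural ξ hm n] fun ω => ξ k ω • v k := fun k hk =>
      ((Filtration.stronglyAdapted_natural hm k).mono
        ((Filtration.natural ξ hm).mono (Nat.lt_succ_iff.1 (Finset.mem_range.1 hk)))).smul_const _
    exact (Finset.stronglyMeasurable_fun_sum _ h1).norm.pow 2
  · exact (memLp_two_iff_integrable_sq_norm (memLp_sum_smul h2 v _).1).1 (memLp_sum_smul h2 v _)
  · rw [setIntegral_sq_norm_sum_succ hm hind h2 h0 v n hs]
    exact le_add_of_nonneg_right (mul_nonneg (sq_nonneg _) (integral_nonneg fun ω => sq_nonneg _))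

/-- **Kolmogorov's maximal inequality** for an infinite series in a Hilbert space. -/
theorem measure_exists_le_sq_norm_sum_le (hm : ∀ k, StronglyMeasurable (ξ k))
    (hind : iIndepFun ξ μ) (h2 : ∀ k, MemLp (ξ k) 2 μ) (h0 : ∀ k, ∫ ω, ξ k ω ∂μ = 0)
    (h1 : ∀ k, ∫ ω, ξ k ω ^ 2 ∂μ = 1) (v : ℕ → H) (hv : Summable fun k => ‖v k‖ ^ 2)
    (ε : ℝ≥0) :
    ε * μ {ω | ∃ n, (ε : ℝ) ≤ ‖∑ k ∈ Finset.range (n + 1), ξ k ω • v k‖ ^ 2}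
      ≤ ENNReal.ofReal (∑' k, ‖v k‖ ^ 2) := by
  set f : ℕ → Ω → ℝ := fun n ω => ‖∑ k ∈ Finset.range (n + 1), ξ k ω • v k‖ ^ 2
  set A : ℕ → Set Ω := fun n =>
    {ω | (ε : ℝ) ≤ (Finset.range (n + 1)).sup' Finset.nonempty_range_add_one fun k => f k ω}
  have hsub := submartingale_sq_norm_sum hm hind h2 h0 v
  have hA : ∀ n, ε * μ (A n) ≤ ENNReal.ofReal (∑' k, ‖v k‖ ^ 2) := by
    intro n
    refine (maximal_ineq hsub (fun n ω => sq_nonneg _) n).trans (ENNReal.ofReal_le_ofReal ?_)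
    refine (setIntegral_le_integral (hsub.integrable n) (ae_of_all _ fun ω => sq_nonneg _)).trans ?_
    rw [integral_sq_norm_sum hm hind h2 h0 h1 v n]
    exact hv.sum_le_tsum _ fun k _ => sq_nonneg _
  have hmono : Monotone A := by
    intro a b hab ω hω
    refine le_trans (show (ε : ℝ) ≤ _ from hω) (Finset.sup'_mono _ ?_ _)
    exact Finset.range_mono (by omega)
  have hU : {ω | ∃ n, (ε : ℝ) ≤ ‖∑ k ∈ Finset.range (n + 1), ξ k ω • v k‖ ^ 2} ⊆ ⋃ n, A n := by
    rintro ω ⟨n, hn⟩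
    refine Set.mem_iUnion.2 ⟨n, le_trans (show (ε : ℝ) ≤ f n ω from hn) ?_⟩
    exact Finset.le_sup' (fun k => f k ω) (Finset.self_mem_range_succ n)
  refine (mul_le_mul_right (measure_mono hU) _).trans ?_
  rw [hmono.measure_iUnion, ENNReal.mul_iSup]
  exact iSup_le hA

/-- A series `∑ ξ_k v_k` with independent centered coefficients of variance one and
`∑ ‖v_k‖² < ∞` converges almost surely. -/
theorem ae_exists_tendsto_sum_smul [CompleteSpace H] (hm : ∀ k, StronglyMeasurable (ξ k))
    (hind : iIndepFun ξ μ) (h2 : ∀ k, MemLp (ξ k) 2 μ) (h0 : ∀ k, ∫ ω, ξ k ω ∂μ = 0)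
    (h1 : ∀ k, ∫ ω, ξ k ω ^ 2 ∂μ = 1) (v : ℕ → H) (hv : Summable fun k => ‖v k‖ ^ 2) :
    ∀ᵐ ω ∂μ, ∃ y, Tendsto (fun n => ∑ k ∈ Finset.range n, ξ k ω • v k) atTop (𝓝 y) := by
  -- Applied to the series started at m, the maximal inequality bounds the probability of failure by
  -- a tail of ∑ ‖v_k‖². The bad event does not depend on m, so it is null.
  have tail : ∀ ε : ℝ≥0, 0 < ε → ∀ᵐ ω ∂μ, ∃ m, ∀ n,
      ‖∑ k ∈ Finset.range (n + 1), ξ (k + m) ω • v (k + m)‖ ^ 2 < ε := by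
    intro ε hε
    have h3 : ∀ m, ε * μ {ω | ¬ ∃ m, ∀ n,
        ‖∑ k ∈ Finset.range (n + 1), ξ (k + m) ω • v (k + m)‖ ^ 2 < ε}
        ≤ ENNReal.ofReal (∑' k, ‖v (k + m)‖ ^ 2) := by
      intro m
      have h4 := measure_exists_le_sq_norm_sum_le (ξ := fun k => ξ (k + m)) (μ := μ)
        (fun k => hm _) (hind.precomp (g := fun k => k + m) (add_left_injective m))
        (fun k => h2 _) (fun k => h0 _)
        (fun k => h1 _) (fun k => v (k + m)) ((summable_nat_add_iff m).2 hv) ε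
      refine (mul_le_mul_right (measure_mono fun ω hω => ?_) _).trans h4
      by_contra hcon
      refine hω ⟨m, fun n => ?_⟩
      by_contra hn
      exact hcon ⟨n, not_lt.1 hn⟩
    have h5 : Tendsto (fun m => ENNReal.ofReal (∑' k, ‖v (k + m)‖ ^ 2)) atTop (𝓝 0) := by
      have := (ENNReal.continuous_ofReal.tendsto 0).comp
        (tendsto_sum_nat_add fun k => ‖v k‖ ^ 2)
      rwa [ENNReal.ofReal_zero] at this
    have h6 := ge_of_tendsto' h5 h3
    rw [nonpos_iff_eq_zero, mul_eq_zero] at h6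
    exact h6.resolve_left (by exact_mod_cast hε.ne')
  have htail : ∀ᵐ ω ∂μ, ∀ j : ℕ, ∃ m, ∀ n,
      ‖∑ k ∈ Finset.range (n + 1), ξ (k + m) ω • v (k + m)‖ ^ 2 < (((j : ℝ≥0) + 1)⁻¹ : ℝ≥0) :=
    ae_all_iff.2 fun j => tail _ (by positivity)
  filter_upwards [htail] with ω hω
  refine cauchySeq_tendsto_of_complete (Metric.cauchySeq_iff'.2 fun ε hε => ?_)
  -- The tail bounds concern squared norms, hence ε².
  obtain ⟨j, hj⟩ := exists_nat_one_div_lt (show (0 : ℝ) < ε ^ 2 by positivity)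
  obtain ⟨m, hmn⟩ := hω j
  refine ⟨m, fun n hn => ?_⟩
  rcases hn.eq_or_lt with rfl | hn
  · rwa [dist_self]
  obtain ⟨i, rfl⟩ : ∃ i, n = m + (i + 1) := ⟨n - m - 1, by omega⟩
  have h7 : ∑ k ∈ Finset.range (m + (i + 1)), ξ k ω • v k - ∑ k ∈ Finset.range m, ξ k ω • v k
      = ∑ k ∈ Finset.range (i + 1), ξ (k + m) ω • v (k + m) := by
    rw [Finset.sum_range_add, add_sub_cancel_left]
    exact Finset.sum_congr rfl fun k _ => by rw [add_comm]
  rw [dist_eq_norm, h7]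
  refine lt_of_pow_lt_pow_left₀ 2 hε.le ((hmn i).trans ?_)
  push_cast
  rwa [← one_div]

end IndependentSeries

end

section

/-! ### The Cameron–Martin space of a centered Gaussian measure -/

section CameronMartin

variable {B : Type*} [NormedAddCommGroup B] [NormedSpace ℝ B] [MeasurableSpace B] [BorelSpace B]

/-- A continuous linear functional on `B` as an element of the Cameron–Martin space. -/
def CameronMartin.ofDual (μ : Measure B) : StrongDual ℝ B →L[ℝ] CameronMartin μ :=
  (StrongDual.toLp (𝕜 := ℝ) μ 2).codRestrict (CameronMartin μ) fun L =>
    Submodule.le_topologicalClosure _ (LinearMap.mem_range_self _ L)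

theorem CameronMartin.denseRange_ofDual (μ : Measure B) : DenseRange (CameronMartin.ofDual μ) := by
  intro h
  rw [closure_subtype]
  have : (Subtype.val '' Set.range (CameronMartin.ofDual μ))
      = Set.range (StrongDual.toLp (𝕜 := ℝ) μ 2) := by
    rw [← Set.range_comp]
    rfl
  rw [this]
  exact h.2

instance (μ : Measure B) : CompleteSpace (CameronMartin μ) :=
  (Submodule.isClosed_topologicalClosure _).completeSpace_coe

variable {μ : Measure B}

theorem CameronMartin.inner_eq (h k : CameronMartin μ) :
    ⟪h, k⟫_ℝ = ∫ b, (h : Lp ℝ 2 μ) b * (k : Lp ℝ 2 μ) b ∂μ := by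
  rw [Submodule.coe_inner, L2.inner_def]
  exact integral_congr_ae (ae_of_all _ fun b => mul_comm _ _)

variable [SecondCountableTopology B] [CompleteSpace B] [IsGaussian μ]

theorem CameronMartin.coeFn_ofDual (L : StrongDual ℝ B) :
    ((CameronMartin.ofDual μ L : CameronMartin μ) : Lp ℝ 2 μ) =ᵐ[μ] L := by
  change (StrongDual.toLp (𝕜 := ℝ) μ 2 L : Lp ℝ 2 μ) =ᵐ[μ] L
  rw [StrongDual.toLp_apply IsGaussian.memLp_two_id]
  exact MemLp.coeFn_toLp _

theorem CameronMartin.inner_ofDual (h : CameronMartin μ) (L : StrongDual ℝ B) :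
    ⟪h, CameronMartin.ofDual μ L⟫_ℝ = ∫ b, (h : Lp ℝ 2 μ) b * L b ∂μ := by
  rw [Submodule.coe_inner, L2.inner_def]
  refine integral_congr_ae ?_
  filter_upwards [CameronMartin.coeFn_ofDual (μ := μ) L] with b hb
  rw [hb]
  exact mul_comm _ _

/-- The functional passes under the Bochner integral, whose integrand is a product of two square
integrable factors. This duality carries all later identifications of Cameron–Martin elements. -/
theorem CameronMartin.apply_incl (h : CameronMartin μ) (L : StrongDual ℝ B) :
    L (CameronMartin.incl h) = ⟪h, CameronMartin.ofDual μ L⟫_ℝ := by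
  rw [CameronMartin.inner_ofDual, CameronMartin.incl, ← L.integral_comp_comm]
  · simp only [map_smul, smul_eq_mul]
  · rw [← memLp_one_iff_integrable]
    exact (IsGaussian.memLp_two_id (μ := μ)).smul (Lp.memLp (h : Lp ℝ 2 μ))

theorem CameronMartin.eq_zero_of_incl_eq_zero {h : CameronMartin μ}
    (hh : CameronMartin.incl h = 0) : h = 0 := by
  refine (CameronMartin.denseRange_ofDual μ).eq_zero_of_inner_left ℝ ?_
  intro L
  rw [← CameronMartin.apply_incl, hh, map_zero]

/-- The exponential x ↦ exp(itx) is |t|-Lipschitz and the L¹ norm is at most the L² norm. It lets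
characteristic functions pass to L² limits. -/
theorem lipschitz_integral_exp {Ω : Type*} [MeasurableSpace Ω] {P : Measure Ω}
    [IsProbabilityMeasure P] (t : ℝ) :
    LipschitzWith (Real.nnabs t)
      fun h : Lp ℝ 2 P => ∫ ω, Complex.exp (Complex.I * ((t * h ω : ℝ) : ℂ)) ∂P := by
  refine LipschitzWith.of_dist_le_mul fun f g => ?_
  have hmeas : ∀ h : Lp ℝ 2 P,
      Integrable (fun ω => Complex.exp (Complex.I * ((t * h ω : ℝ) : ℂ))) P := fun h => by
    refine Integrable.of_bound (C := 1) ?_ (ae_of_all _ fun ω => ?_)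
    · have : Continuous fun x : ℝ => Complex.exp (Complex.I * ((t * x : ℝ) : ℂ)) := by fun_prop
      exact this.comp_aestronglyMeasurable (Lp.aestronglyMeasurable h)
    · rw [Complex.norm_exp_I_mul_ofReal]
  have hpt : ∀ a b : ℝ, ‖Complex.exp (Complex.I * ((t * a : ℝ) : ℂ))
      - Complex.exp (Complex.I * ((t * b : ℝ) : ℂ))‖ ≤ |t| * |a - b| := by
    intro a b
    have h1 : Complex.exp (Complex.I * ((t * a : ℝ) : ℂ))
        - Complex.exp (Complex.I * ((t * b : ℝ) : ℂ)) = Complex.exp (Complex.I * ((t * b : ℝ) : ℂ))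
          * (Complex.exp (Complex.I * ((t * (a - b) : ℝ) : ℂ)) - 1) := by
      rw [mul_sub, ← Complex.exp_add, mul_one]
      congr 2
      push_cast
      ring
    rw [h1, norm_mul, Complex.norm_exp_I_mul_ofReal, one_mul, ← abs_mul]
    exact Real.norm_exp_I_mul_ofReal_sub_one_le
  rw [dist_eq_norm, ← integral_sub (hmeas f) (hmeas g), Real.coe_nnabs, dist_eq_norm]
  have hint : Integrable (f - g : Lp ℝ 2 P) P := (Lp.memLp (f - g)).integrable one_le_two
  calc ‖∫ ω, (Complex.exp (Complex.I * ((t * f ω : ℝ) : ℂ))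
        - Complex.exp (Complex.I * ((t * g ω : ℝ) : ℂ))) ∂P‖
      ≤ ∫ ω, |t| * ‖(f - g : Lp ℝ 2 P) ω‖ ∂P := by
        refine norm_integral_le_of_norm_le (hint.norm.const_mul _) ?_
        filter_upwards [Lp.coeFn_sub f g] with ω hω
        rw [hω]
        exact hpt _ _
    _ = |t| * ∫ ω, ‖(f - g : Lp ℝ 2 P) ω‖ ∂P := integral_const_mul _ _
    _ ≤ |t| * ‖f - g‖ := by
        gcongr
        rw [integral_norm_eq_lintegral_enorm hint.1, ← eLpNorm_one_eq_lintegral_enorm, Lp.norm_def]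
        exact ENNReal.toReal_mono (Lp.eLpNorm_ne_top _)
          (eLpNorm_le_eLpNorm_of_exponent_le one_le_two hint.1)

/-- For continuous functionals this is the characteristic function of a centered Gaussian; both
sides are continuous in h and such functionals are dense. -/
theorem CameronMartin.integral_exp (h0 : ∀ L : StrongDual ℝ B, ∫ b, L b ∂μ = 0)
    (h : CameronMartin μ) (t : ℝ) :
    ∫ b, Complex.exp (Complex.I * ((t * (h : Lp ℝ 2 μ) b : ℝ) : ℂ)) ∂μ
      = Complex.exp (-((t ^ 2 * ‖h‖ ^ 2 / 2 : ℝ) : ℂ)) := by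
  refine (CameronMartin.denseRange_ofDual μ).induction_on
    (p := fun h : CameronMartin μ =>
      ∫ b, Complex.exp (Complex.I * ((t * (h : Lp ℝ 2 μ) b : ℝ) : ℂ)) ∂μ
        = Complex.exp (-((t ^ 2 * ‖h‖ ^ 2 / 2 : ℝ) : ℂ))) h ?_ fun L => ?_
  · refine isClosed_eq ?_ (by fun_prop)
    exact (lipschitz_integral_exp (P := μ) t).continuous.comp continuous_subtype_val
  · have h1 : ∫ b, Complex.exp (Complex.I
        * ((t * (CameronMartin.ofDual μ L : Lp ℝ 2 μ) b : ℝ) : ℂ)) ∂μ = charFun (μ.map L) t := by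
      rw [charFun_apply_real, integral_map (by fun_prop) (by fun_prop)]
      refine integral_congr_ae ?_
      filter_upwards [CameronMartin.coeFn_ofDual (μ := μ) L] with b hb
      rw [hb]
      congr 1
      push_cast
      ring
    have h2 : Var[L; μ] = ‖CameronMartin.ofDual μ L‖ ^ 2 := by
      rw [variance_eq_integral (by fun_prop), h0, ← real_inner_self_eq_norm_sq,
        CameronMartin.inner_ofDual]
      refine integral_congr_ae ?_
      filter_upwards [CameronMartin.coeFn_ofDual (μ := μ) L] with b hb
      rw [hb, sub_zero, sq]
    rw [h1, IsGaussian.map_eq_gaussianReal, charFun_gaussianReal, h0, h2]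
    congr 1
    rw [Real.coe_toNNReal _ (by positivity)]
    push_cast
    ring

theorem CameronMartin.map_eq_gaussianReal (h0 : ∀ L : StrongDual ℝ B, ∫ b, L b ∂μ = 0)
    (h : CameronMartin μ) : μ.map (h : Lp ℝ 2 μ) = gaussianReal 0 (‖h‖₊ ^ 2) := by
  have hm : AEMeasurable (h : Lp ℝ 2 μ) μ := (Lp.aestronglyMeasurable _).aemeasurable
  have := Measure.isProbabilityMeasure_map hm
  refine Measure.ext_of_charFun (funext fun t => ?_)
  rw [charFun_apply_real, integral_map hm (by fun_prop), charFun_gaussianReal]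
  have h1 := CameronMartin.integral_exp h0 h t
  rw [show (fun b => Complex.exp (t * ((h : Lp ℝ 2 μ) b : ℂ) * Complex.I))
    = fun b => Complex.exp (Complex.I * ((t * (h : Lp ℝ 2 μ) b : ℝ) : ℂ)) by
      funext b; congr 1; push_cast; ring, h1]
  congr 1
  push_cast
  ring

theorem CameronMartin.integral_eq_zero (h0 : ∀ L : StrongDual ℝ B, ∫ b, L b ∂μ = 0)
    (h : CameronMartin μ) : ∫ b, (h : Lp ℝ 2 μ) b ∂μ = 0 := by
  have hm : AEMeasurable (h : Lp ℝ 2 μ) μ := (Lp.aestronglyMeasurable _).aemeasurable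
  have h1 := integral_map hm (f := fun x : ℝ => x) (by fun_prop)
  rw [CameronMartin.map_eq_gaussianReal h0, integral_id_gaussianReal] at h1
  exact h1.symm

/-- Linear combinations stay in the Cameron–Martin space and are therefore Gaussian, so finite
families are jointly Gaussian; orthogonality means zero covariance, hence independence. -/
theorem CameronMartin.iIndepFun (h0 : ∀ L : StrongDual ℝ B, ∫ b, L b ∂μ = 0)
    {ι : Type*} {e : ι → CameronMartin μ} (he : Orthonormal ℝ e) :
    iIndepFun (fun k b => (e k : Lp ℝ 2 μ) b) μ := by
  classical
  rw [iIndepFun_iff_finset]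
  intro s
  have hm : ∀ k, AEMeasurable (e k : Lp ℝ 2 μ) μ := fun k =>
    (Lp.aestronglyMeasurable _).aemeasurable
  have hm' : AEMeasurable (fun b (i : s) => (e i : Lp ℝ 2 μ) b) μ :=
    aemeasurable_pi_lambda _ fun i => hm i
  refine HasGaussianLaw.iIndepFun_of_covariance_eq_zero ⟨?_⟩ fun i j hij => ?_
  · refine isGaussian_of_map_eq_gaussianReal fun L => ?_
    set h : CameronMartin μ := ∑ i : s, L (Pi.single i 1) • e i
    refine ⟨0, ‖h‖₊ ^ 2, ?_⟩
    rw [← CameronMartin.map_eq_gaussianReal h0 h]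
    refine (AEMeasurable.map_map_of_aemeasurable (by fun_prop) hm').trans
      (Measure.map_congr ?_)
    have h1 : (h : Lp ℝ 2 μ) = ∑ i : s, L (Pi.single i 1) • (e i : Lp ℝ 2 μ) := by
      simp [h]
    rw [h1]
    have h2 : ∀ᵐ b ∂μ, ∀ i : s, (L (Pi.single i 1) • (e i : Lp ℝ 2 μ) : Lp ℝ 2 μ) b
        = L (Pi.single i 1) * (e i : Lp ℝ 2 μ) b := by
      rw [ae_all_iff]
      intro i
      exact Lp.coeFn_smul _ _
    filter_upwards [h2, Lp.coeFn_finsetSum (p := 2) (μ := μ) Finset.univ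
      fun i : s => L (Pi.single i 1) • (e i : Lp ℝ 2 μ)] with b hb hb'
    rw [hb', Finset.sum_apply]
    simp only [hb, Function.comp_apply]
    conv_lhs => rw [← Finset.univ_sum_single (fun i : s => (e i : Lp ℝ 2 μ) b), map_sum]
    refine Finset.sum_congr rfl fun i _ => ?_
    rw [mul_comm, ← smul_eq_mul, ← map_smul, ← Pi.single_smul, smul_eq_mul, mul_one]
  · change cov[(e i : Lp ℝ 2 μ), (e j : Lp ℝ 2 μ); μ] = 0
    rw [covariance_eq_sub (Lp.memLp _) (Lp.memLp _), CameronMartin.integral_eq_zero h0, zero_mul,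
      sub_zero]
    refine Eq.trans ?_ (he.2 fun h => hij (Subtype.ext h))
    rw [CameronMartin.inner_eq]
    rfl

theorem CameronMartin.ae_exists_tendsto {H : Type*} [NormedAddCommGroup H] [InnerProductSpace ℝ H]
    [CompleteSpace H] (h0 : ∀ L : StrongDual ℝ B, ∫ b, L b ∂μ = 0)
    (e : HilbertBasis ℕ ℝ (CameronMartin μ)) (S : CameronMartin μ → H)
    (hS : Summable fun k => ‖S (e k)‖ ^ 2) :
    ∀ᵐ b ∂μ, ∃ y, Tendsto (extensionSum e S b) atTop (𝓝 y) := by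
  refine ae_exists_tendsto_sum_smul (fun k => Lp.stronglyMeasurable _)
    (CameronMartin.iIndepFun h0 e.orthonormal) (fun k => Lp.memLp _)
    (fun k => CameronMartin.integral_eq_zero h0 _) (fun k => ?_) _ hS
  have h1 := real_inner_self_eq_norm_sq (e k)
  rw [CameronMartin.inner_eq, e.orthonormal.1 k, one_pow] at h1
  simpa only [sq] using h1

end CameronMartin

end

section

/-! ### Measurable linear extensions -/

section Extension

/-- The set where the linear maps converge is a subspace of full measure and the limit is linear on
it. A purely algebraic extension to the whole space gives the proper linear version. -/
theorem exists_linearMap_ae_eq_of_tendsto {E F : Type*} [AddCommGroup E] [Module ℝ E]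
    [MeasurableSpace E] [NormedAddCommGroup F] [NormedSpace ℝ F] {μ : Measure E}
    (A : ℕ → E →ₗ[ℝ] F) (Y : E → F) (h : ∀ᵐ b ∂μ, Tendsto (fun n => A n b) atTop (𝓝 (Y b))) :
    ∃ S : E →ₗ[ℝ] F, S =ᵐ[μ] Y := by
  let V : Submodule ℝ E :=
    { carrier := {b | ∃ y, Tendsto (fun n => A n b) atTop (𝓝 y)}
      zero_mem' := ⟨0, by simp⟩
      add_mem' := by
        rintro a b ⟨y, hy⟩ ⟨z, hz⟩
        exact ⟨y + z, by simpa only [map_add] using hy.add hz⟩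
      smul_mem' := by
        rintro c a ⟨y, hy⟩
        exact ⟨c • y, by simpa only [map_smul] using hy.const_smul c⟩ }
  have hV : ∀ b : V, ∃ y, Tendsto (fun n => A n b) atTop (𝓝 y) := fun b => b.2
  choose l hl using hV
  let S₀ : V →ₗ[ℝ] F :=
    { toFun := l
      map_add' := fun a b => tendsto_nhds_unique (hl (a + b)) (by
        simpa only [Submodule.coe_add, map_add] using (hl a).add (hl b))
      map_smul' := fun c a => tendsto_nhds_unique (hl (c • a)) (by
        simpa only [Submodule.coe_smul, map_smul, RingHom.id_apply] using (hl a).const_smul c) }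
  obtain ⟨S, hS⟩ := S₀.exists_extend
  refine ⟨S, ?_⟩
  filter_upwards [h] with b hb
  have hbV : b ∈ V := ⟨_, hb⟩
  have h1 : S b = S₀ ⟨b, hbV⟩ := DFunLike.congr_fun hS ⟨b, hbV⟩
  rw [h1]
  exact tendsto_nhds_unique (hl ⟨b, hbV⟩) hb

variable {B : Type*} [NormedAddCommGroup B] [NormedSpace ℝ B] [MeasurableSpace B] [BorelSpace B]
  {μ : Measure B}
  {B₂ : Type*} [NormedAddCommGroup B₂] [NormedSpace ℝ B₂]

/-- The element `h` of the Cameron–Martin space with `⟪h, k⟫ = L (S k)`. -/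
def CameronMartin.dualComp (S : CameronMartin μ →L[ℝ] B₂) :
    StrongDual ℝ B₂ →ₗ[ℝ] CameronMartin μ where
  toFun L := (InnerProductSpace.toDual ℝ _).symm (L.comp S)
  map_add' L L' := ext_inner_right ℝ fun k => by
    simp only [inner_add_left, InnerProductSpace.toDual_symm_apply]
    rfl
  map_smul' c L := ext_inner_right ℝ fun k => by
    simp only [RingHom.id_apply, real_inner_smul_left, InnerProductSpace.toDual_symm_apply]
    rfl

theorem CameronMartin.inner_dualComp (S : CameronMartin μ →L[ℝ] B₂) (L : StrongDual ℝ B₂)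
    (k : CameronMartin μ) : ⟪CameronMartin.dualComp S L, k⟫_ℝ = L (S k) :=
  InnerProductSpace.toDual_symm_apply

theorem CameronMartin.aemeasurable_extensionSum [MeasurableSpace B₂] [BorelSpace B₂]
    [SecondCountableTopology B₂]
    (e : HilbertBasis ℕ ℝ (CameronMartin μ)) (S : CameronMartin μ → B₂) (n : ℕ) :
    AEMeasurable (fun b => extensionSum e S b n) μ := by
  refine Finset.aemeasurable_fun_sum _ fun k _ => ?_
  exact ((Lp.aestronglyMeasurable (e k : Lp ℝ 2 μ)).aemeasurable).smul_const _

/-- The Cameron–Martin space of the image of `μ` under the extension of an injective operator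
`S` is `S (H_μ)`. -/
theorem CameronMartin.exists_pullback [MeasurableSpace B₂] [BorelSpace B₂]
    [SecondCountableTopology B₂] [CompleteSpace B₂] {S : CameronMartin μ →L[ℝ] B₂}
    (hS : Function.Injective S) {Y : B → B₂}
    (hY : ∀ L, (fun b => L (Y b)) =ᵐ[μ] (CameronMartin.dualComp S L : Lp ℝ 2 μ))
    {ν : Measure B₂} [IsGaussian ν] (hν : MeasurePreserving Y μ ν) :
    ∃ V : CameronMartin ν ≃ₗᵢ[ℝ] CameronMartin μ, ∀ h, CameronMartin.incl h = S (V h) := by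
  -- An element orthogonal to the range is annihilated by every L ∘ S, hence by S; this is where
  -- injectivity enters.
  have hdense : DenseRange (CameronMartin.dualComp S) := by
    have h1 : ((LinearMap.range (CameronMartin.dualComp S)).topologicalClosure) = ⊤ := by
      rw [Submodule.topologicalClosure_eq_top_iff, Submodule.eq_bot_iff]
      intro k hk
      refine hS ((SeparatingDual.eq_iff_forall_dual_eq (R := ℝ)).2 fun L => ?_)
      rw [map_zero, map_zero, ← CameronMartin.inner_dualComp]
      exact Submodule.inner_right_of_mem_orthogonal (LinearMap.mem_range_self _ L) hk
    have h2 := Submodule.dense_iff_topologicalClosure_eq_top.2 h1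
    rwa [LinearMap.coe_range] at h2
  have hnorm : ∀ L, ‖CameronMartin.dualComp S L‖ = ‖CameronMartin.ofDual ν L‖ := by
    intro L
    rw [← sq_eq_sq₀ (norm_nonneg _) (norm_nonneg _), ← real_inner_self_eq_norm_sq,
      ← real_inner_self_eq_norm_sq, CameronMartin.inner_ofDual, CameronMartin.inner_eq]
    have h1 : ∫ b, (CameronMartin.ofDual ν L : Lp ℝ 2 ν) b * L b ∂ν = ∫ b, L b * L b ∂ν := by
      refine integral_congr_ae ?_
      filter_upwards [CameronMartin.coeFn_ofDual (μ := ν) L] with b hb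
      rw [hb]
    rw [h1, ← hν.map_eq, integral_map hν.measurable.aemeasurable
      (by fun_prop)]
    refine integral_congr_ae ?_
    filter_upwards [hY L] with b hb
    rw [hb]
  let V : CameronMartin ν ≃ₗᵢ[ℝ] CameronMartin μ :=
    (LinearEquiv.refl ℝ (StrongDual ℝ B₂)).extendOfIsometry
      (CameronMartin.ofDual ν).toLinearMap (CameronMartin.dualComp S)
      (CameronMartin.denseRange_ofDual ν) hdense hnorm
  have hV : ∀ L, V (CameronMartin.ofDual ν L) = CameronMartin.dualComp S L := fun L =>
    LinearEquiv.extendOfIsometry_eq (LinearEquiv.refl ℝ (StrongDual ℝ B₂)) _ _ _ _ hnorm L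
  refine ⟨V, fun h => (SeparatingDual.eq_iff_forall_dual_eq (R := ℝ)).2 fun L => ?_⟩
  rw [CameronMartin.apply_incl, ← V.inner_map_map, hV, real_inner_comm,
    CameronMartin.inner_dualComp]

variable [IsGaussian μ]

/-- Applying L to the partial sums gives the basis expansion of `dualComp S L`, which converges in
L²; the almost everywhere limit must agree. The right-hand side no longer mentions the basis. -/
theorem CameronMartin.apply_ae_eq_dualComp (e : HilbertBasis ℕ ℝ (CameronMartin μ))
    (S : CameronMartin μ →L[ℝ] B₂) {Y : B → B₂}
    (hY : ∀ᵐ b ∂μ, Tendsto (extensionSum e S b) atTop (𝓝 (Y b))) (L : StrongDual ℝ B₂) :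
    (fun b => L (Y b)) =ᵐ[μ] (CameronMartin.dualComp S L : Lp ℝ 2 μ) := by
  set x := CameronMartin.dualComp S L
  set u : ℕ → CameronMartin μ := fun n => ∑ k ∈ Finset.range n, e.repr x k • e k
  have h1 : Tendsto (fun n => (u n : Lp ℝ 2 μ)) atTop (𝓝 (x : Lp ℝ 2 μ)) :=
    (continuous_subtype_val.tendsto x).comp (e.hasSum_repr x).tendsto_sum_nat
  have h2 : ∀ᵐ b ∂μ, ∀ n, (u n : Lp ℝ 2 μ) b = L (extensionSum e S b n) := by
    rw [ae_all_iff]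
    intro n
    have h3 : (u n : Lp ℝ 2 μ) = ∑ k ∈ Finset.range n, L (S (e k)) • (e k : Lp ℝ 2 μ) := by
      simp only [u, e.repr_apply_apply, AddSubmonoidClass.coe_finsetSum,
        Submodule.coe_smul]
      refine Finset.sum_congr rfl fun k _ => ?_
      rw [← real_inner_comm, CameronMartin.inner_dualComp]
    have h4 : ∀ᵐ b ∂μ, ∀ k, (L (S (e k)) • (e k : Lp ℝ 2 μ) : Lp ℝ 2 μ) b
        = L (S (e k)) * (e k : Lp ℝ 2 μ) b := by
      rw [ae_all_iff]
      intro k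
      exact Lp.coeFn_smul _ _
    rw [h3]
    filter_upwards [h4, Lp.coeFn_finsetSum (p := 2) (μ := μ) (Finset.range n)
      fun k => L (S (e k)) • (e k : Lp ℝ 2 μ)] with b hb hb'
    rw [hb', Finset.sum_apply, extensionSum, map_sum]
    refine Finset.sum_congr rfl fun k _ => ?_
    rw [hb, map_smul, smul_eq_mul, mul_comm]
  have h5 : ∀ᵐ b ∂μ, Tendsto (fun n => (u n : Lp ℝ 2 μ) b) atTop (𝓝 (L (Y b))) := by
    filter_upwards [h2, hY] with b hb hb'
    simp only [hb]
    exact (L.continuous.tendsto _).comp hb'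
  exact tendstoInMeasure_ae_unique
    (tendstoInMeasure_of_tendsto_ae (fun n => Lp.aestronglyMeasurable _) h5)
    (tendstoInMeasure_of_tendsto_Lp h1)

theorem ae_eq_of_forall_dual {Ω : Type*} [MeasurableSpace Ω] [SecondCountableTopology B₂]
    {P : Measure Ω} {Y Z : Ω → B₂}
    (h : ∀ L : StrongDual ℝ B₂, ∀ᵐ ω ∂P, L (Y ω) = L (Z ω)) : Y =ᵐ[P] Z := by
  have h1 : (fun ω => Y ω - Z ω) =ᵐ[P] 0 := by
    refine ae_eq_zero_of_forall_dual ℝ fun L => ?_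
    filter_upwards [h L] with ω hω
    change L (Y ω - Z ω) = 0
    rw [map_sub, hω, sub_self]
  filter_upwards [h1] with ω hω
  exact sub_eq_zero.1 hω

variable [SecondCountableTopology B] [CompleteSpace B]

/-- An L² limit of continuous functionals is an almost everywhere limit along a subsequence. -/
theorem CameronMartin.exists_linearMap_ae_eq (h : CameronMartin μ) :
    ∃ l : B →ₗ[ℝ] ℝ, l =ᵐ[μ] (h : Lp ℝ 2 μ) := by
  obtain ⟨x, hx, hlim⟩ := mem_closure_iff_seq_limit.1 (CameronMartin.denseRange_ofDual μ h)
  choose L hL using hx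
  have h1 : Tendsto (fun n => (x n : Lp ℝ 2 μ)) atTop (𝓝 (h : Lp ℝ 2 μ)) :=
    (continuous_subtype_val.tendsto h).comp hlim
  obtain ⟨ns, _, hns⟩ := (tendstoInMeasure_of_tendsto_Lp h1).exists_seq_tendsto_ae
  refine exists_linearMap_ae_eq_of_tendsto (fun n => (L (ns n)).toLinearMap) _ ?_
  have h2 : ∀ᵐ b ∂μ, ∀ n, (x (ns n) : Lp ℝ 2 μ) b = L (ns n) b := by
    rw [ae_all_iff]
    intro n
    rw [← hL (ns n)]
    exact CameronMartin.coeFn_ofDual _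
  filter_upwards [hns, h2] with b hb hb2
  simp only [hb2] at hb
  exact hb

variable [MeasurableSpace B₂] [BorelSpace B₂]

theorem isGaussian_map_of_apply_ae_eq (h0 : ∀ L : StrongDual ℝ B, ∫ b, L b ∂μ = 0)
    {S : CameronMartin μ →L[ℝ] B₂} {Y : B → B₂} (hYm : Measurable Y)
    (hY : ∀ L, (fun b => L (Y b)) =ᵐ[μ] (CameronMartin.dualComp S L : Lp ℝ 2 μ)) :
    IsGaussian (μ.map Y) := by
  refine isGaussian_of_map_eq_gaussianReal fun L => ⟨0, ‖CameronMartin.dualComp S L‖₊ ^ 2, ?_⟩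
  rw [← CameronMartin.map_eq_gaussianReal h0, Measure.map_map (by fun_prop) hYm]
  exact Measure.map_congr (hY L)

variable [SecondCountableTopology B₂]

theorem CameronMartin.exists_isMeasurableLinearExtension
    (e₀ : HilbertBasis ℕ ℝ (CameronMartin μ)) (S : CameronMartin μ →L[ℝ] B₂)
    (hconv : ∀ e : HilbertBasis ℕ ℝ (CameronMartin μ),
      ∀ᵐ b ∂μ, ∃ y, Tendsto (extensionSum e S b) atTop (𝓝 y)) :
    ∃ Y : B → B₂, Measurable Y ∧ ∀ e, IsMeasurableLinearExtension e S Y := by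
  have hlim : ∀ e : HilbertBasis ℕ ℝ (CameronMartin μ), ∃ Y : B → B₂, Measurable Y ∧
      ∀ᵐ b ∂μ, Tendsto (extensionSum e S b) atTop (𝓝 (Y b)) := fun e =>
    measurable_limit_of_tendsto_metrizable_ae
      (fun n => CameronMartin.aemeasurable_extensionSum e S n) (hconv e)
  obtain ⟨Y, hYm, hY⟩ := hlim e₀
  refine ⟨Y, hYm, fun e => ⟨?_, ?_⟩⟩
  · choose l hl using fun k => CameronMartin.exists_linearMap_ae_eq (e₀ k)
    obtain ⟨A, hA⟩ := exists_linearMap_ae_eq_of_tendsto (μ := μ)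
      (fun n => ∑ k ∈ Finset.range n, (l k).smulRight (S (e₀ k))) Y (by
        filter_upwards [hY, ae_all_iff.2 hl] with b hb hlb
        refine hb.congr fun n => ?_
        simp [extensionSum, LinearMap.sum_apply, hlb])
    exact ⟨A, hYm.aemeasurable.congr hA.symm, hA⟩
  · obtain ⟨Z, _, hZ⟩ := hlim e
    -- Limits along two bases agree after every functional, and separability makes a countable
    -- family of functionals enough.
    have hYZ : Z =ᵐ[μ] Y := ae_eq_of_forall_dual fun L =>
      (CameronMartin.apply_ae_eq_dualComp e S hZ L).trans
        (CameronMartin.apply_ae_eq_dualComp e₀ S hY L).symm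
    filter_upwards [hZ, hYZ] with b hb hb'
    rwa [← hb']

end Extension

end

section

variable {d : ℕ} {D : Opens (Rd d)}

/-! ### `H^{-r}(D)` is a separable Hilbert space -/

section Dual

open UniformSpace (Completion)

/-- The Riesz representation of the dual of an incomplete inner product space. -/
theorem exists_dual_equiv_completion (E : Type*) [NormedAddCommGroup E] [InnerProductSpace ℝ E] :
    ∃ Φ : StrongDual ℝ E ≃ₗᵢ[ℝ] Completion E,
      ∀ (L : StrongDual ℝ E) (x : E), ⟪Φ L, (x : Completion E)⟫_ℝ = L x := by
  let R : Completion E →ₗ[ℝ] StrongDual ℝ E :=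
    { toFun := fun z => (innerSL ℝ z).comp Completion.toComplL
      map_add' := fun z w => by
        ext x
        exact inner_add_left z w (x : Completion E)
      map_smul' := fun c z => by
        ext x
        exact real_inner_smul_left z (x : Completion E) c }
  have hR : ∀ z x, R z x = ⟪z, (x : Completion E)⟫_ℝ := fun z x => rfl
  have hnorm : ∀ z, ‖R z‖ = ‖z‖ := by
    intro z
    refine le_antisymm (ContinuousLinearMap.opNorm_le_bound _ (norm_nonneg _) fun x => ?_) ?_
    · rw [hR, ← Completion.norm_coe x]
      exact norm_inner_le_norm _ _
    · have h1 : ∀ w : Completion E, ⟪z, w⟫_ℝ ≤ ‖R z‖ * ‖w‖ := by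
        intro w
        induction w using Completion.induction_on with
        | hp => exact isClosed_le (by fun_prop) (by fun_prop)
        | ih x =>
          rw [Completion.norm_coe, ← hR]
          exact (le_abs_self _).trans ((R z).le_opNorm x)
      rcases eq_or_ne z 0 with rfl | hz
      · simp
      · have h2 := h1 z
        rw [real_inner_self_eq_norm_sq, sq] at h2
        exact le_of_mul_le_mul_right h2 (norm_pos_iff.2 hz)
  have hsurj : Function.Surjective R := by
    intro L
    have hi : IsUniformInducing (Completion.toComplL : E →L[ℝ] Completion E) :=
      Completion.isUniformInducing_coe E
    refine ⟨(InnerProductSpace.toDual ℝ _).symm (L.extend Completion.toComplL), ?_⟩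
    ext x
    rw [hR, InnerProductSpace.toDual_symm_apply]
    exact ContinuousLinearMap.extend_eq L Completion.denseRange_coe hi x
  let Ψ : Completion E ≃ₗᵢ[ℝ] StrongDual ℝ E :=
    LinearIsometryEquiv.ofSurjective ⟨R, hnorm⟩ hsurj
  refine ⟨Ψ.symm, fun L x => ?_⟩
  have h3 : R (Ψ.symm L) = L := Ψ.apply_symm_apply L
  rw [← hR, h3]

/-- The bidual is the completion of the space. Hence evaluations at test functions are dense among
the functionals on H^{-r}(D). -/
theorem denseRange_inclusionInDoubleDual (E : Type*) [NormedAddCommGroup E]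
    [InnerProductSpace ℝ E] : DenseRange (NormedSpace.inclusionInDoubleDual ℝ E) := by
  obtain ⟨Φ, hΦ⟩ := exists_dual_equiv_completion E
  let Q : Completion E → StrongDual ℝ (StrongDual ℝ E) := fun z =>
    (innerSL ℝ z).comp Φ.toContinuousLinearEquiv.toContinuousLinearMap
  have hQ : Continuous Q :=
    ((ContinuousLinearMap.compL ℝ (StrongDual ℝ E) (Completion E) ℝ).flip
      Φ.toContinuousLinearEquiv.toContinuousLinearMap).continuous.comp (innerSL ℝ).continuous
  have hsurj : Function.Surjective Q := by
    intro M
    refine ⟨(InnerProductSpace.toDual ℝ _).symm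
      (M.comp Φ.symm.toContinuousLinearEquiv.toContinuousLinearMap), ?_⟩
    ext L
    change ⟪_, Φ L⟫_ℝ = _
    rw [InnerProductSpace.toDual_symm_apply]
    change M (Φ.symm (Φ L)) = M L
    rw [Φ.symm_apply_apply]
  have h1 := hsurj.denseRange.comp (Completion.denseRange_coe (α := E)) hQ
  have h2 : (Q ∘ fun x : E => (x : Completion E)) = NormedSpace.inclusionInDoubleDual ℝ E := by
    funext x
    ext L
    change ⟪(x : Completion E), Φ L⟫_ℝ = L x
    rw [real_inner_comm, hΦ]
  rwa [h2] at h1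

end Dual

theorem TestH.isometry_toLp (r : ℝ≥0) (D : Opens (Rd d)) : Isometry (TestH.toLp r D) :=
  AddMonoidHomClass.isometry_of_norm _ fun _ => rfl

instance (r : ℝ≥0) (D : Opens (Rd d)) : SecondCountableTopology (TestH r D) := by
  have : Fact ((2 : ℝ≥0∞) ≠ ⊤) := ⟨ENNReal.ofNat_ne_top⟩
  exact (TestH.isometry_toLp r D).isEmbedding.secondCountableTopology

instance (r : ℝ≥0) (D : Opens (Rd d)) : InnerProductSpace ℝ (TestH r D) :=
  InnerProductSpace.ofNorm ℝ fun x y => by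
    have h : ∀ z : TestH r D, ‖z‖ = ‖TestH.toLp r D z‖ := fun _ => rfl
    simp only [h, map_add, map_sub, ← sq]
    exact parallelogram_law_with_norm ℂ (TestH.toLp r D x) (TestH.toLp r D y)

theorem HNeg.exists_equiv_completion (r : ℝ≥0) (D : Opens (Rd d)) :
    Nonempty (HNeg r D ≃ₗᵢ[ℝ] UniformSpace.Completion (TestH r D)) := by
  obtain ⟨Φ, _⟩ := exists_dual_equiv_completion (TestH r D)
  exact ⟨Φ⟩

instance (r : ℝ≥0) (D : Opens (Rd d)) : SecondCountableTopology (HNeg r D) := by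
  obtain ⟨Φ⟩ := HNeg.exists_equiv_completion r D
  have : SecondCountableTopology (UniformSpace.Completion (TestH r D)) :=
    UniformSpace.secondCountable_of_separable _
  exact Φ.toHomeomorph.isEmbedding.secondCountableTopology

/-- The evaluation at a test function. -/
def evalTest (r : ℝ≥0) (D : Opens (Rd d)) : 𝓓(D, ℝ) →ₗ[ℝ] StrongDual ℝ (HNeg r D) :=
  (NormedSpace.inclusionInDoubleDual ℝ (TestH r D)).toLinearMap ∘ₗ (TestH.of r).toLinearMap

theorem evalTest_apply {r : ℝ≥0} (φ : 𝓓(D, ℝ)) (b : HNeg r D) :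
    evalTest r D φ b = b (TestH.of r φ) := rfl

theorem denseRange_evalTest (r : ℝ≥0) (D : Opens (Rd d)) : DenseRange (evalTest r D) := by
  have h := denseRange_inclusionInDoubleDual (TestH r D)
  have h1 : Set.range (evalTest r D) = Set.range (NormedSpace.inclusionInDoubleDual ℝ (TestH r D)) :=
    (TestH.of r).surjective.range_comp (NormedSpace.inclusionInDoubleDual ℝ (TestH r D))
  rw [DenseRange, h1]
  exact h

theorem CameronMartin.ae_exists_tendsto_HNeg {B : Type*} [NormedAddCommGroup B] [NormedSpace ℝ B]
    [MeasurableSpace B] [BorelSpace B] [SecondCountableTopology B] [CompleteSpace B]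
    {μ : Measure B} [IsGaussian μ] {r : ℝ≥0} (h0 : ∀ L : StrongDual ℝ B, ∫ b, L b ∂μ = 0)
    (e : HilbertBasis ℕ ℝ (CameronMartin μ)) (S : CameronMartin μ → HNeg r D)
    (hS : Summable fun k => ‖S (e k)‖ ^ 2) :
    ∀ᵐ b ∂μ, ∃ y, Tendsto (extensionSum e S b) atTop (𝓝 y) := by
  obtain ⟨Φ⟩ := HNeg.exists_equiv_completion r D
  have h1 := CameronMartin.ae_exists_tendsto h0 e (fun h => Φ (S h))
    (by simpa only [Φ.norm_map] using hS)
  filter_upwards [h1] with b ⟨y, hy⟩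
  refine ⟨Φ.symm y, ((Φ.symm.continuous.tendsto y).comp hy).congr fun n => ?_⟩
  simp [extensionSum]

end

section

variable {d : ℕ} {D : Opens (Rd d)}

/-! ### The Cameron–Martin space of the white noise -/

section Laws

variable {Ω : Type*} [MeasurableSpace Ω] {P : Measure Ω}
  {B : Type*} [NormedAddCommGroup B] [NormedSpace ℝ B] [MeasurableSpace B]

theorem IsCenteredGaussian.isGaussian_map {X : Ω → B} (hX : IsCenteredGaussian X P) :
    IsGaussian (P.map X) := hX.gaussian.isGaussian_map

theorem IsCenteredGaussian.aemeasurable {X : Ω → B} (hX : IsCenteredGaussian X P) :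
    AEMeasurable X P := hX.gaussian.aemeasurable

variable [BorelSpace B]

theorem IsCenteredGaussian.integral_map_eq_zero {X : Ω → B} (hX : IsCenteredGaussian X P)
    (L : StrongDual ℝ B) : ∫ b, L b ∂(P.map X) = 0 := by
  rw [integral_map hX.aemeasurable (by fun_prop)]
  exact hX.mean_zero L

theorem IsCenteredGaussian.inner_ofDual [SecondCountableTopology B] [CompleteSpace B] {X : Ω → B}
    (hX : IsCenteredGaussian X P) (L L' : StrongDual ℝ B) :
    ⟪CameronMartin.ofDual (P.map X) L, CameronMartin.ofDual (P.map X) L'⟫_ℝ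
      = ∫ ω, L (X ω) * L' (X ω) ∂P := by
  have := hX.isGaussian_map
  rw [CameronMartin.inner_ofDual, ← integral_map (f := fun b => L b * L' b) hX.aemeasurable
    (by fun_prop)]
  refine integral_congr_ae ?_
  filter_upwards [CameronMartin.coeFn_ofDual (μ := P.map X) L] with b hb
  rw [hb]

end Laws

theorem HNeg.ext_test {r : ℝ≥0} {u v : HNeg r D}
    (h : ∀ φ : 𝓓(D, ℝ), u (TestH.of r φ) = v (TestH.of r φ)) : u = v := by
  ext φ
  exact h ((TestH.of r).symm φ)

/-- The covariance says that evaluation at φ ↦ φ preserves norms; both sides have dense range, so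
the correspondence extends to an isometry of the completions. -/
theorem IsWhiteNoise.exists_equiv {Ω : Type*} [MeasurableSpace Ω] {P : Measure Ω} {s : ℝ≥0}
    {W : Ω → HNeg s D} (hW : IsWhiteNoise W P) :
    ∃ I : CameronMartin (P.map W) ≃ₗᵢ[ℝ] L2 D,
      (∀ φ, I (CameronMartin.ofDual _ (evalTest s D φ)) = testL2 D φ) ∧
      ∀ h, toHNeg s D (I h) = CameronMartin.incl h := by
  have := hW.gaussian.isGaussian_map
  have hnorm : ∀ φ : 𝓓(D, ℝ), ‖testL2ₗ D φ‖
      = ‖CameronMartin.ofDual (P.map W) (evalTest s D φ)‖ := by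
    intro φ
    rw [← sq_eq_sq₀ (norm_nonneg _) (norm_nonneg _), ← real_inner_self_eq_norm_sq,
      ← real_inner_self_eq_norm_sq, hW.gaussian.inner_ofDual]
    refine Eq.trans ?_ (hW.covariance φ φ).symm
    change ⟪testL2 D φ, testL2 D φ⟫_ℝ = _
    rw [inner_testL2]
    refine integral_congr_ae ?_
    filter_upwards [coeFn_testL2 (D := D) φ] with x hx
    rw [hx]
  have hdense : DenseRange ((CameronMartin.ofDual (P.map W)).toLinearMap ∘ₗ evalTest s D) :=
    (CameronMartin.denseRange_ofDual (P.map W)).comp (denseRange_evalTest s D)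
      (CameronMartin.ofDual (P.map W)).continuous
  let I : CameronMartin (P.map W) ≃ₗᵢ[ℝ] L2 D :=
    (LinearEquiv.refl ℝ 𝓓(D, ℝ)).extendOfIsometry
      ((CameronMartin.ofDual (P.map W)).toLinearMap ∘ₗ evalTest s D) (testL2ₗ D)
      hdense (denseRange_testL2 D) hnorm
  have hI : ∀ φ, I (CameronMartin.ofDual _ (evalTest s D φ)) = testL2 D φ := fun φ =>
    LinearEquiv.extendOfIsometry_eq (LinearEquiv.refl ℝ 𝓓(D, ℝ)) _ _ hdense
      (denseRange_testL2 D) hnorm φ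
  refine ⟨I, hI, fun h => HNeg.ext_test fun φ => ?_⟩
  rw [toHNeg_apply, ← evalTest_apply φ (CameronMartin.incl h), CameronMartin.apply_incl, ← hI,
    I.inner_map_map]

/-! ### Orthonormal bases -/

/-- Distinct basis vectors are √2 apart, so balls of radius 1/2 around them are disjoint and
separability makes the basis countable. -/
theorem exists_hilbertBasis_nat {H : Type*} [NormedAddCommGroup H] [InnerProductSpace ℝ H]
    [CompleteSpace H] [SecondCountableTopology H] (hH : ¬ FiniteDimensional ℝ H) :
    Nonempty (HilbertBasis ℕ ℝ H) := by
  obtain ⟨w, b, hb⟩ := exists_hilbertBasis ℝ H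
  have hcount : Countable w := by
    have hd : Pairwise fun i j : w => (1 : ℝ) ≤ dist (b i) (b j) := by
      intro i j hij
      have h1 : dist (b i) (b j) ^ 2 = 2 := by
        rw [dist_eq_norm, norm_sub_sq_real, b.orthonormal.1 i, b.orthonormal.1 j,
          b.orthonormal.2 hij]
        norm_num
      nlinarith [dist_nonneg (x := b i) (y := b j)]
    have hdisj : Pairwise fun i j : w =>
        Disjoint (Metric.ball (b i) (1 / 2)) (Metric.ball (b j) (1 / 2)) := fun i j hij =>
      Metric.ball_disjoint_ball (by have := hd hij; linarith)
    exact hdisj.countable_of_isOpen_disjoint (fun i => Metric.isOpen_ball)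
      fun i => ⟨b i, Metric.mem_ball_self (by norm_num)⟩
  have hinf : Infinite w := by
    by_contra hfin
    have : Finite w := not_infinite_iff_finite.1 hfin
    have : Fintype w := Fintype.ofFinite w
    exact hH (Module.Basis.finiteDimensional_of_finite b.toOrthonormalBasis.toBasis)
  obtain ⟨σ⟩ : Nonempty (ℕ ≃ w) := nonempty_equiv_of_countable
  refine ⟨HilbertBasis.mk (b.orthonormal.comp σ σ.injective) ?_⟩
  have h1 : Set.range (b ∘ σ) = Set.range b := σ.surjective.range_comp b
  rw [h1, b.dense_span]

theorem not_finiteDimensional_of_hilbertBasis {H : Type*} [NormedAddCommGroup H]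
    [InnerProductSpace ℝ H] (b : HilbertBasis ℕ ℝ H) : ¬ FiniteDimensional ℝ H := fun _ =>
  not_finite_iff_infinite.2 inferInstance b.orthonormal.linearIndependent.finite

/-- Infinite dimension comes from the given basis g, since H^{1/2}(∂D), stored inside H¹(D), embeds
into L²(D). -/
theorem exists_hilbertBasis_L2 (g : HilbertBasis ℕ ℝ (HHalf D)) :
    Nonempty (HilbertBasis ℕ ℝ (L2 D)) := by
  have : Fact ((2 : ℝ≥0∞) ≠ ⊤) := ⟨ENNReal.ofNat_ne_top⟩
  refine exists_hilbertBasis_nat fun hfin => not_finiteDimensional_of_hilbertBasis g ?_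
  exact FiniteDimensional.of_injective ((H1.toL2 D).toLinearMap ∘ₗ (HHalf D).subtype)
    ((H1.toL2_injective D).comp Subtype.val_injective)

/-! ### Measurable values with vanishing sum -/

/-- The characteristic function of the n-th partial sum at 1 is exp(-½ ∑ c_k²), and it tends to 1 by
dominated convergence. -/
theorem CameronMartin.coeff_eq_zero_of_tendsto {B : Type*} [NormedAddCommGroup B]
    [NormedSpace ℝ B] [MeasurableSpace B] [BorelSpace B] [SecondCountableTopology B]
    [CompleteSpace B] {μ : Measure B} [IsGaussian μ]
    (h0 : ∀ L : StrongDual ℝ B, ∫ b, L b ∂μ = 0) (e : HilbertBasis ℕ ℝ (CameronMartin μ))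
    (c : ℕ → ℝ) (h : ∀ᵐ b ∂μ, Tendsto (fun n => ∑ k ∈ Finset.range n, (e k : Lp ℝ 2 μ) b * c k)
      atTop (𝓝 0)) (k : ℕ) : c k = 0 := by
  set u : ℕ → CameronMartin μ := fun n => ∑ k ∈ Finset.range n, c k • e k with hu
  have hu2 : ∀ n, ‖u n‖ ^ 2 = ∑ k ∈ Finset.range n, c k ^ 2 := by
    intro n
    rw [← real_inner_self_eq_norm_sq, hu, e.orthonormal.inner_sum]
    exact Finset.sum_congr rfl fun k _ => by simp [sq]
  have hcoe : ∀ᵐ b ∂μ, ∀ n, (u n : Lp ℝ 2 μ) b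
      = ∑ k ∈ Finset.range n, (e k : Lp ℝ 2 μ) b * c k := by
    rw [ae_all_iff]
    intro n
    have h4 : ∀ᵐ b ∂μ, ∀ k, (c k • (e k : Lp ℝ 2 μ) : Lp ℝ 2 μ) b
        = c k * (e k : Lp ℝ 2 μ) b := ae_all_iff.2 fun k => Lp.coeFn_smul _ _
    have h3 : (u n : Lp ℝ 2 μ) = ∑ k ∈ Finset.range n, c k • (e k : Lp ℝ 2 μ) := by
      simp [hu]
    rw [h3]
    filter_upwards [h4, Lp.coeFn_finsetSum (p := 2) (μ := μ) (Finset.range n)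
      fun k => c k • (e k : Lp ℝ 2 μ)] with b hb hb'
    rw [hb', Finset.sum_apply]
    exact Finset.sum_congr rfl fun k _ => by rw [hb, mul_comm]
  have hlim : Tendsto (fun n => ∫ b, Complex.exp (Complex.I * ((1 * (u n : Lp ℝ 2 μ) b : ℝ) : ℂ)) ∂μ)
      atTop (𝓝 (∫ _, (1 : ℂ) ∂μ)) := by
    refine tendsto_integral_of_dominated_convergence (fun _ => 1) (fun n => ?_)
      (integrable_const _) (fun n => ae_of_all _ fun b => ?_) ?_
    · have : Continuous fun x : ℝ => Complex.exp (Complex.I * ((1 * x : ℝ) : ℂ)) := by fun_prop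
      exact this.comp_aestronglyMeasurable (Lp.aestronglyMeasurable _)
    · rw [Complex.norm_exp_I_mul_ofReal]
    · filter_upwards [h, hcoe] with b hb hb'
      simp only [hb']
      have : Continuous fun x : ℝ => Complex.exp (Complex.I * ((1 * x : ℝ) : ℂ)) := by fun_prop
      have h5 := (this.tendsto 0).comp hb
      simpa [Function.comp_def] using h5
  have hexp : ∀ n, ∫ b, Complex.exp (Complex.I * ((1 * (u n : Lp ℝ 2 μ) b : ℝ) : ℂ)) ∂μ
      = ((Real.exp (-((∑ k ∈ Finset.range n, c k ^ 2) / 2)) : ℝ) : ℂ) := by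
    intro n
    rw [CameronMartin.integral_exp h0, hu2]
    push_cast
    simp
  simp only [hexp] at hlim
  rw [integral_const, probReal_univ, one_smul] at hlim
  have hlim' : Tendsto (fun n => Real.exp (-((∑ k ∈ Finset.range n, c k ^ 2) / 2))) atTop (𝓝 1) := by
    exact_mod_cast (Complex.continuous_re.tendsto _).comp hlim
  have hanti : ∀ n ≥ k + 1, Real.exp (-((∑ k ∈ Finset.range n, c k ^ 2) / 2))
      ≤ Real.exp (-(c k ^ 2 / 2)) := by
    intro n hn
    refine Real.exp_le_exp.2 ?_
    have := Finset.single_le_sum (f := fun k => c k ^ 2) (s := Finset.range n)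
      (fun i _ => sq_nonneg _) (Finset.mem_range.2 hn)
    linarith
  have h6 : 1 ≤ Real.exp (-(c k ^ 2 / 2)) :=
    le_of_tendsto hlim' (eventually_atTop.2 ⟨k + 1, hanti⟩)
  have h7 := Real.one_le_exp_iff.1 h6
  have h8 : c k ^ 2 = 0 := le_antisymm (by linarith) (sq_nonneg _)
  exact pow_eq_zero_iff two_ne_zero |>.1 h8

/-! ### The scale space -/

theorem scaleMap_apply (g : HilbertBasis ℕ ℝ (HHalf D)) (u : HNegHalf D) (j : ℕ) :
    (scaleMap g u : ℕ → ℝ) j = ((j : ℝ) + 1)⁻¹ * u (g j) := rfl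

theorem HNegHalf.eq_zero_of_basis (g : HilbertBasis ℕ ℝ (HHalf D)) {u : HNegHalf D}
    (h : ∀ j, u (g j) = 0) : u = 0 := by
  have hs : (Submodule.span ℝ (Set.range g)).topologicalClosure ≤ u.ker := by
    refine Submodule.topologicalClosure_minimal _ (Submodule.span_le.2 ?_) u.isClosed_ker
    rintro _ ⟨j, rfl⟩
    exact h j
  rw [g.dense_span] at hs
  ext w
  exact hs (Submodule.mem_top (x := w))

/-- After interchanging the sums, Bessel bounds the sum over k by ‖a‖² for each g_j, and the weights
j^{-2} are summable. H^{-1/2}(∂D) is enlarged to H_sc(∂D) for this reason. -/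
theorem summable_sq_norm_scaleIncl (g : HilbertBasis ℕ ℝ (HHalf D)) {H ι : Type*}
    [NormedAddCommGroup H] [InnerProductSpace ℝ H] [CompleteSpace H] {e : ι → H}
    (he : Orthonormal ℝ e) (a : HHalf D →L[ℝ] StrongDual ℝ H)
    (A : H → HNegHalf D) (hA : ∀ h w, A h w = a w h) :
    Summable fun k => ‖scaleIncl g (A (e k))‖ ^ 2 := by
  have hs : Summable fun j : ℕ => ((j : ℝ) + 1)⁻¹ ^ 2 * ‖a‖ ^ 2 := by
    have := (summable_nat_add_iff 1).2 (Real.summable_one_div_nat_pow.2 (one_lt_two))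
    refine Summable.mul_right _ ?_
    simpa using this
  have hnorm : ∀ u : HNegHalf D, HasSum (fun j : ℕ => ((j : ℝ) + 1)⁻¹ ^ 2 * u (g j) ^ 2)
      (‖scaleIncl g u‖ ^ 2) := by
    intro u
    have h1 := lp.hasSum_norm (p := 2) (by norm_num) (scaleMap g u)
    have h2 : ‖scaleIncl g u‖ = ‖scaleMap g u‖ := rfl
    rw [h2]
    simpa [scaleMap_apply, mul_pow, abs_mul] using h1
  refine summable_of_sum_le (fun k => by positivity)
    (c := ∑' j : ℕ, ((j : ℝ) + 1)⁻¹ ^ 2 * ‖a‖ ^ 2) fun F => ?_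
  have h1 : HasSum (fun j : ℕ => ∑ k ∈ F, ((j : ℝ) + 1)⁻¹ ^ 2 * A (e k) (g j) ^ 2)
      (∑ k ∈ F, ‖scaleIncl g (A (e k))‖ ^ 2) := hasSum_sum fun k _ => hnorm (A (e k))
  refine hasSum_le (fun j => ?_) h1 hs.hasSum
  rw [← Finset.mul_sum]
  refine mul_le_mul_of_nonneg_left ?_ (by positivity)
  simp only [hA]
  have h2 := sum_sq_apply_le he (a (g j)) F
  refine h2.trans ?_
  have h3 : ‖a (g j)‖ ≤ ‖a‖ := by
    have := a.le_opNorm (g j)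
    rwa [g.orthonormal.1 j, mul_one] at this
  gcongr

end

section

variable {d : ℕ} {D : Opens (Rd d)}

/-! ### The stochastic boundary value problem: existence -/

theorem toHNeg_injective (r : ℝ≥0) (D : Opens (Rd d)) : Function.Injective (toHNeg r D) := by
  intro u v h
  refine L2_ext_test fun φ => ?_
  rw [← toHNeg_apply r, ← toHNeg_apply r, h]

theorem testL2_neg_testLaplacian_add (lam : ℝ) (φ : 𝓓(D, ℝ)) :
    testL2 D (-testLaplacian φ + lam • φ)
      = -testL2 D (testLaplacian φ) + lam • testL2 D φ := by
  change testL2ₗ D (-testLaplacian φ + lam • φ) = _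
  rw [map_add, map_neg, map_smul]
  rfl

theorem HasLaplacian.inner_eq {lam : ℝ} {f u : L2 D} (h : HasLaplacian u (lam • u - f))
    (φ : 𝓓(D, ℝ)) : ⟪u, testL2 D (-testLaplacian φ + lam • φ)⟫_ℝ = ⟪f, testL2 D φ⟫_ℝ := by
  have h1 := (hasLaplacian_iff _ _).1 h φ
  rw [inner_sub_left, real_inner_smul_left] at h1
  rw [testL2_neg_testLaplacian_add, inner_add_right, inner_neg_right, real_inner_smul_right]
  linarith

theorem scaleIncl_smul (g : HilbertBasis ℕ ℝ (HHalf D)) (c : ℝ) (u : HNegHalf D) :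
    scaleIncl g (c • u) = c • scaleIncl g u :=
  Subtype.ext (map_smul (scaleMap g) c u)

theorem scaleIncl_zero (g : HilbertBasis ℕ ℝ (HHalf D)) : scaleIncl g 0 = 0 :=
  Subtype.ext (map_zero (scaleMap g))

instance (g : HilbertBasis ℕ ℝ (HHalf D)) : CompleteSpace (Hsc g) :=
  (Submodule.isClosed_topologicalClosure _).completeSpace_coe

section Existence

variable {lam β : ℝ} {bc : BoundaryCondition} {T : L2 D →L[ℝ] H1 D}

theorem injective_of_solvesBVP (hT : ∀ f, SolvesBVP D lam β bc f (T f)) :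
    Function.Injective T := by
  rw [injective_iff_map_eq_zero]
  intro f hf
  refine L2_ext_test fun φ => ?_
  have h1 := (hT f).1.inner_eq φ
  rw [hf, map_zero, inner_zero_left] at h1
  rw [← h1, inner_zero_left]

variable {Ω : Type*} [MeasurableSpace Ω] {P : Measure Ω}

theorem isMeasurableValue_zero {B B₂ : Type*} [NormedAddCommGroup B] [NormedSpace ℝ B]
    [MeasurableSpace B] [OpensMeasurableSpace B] [NormedAddCommGroup B₂] [NormedSpace ℝ B₂]
    (X : Ω → B) (e : HilbertBasis ℕ ℝ (CameronMartin (P.map X)))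
    {S : CameronMartin (P.map X) → B₂} (hS : ∀ h, S h = 0) :
    IsMeasurableValue X P e S fun _ => 0 := by
  refine ae_of_all _ fun ω => ?_
  have h : extensionSum e S (X ω) = fun _ => 0 := by
    funext n
    simp [extensionSum, hS]
  rw [h]
  exact tendsto_const_nhds

/-- For Dirichlet and Neumann every term of the series is zero. For Robin both series must converge
separately: the trace series by the Hilbert–Schmidt bound, the other as its multiple by -β. -/
theorem measurableBoundaryCondition_of_boundaryOp_eq_zero {r : ℝ≥0}
    (g : HilbertBasis ℕ ℝ (HHalf D)) {X : Ω → HNeg r D} (hX : IsCenteredGaussian X P)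
    (J : CameronMartin (P.map X) →L[ℝ] H1 D) (e : HilbertBasis ℕ ℝ (CameronMartin (P.map X)))
    (hJ : ∀ h, boundaryOp D β bc (J h) = 0) : MeasurableBoundaryCondition g β X P J e bc := by
  have := hX.isGaussian_map
  cases bc with
  | dirichlet =>
    refine ⟨fun _ => 0, isMeasurableValue_zero X e fun h => ?_, ae_of_all _ fun _ => rfl⟩
    rw [show boundaryIncl D (trace D (J h)) = 0 from hJ h, scaleIncl_zero]
  | neumann =>
    refine ⟨fun _ => 0, isMeasurableValue_zero X e fun h => ?_, ae_of_all _ fun _ => rfl⟩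
    rw [show conormal D (J h) = 0 from hJ h, scaleIncl_zero]
  | robin =>
    have hsum := summable_sq_norm_scaleIncl g e.orthonormal
      ((innerSL ℝ).bilinearComp ((trace D).comp (HHalf D).subtypeL) ((trace D).comp J))
      (fun h => boundaryIncl D (trace D (J h))) fun h w => by
        change ⟪trace D (J h), trace D (w : H1 D)⟫_ℝ = ⟪trace D (w : H1 D), trace D (J h)⟫_ℝ
        rw [real_inner_comm]
    have hconv := ae_of_ae_map hX.aemeasurable
      (CameronMartin.ae_exists_tendsto hX.integral_map_eq_zero e
        (fun h => scaleIncl g (boundaryIncl D (trace D (J h)))) hsum)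
    set Z : Ω → Hsc g := fun ω => limUnder atTop
      (extensionSum e (fun h => scaleIncl g (boundaryIncl D (trace D (J h)))) (X ω))
    have hZ : IsMeasurableValue X P e
        (fun h => scaleIncl g (boundaryIncl D (trace D (J h)))) Z := by
      filter_upwards [hconv] with ω hω
      exact tendsto_nhds_limUnder hω
    refine ⟨fun ω => (-β) • Z ω, Z, ?_, hZ, ae_of_all _ fun ω => by simp⟩
    filter_upwards [hZ] with ω hω
    refine (hω.const_smul (-β)).congr fun n => ?_
    rw [extensionSum, extensionSum, Finset.smul_sum]
    refine Finset.sum_congr rfl fun k _ => ?_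
    have h1 : conormal D (J (e k)) = (-β) • boundaryIncl D (trace D (J (e k))) := by
      have h2 : conormal D (J (e k)) + β • boundaryIncl D (trace D (J (e k))) = 0 := hJ (e k)
      ext w
      have h3 : conormal D (J (e k)) w + β * boundaryIncl D (trace D (J (e k))) w = 0 :=
        DFunLike.congr_fun h2 w
      change conormal D (J (e k)) w = (-β) * boundaryIncl D (trace D (J (e k))) w
      linarith
    rw [h1, scaleIncl_smul, smul_comm]

theorem ae_forall_test_of_forall_ae {r s : ℝ≥0} {X : Ω → HNeg r D} {W : Ω → HNeg s D}
    (A : 𝓓(D, ℝ) → 𝓓(D, ℝ))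
    (h : ∀ φ, ∀ᵐ ω ∂P, X ω (TestH.of r (A φ)) = W ω (TestH.of s φ)) :
    ∀ᵐ ω ∂P, ∀ φ, X ω (TestH.of r (A φ)) = W ω (TestH.of s φ) := by
  -- A countable dense subset of the graph of A, rather than of the test functions, gives a common
  -- null set without continuity of A.
  let q : 𝓓(D, ℝ) → TestH r D × TestH s D := fun φ => (TestH.of r (A φ), TestH.of s φ)
  have : Nonempty (Set.range q) := ⟨⟨q 0, Set.mem_range_self 0⟩⟩
  have h1 : ∀ᵐ ω ∂P, ∀ n, X ω (denseSeq (Set.range q) n).1.1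
      = W ω (denseSeq (Set.range q) n).1.2 := by
    rw [ae_all_iff]
    intro n
    obtain ⟨φ, hφ⟩ := (denseSeq (Set.range q) n).2
    rw [← hφ]
    exact h φ
  filter_upwards [h1] with ω hω φ
  have hcl : IsClosed {p : Set.range q | X ω p.1.1 = W ω p.1.2} :=
    isClosed_eq (by fun_prop) (by fun_prop)
  exact closure_minimal (by rintro _ ⟨n, rfl⟩; exact hω n) hcl
    (denseRange_denseSeq (Set.range q) ⟨q φ, Set.mem_range_self φ⟩)

theorem isSolution_extension {r s : ℝ≥0} (g : HilbertBasis ℕ ℝ (HHalf D))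
    (hT : ∀ f, SolvesBVP D lam β bc f (T f)) {W : Ω → HNeg s D} (hW : IsWhiteNoise W P)
    {I : CameronMartin (P.map W) ≃ₗᵢ[ℝ] L2 D}
    (hI : ∀ φ, I (CameronMartin.ofDual _ (evalTest s D φ)) = testL2 D φ)
    {That : HNeg s D → HNeg r D} (hm : Measurable That)
    (hThat : ∀ L, (fun b => L (That b)) =ᵐ[P.map W] (CameronMartin.dualComp
      (toHNeg r D ∘L H1.toL2 D ∘L T ∘L I.toContinuousLinearEquiv.toContinuousLinearMap) L :
        Lp ℝ 2 (P.map W))) :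
    IsSolution g lam β bc W P fun ω => That (W ω) := by
  set S := toHNeg r D ∘L H1.toL2 D ∘L T ∘L I.toContinuousLinearEquiv.toContinuousLinearMap
    with hS
  have hSapp : ∀ h, S h = toHNeg r D (H1.toL2 D (T (I h))) := fun h => rfl
  have := hW.gaussian.isGaussian_map
  have hWm := hW.gaussian.aemeasurable
  have h0 := hW.gaussian.integral_map_eq_zero
  have hmap : P.map (fun ω => That (W ω)) = (P.map W).map That :=
    (AEMeasurable.map_map_of_aemeasurable hm.aemeasurable hWm).symm
  have hXg : IsCenteredGaussian (fun ω => That (W ω)) P := by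
    refine ⟨⟨?_⟩, fun L => ?_⟩
    · rw [hmap]
      exact isGaussian_map_of_apply_ae_eq h0 hm hThat
    · rw [← integral_map (f := fun b => L (That b)) hWm
        (L.continuous.measurable.comp hm).aestronglyMeasurable, integral_congr_ae (hThat L)]
      exact CameronMartin.integral_eq_zero h0 _
  refine ⟨hXg, ?_, ?_⟩
  · refine ae_forall_test_of_forall_ae (fun φ => -testLaplacian φ + lam • φ) fun φ => ?_
    -- Green's formula in dual form: testing T f with -Δφ + λφ is testing f with φ.
    have h1 : CameronMartin.dualComp S (evalTest r D (-testLaplacian φ + lam • φ))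
        = CameronMartin.ofDual _ (evalTest s D φ) := by
      refine ext_inner_right ℝ fun h => ?_
      rw [CameronMartin.inner_dualComp, hSapp, evalTest_apply, toHNeg_apply,
        (hT (I h)).1.inner_eq, ← hI, I.inner_map_map, real_inner_comm]
    have h2 := hThat (evalTest r D (-testLaplacian φ + lam • φ))
    rw [h1] at h2
    exact ae_of_ae_map hWm (h2.trans (CameronMartin.coeFn_ofDual _))
  · have hinj : Function.Injective S :=
      (toHNeg_injective r D).comp ((H1.toL2_injective D).comp
        ((injective_of_solvesBVP hT).comp I.injective))
    have := hXg.isGaussian_map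
    obtain ⟨V, hV⟩ := CameronMartin.exists_pullback hinj hThat
      (ν := P.map fun ω => That (W ω)) ⟨hm, hmap.symm⟩
    obtain ⟨b⟩ := exists_hilbertBasis_L2 g
    let VI : CameronMartin (P.map fun ω => That (W ω)) ≃ₗᵢ[ℝ] L2 D := V.trans I
    refine ⟨T.comp VI.toContinuousLinearEquiv.toContinuousLinearMap, fun h => (hV h).symm,
      fun h => ⟨_, (hT (VI h)).1⟩, HilbertBasis.ofRepr (VI.trans b.repr),
      measurableBoundaryCondition_of_boundaryOp_eq_zero g hXg _ _ fun h => (hT (VI h)).2⟩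

end Existence

end

section

variable {d : ℕ} {D : Opens (Rd d)}

/-! ### The stochastic boundary value problem: uniqueness -/

section Uniqueness

variable {Ω : Type*} [MeasurableSpace Ω] {P : Measure Ω} {r : ℝ≥0}

theorem continuous_coord_Hsc (g : HilbertBasis ℕ ℝ (HHalf D)) (j : ℕ) :
    Continuous fun z : Hsc g => ((z : lp (fun _ : ℕ => ℝ) 2) : ℕ → ℝ) j :=
  (continuous_apply j).comp
    ((lp.uniformContinuous_coe (p := 2)).continuous.comp continuous_subtype_val)

theorem eq_zero_of_tendsto_extensionSum_zero (g : HilbertBasis ℕ ℝ (HHalf D)) {X : Ω → HNeg r D}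
    (hX : IsCenteredGaussian X P) (e : HilbertBasis ℕ ℝ (CameronMartin (P.map X)))
    (A : CameronMartin (P.map X) → HNegHalf D)
    (hA : ∀ᵐ ω ∂P, Tendsto (extensionSum e (fun h => scaleIncl g (A h)) (X ω)) atTop (𝓝 0))
    (k : ℕ) : A (e k) = 0 := by
  have := hX.isGaussian_map
  refine HNegHalf.eq_zero_of_basis g fun j => ?_
  -- Convergence is known on Ω; a measurable convergence set is needed to transfer it to the law of
  -- X.
  have hmeas : MeasurableSet {b : HNeg r D | Tendsto (fun n => ∑ k ∈ Finset.range n,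
      (e k : Lp ℝ 2 (P.map X)) b * (((j : ℝ) + 1)⁻¹ * A (e k) (g j))) atTop (𝓝 0)} := by
    refine measurableSet_tendsto _ fun n => ?_
    refine Finset.measurable_fun_sum _ fun k _ => ?_
    exact (Lp.stronglyMeasurable (e k : Lp ℝ 2 (P.map X))).measurable.mul_const _
  have h1 : ∀ᵐ b ∂(P.map X), Tendsto (fun n => ∑ k ∈ Finset.range n,
      (e k : Lp ℝ 2 (P.map X)) b * (((j : ℝ) + 1)⁻¹ * A (e k) (g j))) atTop (𝓝 0) := by
    rw [ae_map_iff hX.aemeasurable hmeas]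
    filter_upwards [hA] with ω hω
    have h2 := ((continuous_coord_Hsc g j).tendsto 0).comp hω
    refine h2.congr fun n => ?_
    rw [Function.comp_apply, extensionSum]
    simp only [AddSubmonoidClass.coe_finsetSum, Submodule.coe_smul, lp.coeFn_smul]
    exact Finset.sum_apply j _ _
  have h2 := CameronMartin.coeff_eq_zero_of_tendsto hX.integral_map_eq_zero e _ h1 k
  exact (mul_eq_zero.1 h2).resolve_left (by positivity)

theorem MeasurableBoundaryCondition.boundaryOp_eq_zero {g : HilbertBasis ℕ ℝ (HHalf D)} {β : ℝ}
    {bc : BoundaryCondition} {X : Ω → HNeg r D} (hX : IsCenteredGaussian X P)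
    {J : CameronMartin (P.map X) →L[ℝ] H1 D} {e : HilbertBasis ℕ ℝ (CameronMartin (P.map X))}
    (h : MeasurableBoundaryCondition g β X P J e bc) (k : ℕ) :
    boundaryOp D β bc (J (e k)) = 0 := by
  cases bc with
  | dirichlet =>
    obtain ⟨Z, hZ, hZ0⟩ := h
    refine eq_zero_of_tendsto_extensionSum_zero g hX e
      (fun h => boundaryIncl D (trace D (J h))) ?_ k
    filter_upwards [hZ, hZ0] with ω hω hω0
    rwa [hω0] at hω
  | neumann =>
    obtain ⟨Z, hZ, hZ0⟩ := h
    refine eq_zero_of_tendsto_extensionSum_zero g hX e (fun h => conormal D (J h)) ?_ k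
    filter_upwards [hZ, hZ0] with ω hω hω0
    rwa [hω0] at hω
  | robin =>
    obtain ⟨N, Z, hN, hZ, h0⟩ := h
    refine eq_zero_of_tendsto_extensionSum_zero g hX e
      (fun h => conormal D (J h) + β • boundaryIncl D (trace D (J h))) ?_ k
    filter_upwards [hN, hZ, h0] with ω hωN hωZ hω0
    have h1 := hωN.add (hωZ.const_smul β)
    rw [hω0] at h1
    refine h1.congr fun n => ?_
    rw [extensionSum, extensionSum, extensionSum, Finset.smul_sum, ← Finset.sum_add_distrib]
    refine Finset.sum_congr rfl fun k _ => ?_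
    have h2 : scaleIncl g (conormal D (J (e k)) + β • boundaryIncl D (trace D (J (e k))))
        = scaleIncl g (conormal D (J (e k)))
          + β • scaleIncl g (boundaryIncl D (trace D (J (e k)))) := by
      rw [← scaleIncl_smul]
      exact Subtype.ext (map_add (scaleMap g) _ _)
    rw [h2, smul_add, smul_comm β]

/-- The operator `φ ↦ -Δφ + λφ` on test functions. -/
def helmholtzTest (D : Opens (Rd d)) (lam : ℝ) : 𝓓(D, ℝ) →ₗ[ℝ] 𝓓(D, ℝ) where
  toFun φ := -testLaplacian φ + lam • φ
  map_add' φ ψ := by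
    simp only [testLaplacian, LineDeriv.lineDerivOp_add, Finset.sum_add_distrib, smul_add, neg_add]
    abel
  map_smul' c φ := by
    simp only [testLaplacian, LineDeriv.lineDerivOp_smul, ← Finset.smul_sum, smul_add, smul_neg,
      RingHom.id_apply, smul_comm c lam]

/-- Composition with X or W is an L² isometry, so an identity between random variables passes from
test functions to all of L²(D). -/
theorem apply_ae_eq_of_forall_test {s : ℝ≥0} {X : Ω → HNeg r D} (hX : IsCenteredGaussian X P)
    {W : Ω → HNeg s D} (hW : IsCenteredGaussian W P)
    (M : L2 D →L[ℝ] CameronMartin (P.map X)) (N : L2 D →L[ℝ] CameronMartin (P.map W))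
    (h : ∀ φ : 𝓓(D, ℝ), ∀ᵐ ω ∂P, (M (testL2 D φ) : Lp ℝ 2 (P.map X)) (X ω)
      = (N (testL2 D φ) : Lp ℝ 2 (P.map W)) (W ω)) (f : L2 D) :
    ∀ᵐ ω ∂P, (M f : Lp ℝ 2 (P.map X)) (X ω) = (N f : Lp ℝ 2 (P.map W)) (W ω) := by
  have hXm : MeasurePreserving (hX.aemeasurable.mk X) P (P.map X) :=
    ⟨hX.aemeasurable.measurable_mk, (Measure.map_congr hX.aemeasurable.ae_eq_mk).symm⟩
  have hWm : MeasurePreserving (hW.aemeasurable.mk W) P (P.map W) :=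
    ⟨hW.aemeasurable.measurable_mk, (Measure.map_congr hW.aemeasurable.ae_eq_mk).symm⟩
  have hcX : ∀ k : Lp ℝ 2 (P.map X), Lp.compMeasurePreservingₗᵢ ℝ _ hXm k
      =ᵐ[P] fun ω => k (X ω) := by
    intro k
    filter_upwards [Lp.coeFn_compMeasurePreserving k hXm, hX.aemeasurable.ae_eq_mk] with ω h1 h2
    exact h1.trans (by rw [Function.comp_apply, ← h2])
  have hcW : ∀ k : Lp ℝ 2 (P.map W), Lp.compMeasurePreservingₗᵢ ℝ _ hWm k
      =ᵐ[P] fun ω => k (W ω) := by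
    intro k
    filter_upwards [Lp.coeFn_compMeasurePreserving k hWm, hW.aemeasurable.ae_eq_mk] with ω h1 h2
    exact h1.trans (by rw [Function.comp_apply, ← h2])
  have heq : (fun f => Lp.compMeasurePreservingₗᵢ ℝ _ hXm (M f : Lp ℝ 2 (P.map X)))
      = fun f => Lp.compMeasurePreservingₗᵢ ℝ _ hWm (N f : Lp ℝ 2 (P.map W)) := by
    refine (denseRange_testL2 D).equalizer ?_ ?_ ?_
    · exact (LinearIsometry.continuous _).comp (continuous_subtype_val.comp M.continuous)
    · exact (LinearIsometry.continuous _).comp (continuous_subtype_val.comp N.continuous)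
    · funext φ
      refine Lp.ext ?_
      exact (hcX _).trans (EventuallyEq.trans (h φ) (hcW _).symm)
  have h1 := hcX (M f : Lp ℝ 2 (P.map X))
  rw [congrFun heq f] at h1
  exact h1.symm.trans (hcW _)

theorem IsSolution.ae_eq_extension {s : ℝ≥0} {lam β : ℝ} {bc : BoundaryCondition}
    {T : L2 D →L[ℝ] H1 D} {g : HilbertBasis ℕ ℝ (HHalf D)}
    (hT : ∀ f u, SolvesBVP D lam β bc f u ↔ u = T f) {W : Ω → HNeg s D} (hW : IsWhiteNoise W P)
    {I : CameronMartin (P.map W) ≃ₗᵢ[ℝ] L2 D}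
    (hI : ∀ φ, I (CameronMartin.ofDual _ (evalTest s D φ)) = testL2 D φ)
    {That : HNeg s D → HNeg r D}
    (hThat : ∀ L, (fun b => L (That b)) =ᵐ[P.map W] (CameronMartin.dualComp
      (toHNeg r D ∘L H1.toL2 D ∘L T ∘L I.toContinuousLinearEquiv.toContinuousLinearMap) L :
        Lp ℝ 2 (P.map W)))
    {X : Ω → HNeg r D} (hX : IsSolution g lam β bc W P X) : ∀ᵐ ω ∂P, X ω = That (W ω) := by
  have hXG := hX.gaussian
  have := hXG.isGaussian_map
  have := hW.gaussian.isGaussian_map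
  have hWm := hW.gaussian.aemeasurable
  obtain ⟨J, hJ, _, e, hbc⟩ := hX.boundary
  let M₀ : 𝓓(D, ℝ) →ₗ[ℝ] CameronMartin (P.map X) :=
    (CameronMartin.ofDual (P.map X)).toLinearMap ∘ₗ evalTest r D ∘ₗ helmholtzTest D lam
  have hM₀ : ∀ φ, M₀ φ = CameronMartin.ofDual (P.map X)
      (evalTest r D (-testLaplacian φ + lam • φ)) := fun φ => rfl
  -- The equation turns the covariance of X at -Δφ + λφ into that of the white noise at φ.
  have hinner : ∀ φ ψ, ⟪M₀ φ, M₀ ψ⟫_ℝ = ⟪testL2 D φ, testL2 D ψ⟫_ℝ := by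
    intro φ ψ
    rw [hM₀, hM₀, hXG.inner_ofDual, ← hI, ← hI, I.inner_map_map, hW.gaussian.inner_ofDual]
    refine integral_congr_ae ?_
    filter_upwards [hX.equation] with ω hω
    simp only [evalTest_apply, hω]
  have hbd : ∀ φ, ‖M₀ φ‖ ≤ 1 * ‖testL2ₗ D φ‖ := by
    intro φ
    rw [one_mul]
    refine le_of_eq ((sq_eq_sq₀ (norm_nonneg _) (norm_nonneg _)).1 ?_)
    rw [← real_inner_self_eq_norm_sq, ← real_inner_self_eq_norm_sq]
    exact hinner φ φ
  let M : L2 D →L[ℝ] CameronMartin (P.map X) := M₀.extendOfNorm (testL2ₗ D)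
  have hM : ∀ φ, M (testL2 D φ) = M₀ φ := fun φ =>
    LinearMap.extendOfNorm_eq (denseRange_testL2 D) ⟨1, hbd⟩ φ
  let A : CameronMartin (P.map X) →L[ℝ] L2 D := ContinuousLinearMap.adjoint M
  have hA : ∀ h f, ⟪A h, f⟫_ℝ = ⟪h, M f⟫_ℝ := fun h f => ContinuousLinearMap.adjoint_inner_left M f h
  have hAM : ∀ f, A (M f) = f := by
    have h1 : (fun f => A (M f)) = fun f => f := by
      refine (denseRange_testL2 D).equalizer (by fun_prop) continuous_id (funext fun φ => ?_)
      refine L2_ext_test fun ψ => ?_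
      change ⟪A (M (testL2 D φ)), testL2 D ψ⟫_ℝ = ⟪testL2 D φ, testL2 D ψ⟫_ℝ
      rw [hA, hM, hM, hinner]
    exact congrFun h1
  have hLap : ∀ h, HasLaplacian (H1.toL2 D (J h)) (lam • H1.toL2 D (J h) - A h) := by
    intro h
    refine (hasLaplacian_iff _ _).2 fun φ => ?_
    have h1 : ⟪A h, testL2 D φ⟫_ℝ
        = ⟪H1.toL2 D (J h), testL2 D (-testLaplacian φ + lam • φ)⟫_ℝ := by
      rw [hA, hM, hM₀, ← CameronMartin.apply_incl, ← hJ, evalTest_apply, toHNeg_apply]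
    rw [testL2_neg_testLaplacian_add, inner_add_right, inner_neg_right,
      real_inner_smul_right] at h1
    rw [inner_sub_left, real_inner_smul_left, h1]
    ring
  have hJT : J = T.comp A := by
    refine ContinuousLinearMap.ext_on
      (Submodule.dense_iff_topologicalClosure_eq_top.2 e.dense_span) ?_
    rintro _ ⟨k, rfl⟩
    exact (hT _ _).1 ⟨hLap (e k), hbc.boundaryOp_eq_zero hXG k⟩
  -- The difference h - M(Ah) lies in the kernel of A, hence of J = T A, and the Cameron–Martin
  -- embedding is injective.
  have hMA : ∀ h, M (A h) = h := by
    intro h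
    have h1 : A (h - M (A h)) = 0 := by rw [map_sub, hAM, sub_self]
    have h2 : CameronMartin.incl (h - M (A h)) = 0 := by
      rw [← hJ, hJT, ContinuousLinearMap.comp_apply, h1, map_zero, map_zero, map_zero]
    exact (sub_eq_zero.1 (CameronMartin.eq_zero_of_incl_eq_zero h2)).symm
  have hJM : ∀ f, J (M f) = T f := fun f => by
    rw [hJT, ContinuousLinearMap.comp_apply, hAM]
  have hXW := apply_ae_eq_of_forall_test hXG hW.gaussian M
    I.symm.toContinuousLinearEquiv.toContinuousLinearMap fun φ => by
      have h1 : I.symm.toContinuousLinearEquiv.toContinuousLinearMap (testL2 D φ)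
          = CameronMartin.ofDual _ (evalTest s D φ) := by
        rw [← hI]
        exact I.symm_apply_apply _
      rw [hM, hM₀, h1]
      filter_upwards [ae_of_ae_map hXG.aemeasurable (CameronMartin.coeFn_ofDual
        (μ := P.map X) (evalTest r D (-testLaplacian φ + lam • φ))), ae_of_ae_map hWm
        (CameronMartin.coeFn_ofDual (μ := P.map W) (evalTest s D φ)), hX.equation] with ω h2 h3 h4
      rw [h2, h3, evalTest_apply, evalTest_apply, h4]
  refine ae_eq_of_forall_dual fun L => ?_
  -- Since J M = T, both sides represent the functional h ↦ L(J(M(I h))).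
  have hL : CameronMartin.dualComp
      (toHNeg r D ∘L H1.toL2 D ∘L T ∘L I.toContinuousLinearEquiv.toContinuousLinearMap) L
      = I.symm (A (CameronMartin.ofDual _ L)) := by
    refine ext_inner_right ℝ fun h => ?_
    rw [CameronMartin.inner_dualComp, ← I.inner_map_map, I.apply_symm_apply, hA, real_inner_comm,
      ← CameronMartin.apply_incl, ← hJ, hJM]
    rfl
  have h1 := hThat L
  rw [hL] at h1
  filter_upwards [hXW (A (CameronMartin.ofDual _ L)), ae_of_ae_map hWm h1,
    ae_of_ae_map hXG.aemeasurable (CameronMartin.coeFn_ofDual (μ := P.map X) L)] with ω h2 h3 h4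
  rw [hMA, h4] at h2
  rw [h2, h3]
  rfl

end Uniqueness

end

end WhiteNoiseBVP

end

/-! ### The main theorem -/

theorem mainTheorem2 {d : ℕ} (hd : 2 ≤ d) (D : Opens (Rd d)) (hD : IsBoundedLipschitzDomain D)
    (lam β : ℝ) (hlam : 0 < lam) (hβ : 0 < β) (bc : BoundaryCondition)
    (r s : ℝ≥0) (hr : (d : ℝ) / 2 - 1 < r) (hs : (d : ℝ) / 2 < s)
    (g : HilbertBasis ℕ ℝ (HHalf D))
    {Ω : Type*} [MeasurableSpace Ω] (P : Measure Ω) [IsProbabilityMeasure P]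
    (W : Ω → HNeg s D) (hW : IsWhiteNoise W P) :
    ∃ (T : L2 D →L[ℝ] H1 D) (I : CameronMartin (P.map W) ≃ₗᵢ[ℝ] L2 D)
      (That : HNeg s D → HNeg r D),
      -- `T f` is the unique solution `u ∈ H¹(D)` of the deterministic problem with load `f`
      (∀ (f : L2 D) (u : H1 D), SolvesBVP D lam β bc f u ↔ u = T f) ∧
      -- the Cameron–Martin space of the white noise is `L²(D)`
      (∀ h, toHNeg s D (I h) = CameronMartin.incl h) ∧
      -- `That` is the measurable linear extension of `T`
      (∀ e : HilbertBasis ℕ ℝ (CameronMartin (P.map W)),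
        IsMeasurableLinearExtension e
          (toHNeg r D ∘L H1.toL2 D ∘L T ∘L I.toContinuousLinearEquiv.toContinuousLinearMap)
          That) ∧
      -- the solution of the stochastic problem is `That W`
      IsSolution g lam β bc W P (fun ω => That (W ω)) ∧
      ∀ X : Ω → HNeg r D, IsSolution g lam β bc W P X → ∀ᵐ ω ∂P, X ω = That (W ω) := by
  have hd1 : 1 ≤ d := one_le_two.trans hd
  have hτ := isTraceOperator_trace g
  have := hW.gaussian.isGaussian_map
  obtain ⟨T, hT⟩ := exists_bvp_operator hd1 hD hτ hlam hβ.le bc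
  obtain ⟨I, hI, hIincl⟩ := hW.exists_equiv
  obtain ⟨b⟩ := exists_hilbertBasis_L2 g
  let e₀ : HilbertBasis ℕ ℝ (CameronMartin (P.map W)) := HilbertBasis.ofRepr (I.trans b.repr)
  obtain ⟨That, hm, hext⟩ := CameronMartin.exists_isMeasurableLinearExtension e₀
    (toHNeg r D ∘L H1.toL2 D ∘L T ∘L I.toContinuousLinearEquiv.toContinuousLinearMap) fun e =>
      CameronMartin.ae_exists_tendsto_HNeg hW.gaussian.integral_map_eq_zero e _
        (summable_sq_norm_toHNeg hd1 hD hτ hr e.orthonormal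
          (T ∘L I.toContinuousLinearEquiv.toContinuousLinearMap))
  have hThat := CameronMartin.apply_ae_eq_dualComp e₀ _ (hext e₀).2
  exact ⟨T, I, That, hT, hIincl, hext,
    isSolution_extension g (fun f => (hT f _).2 rfl) hW hI hm hThat,
    fun X hX => hX.ae_eq_extension hT hW hI hThat⟩
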